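/- Let $(M,\omega)$ be a symplectic manifold (smooth, finite dimensional, Hausdorff), $\hbar>0$, and let $L\to M$ be a smooth complex line bundle with a smooth connection $\nabla$ whose curvature is $\hbar^{-1}\omega$, in the normalization $[\nabla_X,\nabla_Y]-\nabla_{[X,Y]}=-\sqrt{-1}\,\hbar^{-1}\omega(X,Y)$ (so that $d-\sqrt{-1}\hbar^{-1}\theta$ has curvature $\hbar^{-1}d\theta$). Let $\mathcal PM$ be the space of smooth paths $\gamma:[0,1]\to M$, let $\mathrm{ev}_0(\gamma)=\gamma(0)$, and let $\lambda$ be the one-form on $\mathcal PM$ given, for a vector field $v$ along $\gamma$, by $$\lambda_\gamma(v)=\int_0^1\Big(\int_0^t\omega(\dot\gamma(\tau),v(\tau))\,d\tau\Big)dt .$$ Let $\widetilde\nabla=\mathrm{ev}_0^*\nabla-\sqrt{-1}\,\hbar^{-1}\lambda$, a connection on $\mathrm{ev}_0^*L\to\mathcal PM$. Let $\Gamma:[0,1]\to\mathcal PM$ be a smooth loop, that is, a smooth map $\Gamma:[0,1]^2\to M$, $(s,t)\mapsto\Gamma(s,t)=\Gamma_s(t)=\Gamma^t(s)$, with $\Gamma_0=\Gamma_1$;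 so every longitudinal path $\Gamma^t$ is a loop in $M$. An oriented surface in $M$ is given by finitely many smooth oriented patches $[0,1]^2\to M$. It spans a loop if its oriented boundary, as a smooth integral one-chain modulo reparametrization and subdivision of paths, is that loop. 1. Let $U\subset M$ be open and let $\theta$ be a smooth one-form on $U$ with $\omega|_U=d\theta$, such that the image of $\Gamma$ lies in $U$. Suppose that $L|_U$ has a smooth nowhere vanishing section with respect to which $\nabla=d-\sqrt{-1}\hbar^{-1}\theta$, or that at least one of the loops $\Gamma^t$ is spanned by an oriented surface contained in $U$. Then the holonomy of $\widetilde\nabla$ around $\Gamma$ is $$\exp\Big(\frac{\sqrt{-1}}{\hbar}\int_0^1dt\oint_{\Gamma^t}\theta\Big).$$ 2. In general, let $(\Sigma_t)_{t\in[0,1]}$ be oriented surfaces in $M$ such that $\Sigma_t$ spans $\Gamma^t$ for every $t$ and $t\mapsto\int_{\Sigma_t}\omega$ is continuous. Then the holonomy of $\widetilde\nabla$ around $\Gamma$ is $$\exp\Big(\frac{\sqrt{-1}}{\hbar}\int_0^1dt\int_{\Sigma_t}\omega\Big).$$ In particular this holds for $\Sigma_t=G_t$, $G_t(a,b)=G(a,b)(t)$,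 when $G:[0,1]^2\to\mathcal PM$ is a smooth parametrized surface, that is, a smooth map $[0,1]^3\to M$, such that $G_t$ spans $\Gamma^t$ for every $t$. 3. The expression in 2 does not depend on the choice of the surfaces: if $\Sigma$ and $\Sigma'$ both span $\Gamma^t$, then $\int_\Sigma\omega-\int_{\Sigma'}\omega\in2\pi\hbar\,\mathbb Z$, and any two families $(\Sigma_t)$, $(\Sigma'_t)$ as in 2 give the same value of the exponential. -/

import Mathlib

open Set Bundle
open scoped Manifold ContDiff

noncomputable section

namespace PathHol

/-! ### Smooth paths, squares and cubes in a manifold -/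

section Cubes

variable (E : Type*) [NormedAddCommGroup E] [NormedSpace ℝ E]
  (M : Type*) [TopologicalSpace M] [ChartedSpace E M]

/-- The retraction of the real line onto `[0,1]`; it extends maps defined on `[0,1]`. -/
def clamp (r : ℝ) : unitInterval := projIcc 0 1 zero_le_one r

/-- A smooth path `[0,1] → M`. The type of smooth paths is the path space `𝒫M`. -/
@[ext] structure SmoothPath where
  toFun : unitInterval → M
  smooth : ContMDiffOn 𝓘(ℝ, ℝ) 𝓘(ℝ, E) ∞ (fun r : ℝ => toFun (clamp r)) (Icc 0 1)

/-- A smooth map `[0,1] × [0,1] → M`. Such a map `(s, t) ↦ Γ(s, t)` is also the same thing as a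
smooth path `s ↦ Γ_s` in the path space `𝒫M`, where `Γ_s(t) = Γ(s, t)`. -/
@[ext] structure SmoothSquare where
  toFun : unitInterval → unitInterval → M
  smooth : ContMDiffOn 𝓘(ℝ, ℝ × ℝ) 𝓘(ℝ, E) ∞
    (fun p : ℝ × ℝ => toFun (clamp p.1) (clamp p.2)) (Icc 0 1 ×ˢ Icc 0 1)

/-- A smooth map `[0,1] × [0,1] × [0,1] → M`. Such a map `(a, b, t) ↦ G(a, b)(t)` is the same
thing as a smooth parametrized surface `(a, b) ↦ G(a, b)` in the path space `𝒫M`. -/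
@[ext] structure SmoothCube where
  toFun : unitInterval → unitInterval → unitInterval → M
  smooth : ContMDiffOn 𝓘(ℝ, ℝ × ℝ × ℝ) 𝓘(ℝ, E) ∞
    (fun p : ℝ × ℝ × ℝ => toFun (clamp p.1) (clamp p.2.1) (clamp p.2.2))
    (Icc 0 1 ×ˢ (Icc 0 1 ×ˢ Icc 0 1))

variable {E M}

/-- A smooth path, extended from `[0,1]` to `ℝ` by its end values. -/
def SmoothPath.ext' (γ : SmoothPath E M) (r : ℝ) : M := γ.toFun (clamp r)

/-- A smooth square, extended from `[0,1]²` to `ℝ²`. -/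
def SmoothSquare.ext' (u : SmoothSquare E M) (a b : ℝ) : M := u.toFun (clamp a) (clamp b)

theorem clamp_coe (a : unitInterval) : clamp (a : ℝ) = a := projIcc_val zero_le_one a

/-- The path `b ↦ u(a, b)`. For a path `Γ` in the path space this is the transversal path `Γ_a`,
i.e. the value of `Γ` at `a`. -/
def SmoothSquare.fst (u : SmoothSquare E M) (a : unitInterval) : SmoothPath E M where
  toFun b := u.toFun a b
  smooth := by
    have h : ContMDiffOn 𝓘(ℝ, ℝ) 𝓘(ℝ, ℝ × ℝ) ∞ (fun r : ℝ => ((a : ℝ), r)) (Icc 0 1) :=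
      (contDiff_const.prodMk contDiff_id).contMDiff.contMDiffOn
    have h2 := u.smooth.comp h (fun r hr => ⟨a.2, hr⟩)
    simpa [Function.comp_def, clamp_coe] using h2

/-- The path `a ↦ u(a, b)`. For a path `Γ` in the path space this is the longitudinal
path `Γ^b`. -/
def SmoothSquare.snd (u : SmoothSquare E M) (b : unitInterval) : SmoothPath E M where
  toFun a := u.toFun a b
  smooth := by
    have h : ContMDiffOn 𝓘(ℝ, ℝ) 𝓘(ℝ, ℝ × ℝ) ∞ (fun r : ℝ => (r, (b : ℝ))) (Icc 0 1) :=
      (contDiff_id.prodMk contDiff_const).contMDiff.contMDiffOn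
    have h2 := u.smooth.comp h (fun r hr => ⟨hr, b.2⟩)
    simpa [Function.comp_def, clamp_coe] using h2

/-- The surface `G_t(a, b) = G(a, b)(t)` in `M`. -/
def SmoothCube.slice (G : SmoothCube E M) (t : unitInterval) : SmoothSquare E M where
  toFun a b := G.toFun a b t
  smooth := by
    have h : ContMDiffOn 𝓘(ℝ, ℝ × ℝ) 𝓘(ℝ, ℝ × ℝ × ℝ) ∞
        (fun p : ℝ × ℝ => (p.1, p.2, (t : ℝ))) (Icc 0 1 ×ˢ Icc 0 1) :=
      (contDiff_fst.prodMk (contDiff_snd.prodMk contDiff_const)).contMDiff.contMDiffOn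
    have h2 := G.smooth.comp h (fun p hp => ⟨hp.1, hp.2, t.2⟩)
    simpa [Function.comp_def, clamp_coe] using h2

variable (E) in
/-- The velocity at `r ∈ [0,1]` of a curve in `M` parametrized by `[0,1]`. -/
def velocity (c : ℝ → M) (r : ℝ) : TangentSpace 𝓘(ℝ, E) (c r) :=
  mfderivWithin 𝓘(ℝ, ℝ) 𝓘(ℝ, E) c (Icc 0 1) r (1 : ℝ)

/-- The partial derivative `∂u/∂a` at `(a, b) ∈ [0,1]²`. -/
def SmoothSquare.d1 (u : SmoothSquare E M) (a b : ℝ) : TangentSpace 𝓘(ℝ, E) (u.ext' a b) :=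
  velocity E (fun r => u.ext' r b) a

/-- The partial derivative `∂u/∂b` at `(a, b) ∈ [0,1]²`. -/
def SmoothSquare.d2 (u : SmoothSquare E M) (a b : ℝ) : TangentSpace 𝓘(ℝ, E) (u.ext' a b) :=
  velocity E (fun r => u.ext' a r) b

/-- A path `Γ` in the path space is a loop when `Γ_0 = Γ_1`. -/
def SmoothSquare.IsLoop (Γ : SmoothSquare E M) : Prop := Γ.fst 0 = Γ.fst 1

end Cubes

/-! ### One-forms, two-forms, symplectic forms -/

section Forms

variable (E : Type*) [NormedAddCommGroup E] [NormedSpace ℝ E]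
  (M : Type*) [TopologicalSpace M] [ChartedSpace E M]

/-- A (not necessarily smooth) one-form on `M`. -/
abbrev OneForm := (x : M) → TangentSpace 𝓘(ℝ, E) x →L[ℝ] ℝ

/-- A (not necessarily smooth) field of bilinear forms on `M`. -/
abbrev BilinForm := (x : M) → TangentSpace 𝓘(ℝ, E) x →L[ℝ] TangentSpace 𝓘(ℝ, E) x →L[ℝ] ℝ

variable {E M}

/-- The one-form `θ`, read in the preferred chart `φ` at `x`: the pull-back `(φ⁻¹)^* θ`. -/
def OneForm.inChart (θ : OneForm E M) (x : M) (y : E) : E →L[ℝ] ℝ :=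
  (θ ((extChartAt 𝓘(ℝ, E) x).symm y)).comp
    (mfderiv 𝓘(ℝ, E) 𝓘(ℝ, E) (extChartAt 𝓘(ℝ, E) x).symm y)

/-- The exterior derivative `(dθ)_x(v, w)`, computed in the preferred chart at `x`. -/
def OneForm.d (θ : OneForm E M) (x : M) (v w : TangentSpace 𝓘(ℝ, E) x) : ℝ :=
  let φ := extChartAt 𝓘(ℝ, E) x
  let v' : E := mfderiv 𝓘(ℝ, E) 𝓘(ℝ, E) φ x v
  let w' : E := mfderiv 𝓘(ℝ, E) 𝓘(ℝ, E) φ x w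
  fderiv ℝ (θ.inChart x) (φ x) v' w' - fderiv ℝ (θ.inChart x) (φ x) w' v'

/-- Smoothness of a one-form on a set. -/
def OneForm.SmoothOn [IsManifold 𝓘(ℝ, E) ∞ M] (θ : OneForm E M) (U : Set M) : Prop :=
  ContMDiffOn 𝓘(ℝ, E) (𝓘(ℝ, E).prod 𝓘(ℝ, E →L[ℝ] ℝ)) ∞
    (fun x => (TotalSpace.mk' (E →L[ℝ] ℝ) x (θ x) :
      TotalSpace (E →L[ℝ] ℝ) (fun x : M => TangentSpace 𝓘(ℝ, E) x →L[ℝ] ℝ))) U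

/-- A field of bilinear forms, read in the preferred chart at `x`, evaluated on two vectors. -/
def BilinForm.inChart (Ω : BilinForm E M) (x : M) (v w : E) (y : E) : ℝ :=
  let ψ := (extChartAt 𝓘(ℝ, E) x).symm
  Ω (ψ y) (mfderiv 𝓘(ℝ, E) 𝓘(ℝ, E) ψ y v) (mfderiv 𝓘(ℝ, E) 𝓘(ℝ, E) ψ y w)

/-- A symplectic form on `M`: a smooth alternating two-form which is closed and nondegenerate. -/
structure IsSymplectic [IsManifold 𝓘(ℝ, E) ∞ M] (Ω : BilinForm E M) : Prop where
  alternating : ∀ x v, Ω x v v = 0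
  smooth : ContMDiff 𝓘(ℝ, E) (𝓘(ℝ, E).prod 𝓘(ℝ, E →L[ℝ] E →L[ℝ] ℝ)) ∞
    (fun x => (TotalSpace.mk' (E →L[ℝ] E →L[ℝ] ℝ) x (Ω x) :
      TotalSpace (E →L[ℝ] E →L[ℝ] ℝ)
        (fun x : M => TangentSpace 𝓘(ℝ, E) x →L[ℝ] TangentSpace 𝓘(ℝ, E) x →L[ℝ] ℝ)))
  closed : ∀ (x : M) (u v w : E),
    let y := extChartAt 𝓘(ℝ, E) x x
    fderiv ℝ (BilinForm.inChart Ω x v w) y u + fderiv ℝ (BilinForm.inChart Ω x w u) y v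
      + fderiv ℝ (BilinForm.inChart Ω x u v) y w = 0
  nondegenerate : ∀ x v, (∀ w, Ω x v w = 0) → v = 0

/-- `θ` is a symplectic potential for `Ω` on `U`: it is smooth and `Ω = dθ` there. -/
def IsPotentialOn [IsManifold 𝓘(ℝ, E) ∞ M] (Ω : BilinForm E M) (θ : OneForm E M)
    (U : Set M) : Prop :=
  θ.SmoothOn U ∧ ∀ x ∈ U, ∀ v w, θ.d x v w = Ω x v w

/-- The line integral `∫_γ θ`. -/
def lineIntegral (θ : OneForm E M) (γ : SmoothPath E M) : ℝ :=
  ∫ r in (0 : ℝ)..1, θ (γ.ext' r) (velocity E γ.ext' r)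

/-- The integral of a two-form over a parametrized square,
`∫∫ Ω(∂_a u, ∂_b u) da db`. -/
def squareIntegral (Ω : BilinForm E M) (u : SmoothSquare E M) : ℝ :=
  ∫ a in (0 : ℝ)..1, ∫ b in (0 : ℝ)..1, Ω (u.ext' a b) (u.d1 a b) (u.d2 a b)

end Forms

/-! ### Oriented surfaces and their boundaries -/

section Surfaces

variable (E : Type*) [NormedAddCommGroup E] [NormedSpace ℝ E]
  (M : Type*) [TopologicalSpace M] [ChartedSpace E M]

/-- A smooth map `[0,1] → [0,1]`, not necessarily monotone. -/
def IsReparam (φ : unitInterval → unitInterval) : Prop :=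
  ContDiffOn ℝ ∞ (fun r : ℝ => (φ (clamp r) : ℝ)) (Icc 0 1)

/-- Subdivision relations between smooth paths: `q₁ + q₂ = q₃` whenever the `qᵢ` run along one
smooth path `p`, `q₁` from parameter `a` to `b`, `q₂` from `b` to `c`, and `q₃` from `a` to `c`.
In particular constant paths are `0`, reversing a path changes its sign, a path is unchanged under
reparametrization, and a path is the sum of the pieces of a subdivision. -/
def subdivisionRelations : Set (FreeAbelianGroup (SmoothPath E M)) :=
  {z | ∃ (p q₁ q₂ q₃ : SmoothPath E M) (φ₁ φ₂ φ₃ : unitInterval → unitInterval),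
    IsReparam φ₁ ∧ IsReparam φ₂ ∧ IsReparam φ₃ ∧
    q₁.toFun = p.toFun ∘ φ₁ ∧ q₂.toFun = p.toFun ∘ φ₂ ∧ q₃.toFun = p.toFun ∘ φ₃ ∧
    φ₁ 0 = φ₃ 0 ∧ φ₁ 1 = φ₂ 0 ∧ φ₂ 1 = φ₃ 1 ∧
    z = FreeAbelianGroup.of q₁ + FreeAbelianGroup.of q₂ - FreeAbelianGroup.of q₃}

/-- Integral smooth one-chains, modulo reparametrization and subdivision. -/
abbrev OneChain :=
  FreeAbelianGroup (SmoothPath E M) ⧸ AddSubgroup.closure (subdivisionRelations E M)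

/-- A compact oriented surface in `M`, given by finitely many smooth oriented patches
`[0,1]² → M`. Every compact oriented surface with a smooth map to `M` is of this form, by cutting it
into squares; how the patches are glued is recorded by the cancellation of common edges in the
boundary. -/
abbrev OrientedSurface := List (SmoothSquare E M)

variable {E M}

/-- The one-chain of a smooth path. -/
def SmoothPath.chain (γ : SmoothPath E M) : OneChain E M :=
  QuotientAddGroup.mk (FreeAbelianGroup.of γ)

/-- The boundary of a square, traversed counterclockwise in the `(a, b)`-plane. -/
def SmoothSquare.boundary (u : SmoothSquare E M) : OneChain E M :=
  (u.snd 0).chain + (u.fst 1).chain - (u.snd 1).chain - (u.fst 0).chain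

/-- The oriented boundary of a surface. -/
def surfaceBoundary (S : OrientedSurface E M) : OneChain E M :=
  (S.map SmoothSquare.boundary).sum

/-- The surface `S` spans the loop `γ`: its oriented boundary is `γ`. -/
def Spans (S : OrientedSurface E M) (γ : SmoothPath E M) : Prop :=
  surfaceBoundary S = γ.chain

/-- The integral `∫_S Ω`. -/
def surfaceIntegral (Ω : BilinForm E M) (S : OrientedSurface E M) : ℝ :=
  (S.map (squareIntegral Ω)).sum

end Surfaces

/-! ### Connections on complex line bundles -/

section Connections

variable {E : Type*} [NormedAddCommGroup E] [NormedSpace ℝ E]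
  {M : Type*} [TopologicalSpace M] [ChartedSpace E M]
  {L : M → Type*} [TopologicalSpace (TotalSpace ℂ L)] [∀ x, TopologicalSpace (L x)]
  [∀ x, AddCommGroup (L x)] [∀ x, Module ℂ (L x)]
  [∀ x, IsTopologicalAddGroup (L x)] [∀ x, ContinuousSMul ℝ (L x)]
  [FiberBundle ℂ L]

/-- A covariant derivative on a complex line bundle is a smooth complex connection when it is
complex linear on sections and maps smooth sections to smooth sections. -/
structure IsSmoothComplexConnection [IsManifold 𝓘(ℝ, E) ∞ M] [VectorBundle ℝ ℂ L]
    (cov : CovariantDerivative 𝓘(ℝ, E) ℂ L) : Prop where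
  smooth : CovariantDerivative.ContMDiffCovariantDerivative cov ∞
  complexLinear : ∀ (σ : (x : M) → L x) (x : M),
    MDifferentiableAt 𝓘(ℝ, E) (𝓘(ℝ, E).prod 𝓘(ℝ, ℂ)) (fun y => TotalSpace.mk' ℂ y (σ y)) x →
    ∀ v, cov (fun y => Complex.I • σ y) x v = Complex.I • cov σ x v

/-- The connection has curvature `ħ⁻¹Ω`, in the normalization in which `d - √-1 ħ⁻¹θ` has
curvature `ħ⁻¹dθ`, i.e.
`∇_X ∇_Y σ - ∇_Y ∇_X σ - ∇_[X,Y] σ = -√-1 ħ⁻¹ Ω(X, Y) σ`. -/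
def HasCurvature [IsManifold 𝓘(ℝ, E) ∞ M] (cov : CovariantDerivative 𝓘(ℝ, E) ℂ L) (ħ : ℝ)
    (Ω : BilinForm E M) : Prop :=
  ∀ (X Y : (x : M) → TangentSpace 𝓘(ℝ, E) x) (σ : (x : M) → L x),
    ContMDiff 𝓘(ℝ, E) (𝓘(ℝ, E).prod 𝓘(ℝ, E)) ∞
      (fun x => (TotalSpace.mk' E x (X x) : TangentBundle 𝓘(ℝ, E) M)) →
    ContMDiff 𝓘(ℝ, E) (𝓘(ℝ, E).prod 𝓘(ℝ, E)) ∞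
      (fun x => (TotalSpace.mk' E x (Y x) : TangentBundle 𝓘(ℝ, E) M)) →
    ContMDiff 𝓘(ℝ, E) (𝓘(ℝ, E).prod 𝓘(ℝ, ℂ)) ∞ (fun x => TotalSpace.mk' ℂ x (σ x)) →
    ∀ x : M,
      cov (fun y => cov σ y (Y y)) x (X x) - cov (fun y => cov σ y (X y)) x (Y x)
        - cov σ x (VectorField.mlieBracket 𝓘(ℝ, E) X Y x)
      = (-(Complex.I / (ħ : ℂ)) * ((Ω x (X x) (Y x) : ℝ) : ℂ)) • σ x

/-- On `U` the connection is `d - √-1 ħ⁻¹θ` with respect to a smooth trivialization of the line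
bundle over `U`, given by a nowhere vanishing section. -/
def IsConnectionFormOn (cov : CovariantDerivative 𝓘(ℝ, E) ℂ L) (ħ : ℝ) (θ : OneForm E M)
    (U : Set M) : Prop :=
  ∃ σ : (x : M) → L x,
    ContMDiffOn 𝓘(ℝ, E) (𝓘(ℝ, E).prod 𝓘(ℝ, ℂ)) ∞ (fun x => TotalSpace.mk' ℂ x (σ x)) U ∧
    (∀ x ∈ U, σ x ≠ 0) ∧
    ∀ x ∈ U, ∀ v, cov σ x v = (-(Complex.I / (ħ : ℂ)) * ((θ x v : ℝ) : ℂ)) • σ x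

/-- The covariant derivative at `r ∈ [0,1]` of a section `ξ` of the line bundle along a curve `c`,
i.e. the derivative of `ξ` for the pull-back connection `c^*∇`. If `ξ = f · σ` near `r`, with `σ`
the frame of the preferred trivialization at `c r`, it is `f' · σ + f · ∇_{c'} σ`. -/
def covDerivAlong (cov : CovariantDerivative 𝓘(ℝ, E) ℂ L) (c : ℝ → M) (ξ : (r : ℝ) → L (c r))
    (r : ℝ) : L (c r) :=
  let e := trivializationAt ℂ L (c r)
  let σ : (y : M) → L y := fun y => e.symm y 1
  let f : ℝ → ℂ := fun q => (e (TotalSpace.mk' ℂ (c q) (ξ q))).2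
  derivWithin f (Icc 0 1) r • σ (c r) + f r • cov σ (c r) (velocity E c r)

/-- The one-form `λ` on the path space: for a tangent vector `v` at `γ`, that is a vector field
along `γ`, `λ_γ(v) = ∫_0^1 (∫_0^t Ω(γ'(τ), v(τ)) dτ) dt`. -/
def lambdaForm (Ω : BilinForm E M) (γ : SmoothPath E M)
    (v : (t : ℝ) → TangentSpace 𝓘(ℝ, E) (γ.ext' t)) : ℝ :=
  ∫ t in (0 : ℝ)..1, ∫ τ in (0 : ℝ)..t, Ω (γ.ext' τ) (velocity E γ.ext' τ) (v τ)

/-- The tangent vector `Γ'(s)` of a path `Γ` in the path space: the vector field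
`t ↦ ∂Γ/∂s (s, t)` along `Γ_s`. -/
def SmoothSquare.tangent (Γ : SmoothSquare E M) (s : ℝ) (t : ℝ) :
    TangentSpace 𝓘(ℝ, E) ((Γ.fst (clamp s)).ext' t) := Γ.d1 s t

/-- The curve `ev_0 ∘ Γ` in `M`. -/
def SmoothSquare.ev0 (Γ : SmoothSquare E M) (s : ℝ) : M := (Γ.fst (clamp s)).ext' 0

/-- The covariant derivative of a section `ξ` of `ev_0^* L` along a path `Γ` in the path space,
for the connection `ev_0^* ∇ - √-1 ħ⁻¹ λ`. -/
def pathCovDeriv (cov : CovariantDerivative 𝓘(ℝ, E) ℂ L) (ħ : ℝ) (Ω : BilinForm E M)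
    (Γ : SmoothSquare E M) (ξ : (s : ℝ) → L (Γ.ev0 s)) (s : ℝ) : L (Γ.ev0 s) :=
  covDerivAlong cov Γ.ev0 ξ s
    - (Complex.I / (ħ : ℂ) * ((lambdaForm Ω (Γ.fst (clamp s)) (Γ.tangent s) : ℝ) : ℂ)) • ξ s

/-- Sections of `ev_0^* L` along `Γ` that are parallel for `ev_0^* ∇ - √-1 ħ⁻¹ λ`. Only the values
of `ξ` on `[0,1]` matter. -/
def IsParallel (cov : CovariantDerivative 𝓘(ℝ, E) ℂ L) (ħ : ℝ) (Ω : BilinForm E M)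
    (Γ : SmoothSquare E M) (ξ : (s : ℝ) → L (Γ.ev0 s)) : Prop :=
  MDifferentiableOn 𝓘(ℝ, ℝ) (𝓘(ℝ, E).prod 𝓘(ℝ, ℂ))
    (fun s : ℝ => TotalSpace.mk' ℂ (Γ.ev0 s) (ξ s)) (Icc 0 1) ∧
  ∀ s ∈ Icc (0 : ℝ) 1, pathCovDeriv cov ħ Ω Γ ξ s = 0

/-- `h` is the holonomy of `ev_0^* ∇ - √-1 ħ⁻¹ λ` around the loop `Γ` in the path space: parallel
transport around `Γ` exists and is multiplication by `h`. -/
def HasHolonomy (cov : CovariantDerivative 𝓘(ℝ, E) ℂ L) (ħ : ℝ) (Ω : BilinForm E M)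
    (Γ : SmoothSquare E M) (h : ℂ) : Prop :=
  (∀ v : L (Γ.ev0 0), ∃ ξ : (s : ℝ) → L (Γ.ev0 s), IsParallel cov ħ Ω Γ ξ ∧ ξ 0 = v) ∧
  ∀ ξ : (s : ℝ) → L (Γ.ev0 s), IsParallel cov ħ Ω Γ ξ →
    TotalSpace.mk' ℂ (Γ.ev0 1) (ξ 1) = TotalSpace.mk' ℂ (Γ.ev0 0) (h • ξ 0)

end Connections

/-- The number `exp((√-1/ħ) x)`. -/
def phase (ħ x : ℝ) : ℂ := Complex.exp (Complex.I / (ħ : ℂ) * (x : ℂ))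

/-- The integral `∫_0^1 dt ∫_{S_t} Ω` for a family of surfaces. -/
def familyIntegral {E : Type*} [NormedAddCommGroup E] [NormedSpace ℝ E]
    {M : Type*} [TopologicalSpace M] [ChartedSpace E M]
    (Ω : BilinForm E M) (S : unitInterval → OrientedSurface E M) : ℝ :=
  ∫ t in (0 : ℝ)..1, surfaceIntegral Ω (S (clamp t))

/-- A family `(S_t)` of oriented surfaces such that `S_t` spans the longitudinal loop `Γ^t` for
every `t` and `∫_{S_t} Ω` depends continuously on `t`. -/
def IsSpanningFamily {E : Type*} [NormedAddCommGroup E] [NormedSpace ℝ E]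
    {M : Type*} [TopologicalSpace M] [ChartedSpace E M]
    (Ω : BilinForm E M) (Γ : SmoothSquare E M) (S : unitInterval → OrientedSurface E M) : Prop :=
  (∀ t, Spans (S t) (Γ.snd t)) ∧ Continuous (fun t => surfaceIntegral Ω (S t))

end PathHol

end

/-! Everything is controlled by one number, the parallel transport `transport` of the connection
along a path of `M`, read in the preferred trivializations at the two end points. It is
multiplicative under subdivision and invariant under reparametrization, so it extends to a
homomorphism from one-chains to the multiplicative group (`exists_transportHom`). On a rectangle
inside one trivialization the curvature identity says that the exterior derivative of the connection
form is a multiple of the symplectic form. Stokes and gluing of rectangles then show that the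
transport around any smooth square is the phase of its symplectic area (`transport_rectangle`).
Hence the transport around a loop spanned by a surface is the phase of the area of the surface
(`transport_eq_phase_of_spans`), and two areas spanning the same loop differ by a multiple of `2πħ`.

On the path space, subtracting `√-1 ħ⁻¹λ` multiplies the transport of the initial points by the
phase of the integral of `λ` along the loop (`hasHolonomy_transport`). By Fubini that integral is
minus the average over `t` of `flux`, the symplectic area of `Γ` over `[0,1] × [0,t]`
(`integral_lam`). Since `Γ_0 = Γ_1`, the transverse edges of this rectangle cancel, and the
transports around `Γ^0` and `Γ^t` differ by the phase of the same flux (`transport_snd_of_isLoop`).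
If `g` is a continuous logarithm of the transport around `Γ^t`, then `g t + flux t - g 0` is
continuous with values in a lattice and vanishes at `t = 0`, so `g t = g 0 - flux t`. Averaging over
`t` identifies the holonomy with the phase of the integral of `g`
(`hasHolonomy_of_transport_eq_phase`). The general case takes for `g` the areas of the spanning
surfaces.

For a symplectic potential, `g` is the line integral over `Γ^t`, which satisfies the same relation
with the flux by Stokes. It therefore suffices to know that it computes the transport for a single
`t`. This must be supplied: the given connection and `d - √-1 ħ⁻¹θ` have equal curvature on `U`, but
may differ by a flat connection with holonomy. Either a frame in which they agree, or one loop
spanned inside `U`, removes the ambiguity (`hasHolonomy_lineIntegral`). -/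

noncomputable section

set_option linter.unusedSectionVars false

namespace PathHol

open Filter Topology MeasureTheory

/-! ### One-forms and velocities read in charts -/

section ChartForms

variable {E : Type*} [NormedAddCommGroup E] [NormedSpace ℝ E]
  {M : Type*} [TopologicalSpace M] [ChartedSpace E M]
  {F : Type*} [NormedAddCommGroup F] [NormedSpace ℝ F]

variable (E) in
/-- The preferred chart at `x`. -/
abbrev chartMap (x : M) : M → E := extChartAt 𝓘(ℝ, E) x

variable (E) in
/-- The derivative of the inverse of the preferred chart at `x`, with the tangent spaces of `M`
identified with the model space. -/
def symmDeriv (x : M) (y : E) : E →L[ℝ] E :=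
  mfderiv 𝓘(ℝ, E) 𝓘(ℝ, E) (extChartAt 𝓘(ℝ, E) x).symm y

variable (E) in
/-- The velocity of a curve, as an element of the model space. -/
def vel (c : ℝ → M) (r : ℝ) : E := velocity E c r

/-- A vector-valued one-form, read in the preferred chart at `x`. -/
def formInChart (α : M → E →L[ℝ] F) (x : M) (y : E) : E →L[ℝ] F :=
  (α ((extChartAt 𝓘(ℝ, E) x).symm y)).comp (symmDeriv E x y)

theorem formInChart_chartMap (α : M → E →L[ℝ] F) {x y : M}
    (hy : y ∈ (extChartAt 𝓘(ℝ, E) x).source) (w : E) :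
    formInChart α x (chartMap E x y) w = α y (symmDeriv E x (chartMap E x y) w) := by
  rw [formInChart, chartMap, (extChartAt 𝓘(ℝ, E) x).left_inv hy]
  rfl

variable [IsManifold 𝓘(ℝ, E) ∞ M]

theorem mdifferentiableAt_chart_symm {x : M} {y : E}
    (hy : y ∈ (extChartAt 𝓘(ℝ, E) x).target) :
    MDifferentiableAt 𝓘(ℝ, E) 𝓘(ℝ, E) (extChartAt 𝓘(ℝ, E) x).symm y := by
  have : IsManifold 𝓘(ℝ, E) 1 M := IsManifold.of_le (n := ∞) (by simp)
  have := mdifferentiableWithinAt_extChartAt_symm (I := 𝓘(ℝ, E)) hy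
  rwa [modelWithCornersSelf_coe, range_id, mdifferentiableWithinAt_univ] at this

theorem contDiffWithinAt_chartMap_comp {G : Type*} [NormedAddCommGroup G] [NormedSpace ℝ G]
    {c : G → M} {s : Set G} {p : G} {x : M}
    (hc : ContMDiffWithinAt 𝓘(ℝ, G) 𝓘(ℝ, E) ∞ c s p)
    (hx : c p ∈ (extChartAt 𝓘(ℝ, E) x).source) :
    ContDiffWithinAt ℝ ∞ (fun q => chartMap E x (c q)) s p := by
  rw [← contMDiffWithinAt_iff_contDiffWithinAt]
  have h : ContMDiffAt 𝓘(ℝ, E) 𝓘(ℝ, E) ∞ (extChartAt 𝓘(ℝ, E) x) (c p) :=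
    contMDiffAt_extChartAt' (by simpa using hx)
  exact h.comp_contMDiffWithinAt p hc

/-- Near `r` the curve is the inverse chart composed with its own chart expression, so this is the
chain rule. The chart at `x` stays fixed while the point of the curve moves. -/
theorem vel_eq_symmDeriv {c : ℝ → M} {r : ℝ} {x : M} (hr : r ∈ Icc (0 : ℝ) 1)
    (hc : ContMDiffWithinAt 𝓘(ℝ, ℝ) 𝓘(ℝ, E) ∞ c (Icc 0 1) r)
    (hx : c r ∈ (extChartAt 𝓘(ℝ, E) x).source) :
    vel E c r = symmDeriv E x (chartMap E x (c r))
      (derivWithin (fun q => chartMap E x (c q)) (Icc 0 1) r) := by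
  have hu : UniqueMDiffWithinAt 𝓘(ℝ, ℝ) (Icc (0 : ℝ) 1) r :=
    ((uniqueDiffOn_Icc zero_lt_one) r hr).uniqueMDiffWithinAt
  have h1 : HasMFDerivAt 𝓘(ℝ, E) 𝓘(ℝ, E) (extChartAt 𝓘(ℝ, E) x).symm
      (extChartAt 𝓘(ℝ, E) x (c r)) _ :=
    (mdifferentiableAt_chart_symm ((extChartAt 𝓘(ℝ, E) x).map_source hx)).hasMFDerivAt
  have h2 : HasMFDerivWithinAt 𝓘(ℝ, ℝ) 𝓘(ℝ, E) (fun q => extChartAt 𝓘(ℝ, E) x (c q))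
      (Icc 0 1) r _ :=
    ((contDiffWithinAt_chartMap_comp hc hx).differentiableWithinAt
      (by simp)).hasFDerivWithinAt.hasMFDerivWithinAt
  have h3 := HasMFDerivAt.comp_hasMFDerivWithinAt r h1 h2
  have h4 : HasMFDerivWithinAt 𝓘(ℝ, ℝ) 𝓘(ℝ, E)
      ((extChartAt 𝓘(ℝ, E) x).symm ∘ fun q => extChartAt 𝓘(ℝ, E) x (c q)) (Icc 0 1) r
      (mfderivWithin 𝓘(ℝ, ℝ) 𝓘(ℝ, E) c (Icc 0 1) r) := by
    refine ((hc.mdifferentiableWithinAt (by simp)).hasMFDerivWithinAt).congr_of_eventuallyEq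
      ?_ ((extChartAt 𝓘(ℝ, E) x).left_inv hx)
    filter_upwards [hc.continuousWithinAt ((isOpen_extChartAt_source x).mem_nhds hx)] with q hq
    exact (extChartAt 𝓘(ℝ, E) x).left_inv hq
  have h5 := hu.eq h4 h3
  exact congrArg (fun A : ℝ →L[ℝ] E => A 1) h5

/-- The velocity of the image of a curve in a vector space under a smooth map. -/
theorem vel_comp_eq_symmDeriv {G : Type*} [NormedAddCommGroup G] [NormedSpace ℝ G] {f : G → M}
    {s : Set G} {ℓ : ℝ → G} {v : G} {r : ℝ} {x : M} (hr : r ∈ Icc (0 : ℝ) 1)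
    (hf : ContMDiffWithinAt 𝓘(ℝ, G) 𝓘(ℝ, E) ∞ f s (ℓ r)) (hℓ : ContDiff ℝ ∞ ℓ)
    (hv : HasDerivWithinAt ℓ v (Icc 0 1) r) (hs : MapsTo ℓ (Icc 0 1) s)
    (hx : f (ℓ r) ∈ (extChartAt 𝓘(ℝ, E) x).source) :
    vel E (fun q => f (ℓ q)) r = symmDeriv E x (chartMap E x (f (ℓ r)))
      (fderivWithin ℝ (fun q => chartMap E x (f q)) s (ℓ r) v) := by
  have hc : ContMDiffWithinAt 𝓘(ℝ, ℝ) 𝓘(ℝ, E) ∞ (fun q => f (ℓ q)) (Icc 0 1) r :=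
    hf.comp r (hℓ.contMDiff r).contMDiffWithinAt hs
  rw [vel_eq_symmDeriv hr hc hx]
  congr 1
  have h1 := ((contDiffWithinAt_chartMap_comp hf hx).differentiableWithinAt
    (by simp)).hasFDerivWithinAt
  exact (h1.comp_hasDerivWithinAt r hv hs).derivWithin (uniqueDiffOn_Icc zero_lt_one _ hr)

theorem apply_vel (α : M → E →L[ℝ] F) {c : ℝ → M} {r : ℝ} {x : M}
    (hr : r ∈ Icc (0 : ℝ) 1)
    (hc : ContMDiffWithinAt 𝓘(ℝ, ℝ) 𝓘(ℝ, E) ∞ c (Icc 0 1) r)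
    (hx : c r ∈ (extChartAt 𝓘(ℝ, E) x).source) :
    α (c r) (vel E c r) = formInChart α x (chartMap E x (c r))
      (derivWithin (fun q => chartMap E x (c q)) (Icc 0 1) r) := by
  rw [formInChart_chartMap α hx, ← vel_eq_symmDeriv hr hc hx]

theorem symmDeriv_self (x : M) : symmDeriv E x (chartMap E x x) = ContinuousLinearMap.id ℝ E := by
  have : IsManifold 𝓘(ℝ, E) 1 M := IsManifold.of_le (n := ∞) (by simp)
  have h := mfderivWithin_range_extChartAt_symm (I := 𝓘(ℝ, E)) (x := x)
  rw [modelWithCornersSelf_coe, range_id, mfderivWithin_univ] at h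
  exact h

/-- The model vector `vel E c q` need not be continuous in `q`, because the tangent space at `c q`
is identified with `E` by a chart that changes with the point. The pairing with a form does not
depend on the chart, and is computed in the fixed chart at `c r`. -/
theorem continuousWithinAt_apply_vel {α : M → E →L[ℝ] F} {c : ℝ → M} {r : ℝ}
    (hr : r ∈ Icc (0 : ℝ) 1) (hc : ContMDiffOn 𝓘(ℝ, ℝ) 𝓘(ℝ, E) ∞ c (Icc 0 1))
    (hα : ContinuousAt (formInChart α (c r)) (chartMap E (c r) (c r))) :
    ContinuousWithinAt (fun q => α (c q) (vel E c q)) (Icc 0 1) r := by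
  have hx : c r ∈ (extChartAt 𝓘(ℝ, E) (c r)).source := mem_extChartAt_source _
  have hd := contDiffWithinAt_chartMap_comp (hc r hr) hx
  have h1 : ContinuousWithinAt (fun q => formInChart α (c r) (chartMap E (c r) (c q))
      (derivWithin (fun q => chartMap E (c r) (c q)) (Icc 0 1) q)) (Icc 0 1) r := by
    refine ContinuousWithinAt.clm_apply ?_ ?_
    · exact hα.comp_continuousWithinAt (f := fun q => chartMap E (c r) (c q)) hd.continuousWithinAt
    · have := (hd.fderivWithin_right (m := ∞) (uniqueDiffOn_Icc zero_lt_one) (by simp)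
        hr).continuousWithinAt
      exact this.clm_apply continuousWithinAt_const
  refine h1.congr_of_eventuallyEq ?_ (apply_vel α hr (hc r hr) hx)
  filter_upwards [(hc r hr).continuousWithinAt ((isOpen_extChartAt_source _).mem_nhds hx),
    self_mem_nhdsWithin] with q hq hq1
  exact apply_vel α hq1 (hc q hq1) hq

end ChartForms

/-! ### Smooth squares and Stokes' theorem on rectangles -/

section Squares

variable {E : Type*} [NormedAddCommGroup E] [NormedSpace ℝ E]
  {M : Type*} [TopologicalSpace M] [ChartedSpace E M]
  {F : Type*} [NormedAddCommGroup F] [NormedSpace ℝ F]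

/-- The unit square. -/
abbrev unitSquare : Set (ℝ × ℝ) := Icc (0 : ℝ) 1 ×ˢ Icc (0 : ℝ) 1

theorem uniqueDiffOn_unitSquare : UniqueDiffOn ℝ unitSquare :=
  (uniqueDiffOn_Icc zero_lt_one).prod (uniqueDiffOn_Icc zero_lt_one)

theorem continuous_clamp : Continuous clamp := continuous_projIcc (h := zero_le_one)

theorem SmoothPath.contMDiffOn_ext (γ : SmoothPath E M) :
    ContMDiffOn 𝓘(ℝ, ℝ) 𝓘(ℝ, E) ∞ γ.ext' (Icc 0 1) := γ.smooth

theorem coe_clamp {r : ℝ} (hr : r ∈ Icc (0 : ℝ) 1) : (clamp r : ℝ) = r := by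
  simp [clamp, projIcc_of_mem _ hr]

theorem clamp_clamp (r : ℝ) : clamp (clamp r : ℝ) = clamp r := clamp_coe _

theorem SmoothPath.continuous_ext (γ : SmoothPath E M) : Continuous γ.ext' := by
  have h : γ.ext' = (Icc (0 : ℝ) 1).domRestrict γ.ext' ∘ clamp := by
    ext r
    simp [SmoothPath.ext', Set.domRestrict, clamp_clamp]
  rw [h]
  exact (continuousOn_iff_continuous_domRestrict.1 γ.contMDiffOn_ext.continuousOn).comp
    continuous_clamp

theorem SmoothSquare.contMDiffOn_ext (u : SmoothSquare E M) :
    ContMDiffOn 𝓘(ℝ, ℝ × ℝ) 𝓘(ℝ, E) ∞ (fun p : ℝ × ℝ => u.ext' p.1 p.2) unitSquare := u.smooth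

theorem SmoothSquare.continuous_ext (u : SmoothSquare E M) :
    Continuous (fun p : ℝ × ℝ => u.ext' p.1 p.2) := by
  have h : (fun p : ℝ × ℝ => u.ext' p.1 p.2) = unitSquare.domRestrict (fun p => u.ext' p.1 p.2) ∘
      (fun p : ℝ × ℝ => (⟨((clamp p.1 : ℝ), (clamp p.2 : ℝ)),
        ⟨(clamp p.1).2, (clamp p.2).2⟩⟩ : unitSquare)) := by
    ext r
    simp [SmoothSquare.ext', Set.domRestrict, clamp_clamp]
  rw [h]
  refine (continuousOn_iff_continuous_domRestrict.1 u.contMDiffOn_ext.continuousOn).comp ?_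
  refine Continuous.subtype_mk ?_ _
  exact ((continuous_subtype_val.comp continuous_clamp).comp continuous_fst).prodMk
    ((continuous_subtype_val.comp continuous_clamp).comp continuous_snd)

/-- The partial derivatives of a square, as elements of the model space. -/
def SmoothSquare.e1 (u : SmoothSquare E M) (p : ℝ × ℝ) : E := vel E (fun r => u.ext' r p.2) p.1

/-- The partial derivatives of a square, as elements of the model space. -/
def SmoothSquare.e2 (u : SmoothSquare E M) (p : ℝ × ℝ) : E := vel E (fun r => u.ext' p.1 r) p.2

theorem SmoothSquare.eventually_source (u : SmoothSquare E M) {x : M} {p : ℝ × ℝ}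
    (hx : u.ext' p.1 p.2 ∈ (extChartAt 𝓘(ℝ, E) x).source) :
    ∀ᶠ q in 𝓝 p, u.ext' q.1 q.2 ∈ (extChartAt 𝓘(ℝ, E) x).source :=
  u.continuous_ext.continuousAt.eventually ((isOpen_extChartAt_source _).mem_nhds hx)

variable [IsManifold 𝓘(ℝ, E) ∞ M]

/-- A square read in the preferred chart at `x`. -/
def SmoothSquare.inChart (u : SmoothSquare E M) (x : M) (p : ℝ × ℝ) : E :=
  chartMap E x (u.ext' p.1 p.2)

theorem SmoothSquare.contDiffWithinAt_inChart (u : SmoothSquare E M) {x : M} {p : ℝ × ℝ}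
    (hp : p ∈ unitSquare) (hx : u.ext' p.1 p.2 ∈ (extChartAt 𝓘(ℝ, E) x).source) :
    ContDiffWithinAt ℝ ∞ (u.inChart x) unitSquare p :=
  contDiffWithinAt_chartMap_comp (u.contMDiffOn_ext p hp) hx

theorem SmoothSquare.e1_eq (u : SmoothSquare E M) {x : M} {p : ℝ × ℝ}
    (hp : p ∈ unitSquare) (hx : u.ext' p.1 p.2 ∈ (extChartAt 𝓘(ℝ, E) x).source) :
    u.e1 p = symmDeriv E x (u.inChart x p) (fderivWithin ℝ (u.inChart x) unitSquare p (1, 0)) :=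
  vel_comp_eq_symmDeriv (ℓ := fun r : ℝ => (r, p.2)) hp.1 (u.contMDiffOn_ext p hp)
    (contDiff_id.prodMk contDiff_const)
    ((hasDerivWithinAt_id _ _).prodMk (hasDerivWithinAt_const _ _ _)) (fun _ hr => ⟨hr, hp.2⟩) hx

theorem SmoothSquare.e2_eq (u : SmoothSquare E M) {x : M} {p : ℝ × ℝ}
    (hp : p ∈ unitSquare) (hx : u.ext' p.1 p.2 ∈ (extChartAt 𝓘(ℝ, E) x).source) :
    u.e2 p = symmDeriv E x (u.inChart x p) (fderivWithin ℝ (u.inChart x) unitSquare p (0, 1)) :=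
  vel_comp_eq_symmDeriv (ℓ := fun r : ℝ => (p.1, r)) hp.2 (u.contMDiffOn_ext p hp)
    (contDiff_const.prodMk contDiff_id)
    ((hasDerivWithinAt_const _ _ _).prodMk (hasDerivWithinAt_id _ _)) (fun _ hr => ⟨hp.1, hr⟩) hx

theorem SmoothSquare.continuousWithinAt_fderiv (u : SmoothSquare E M) {x : M} {p : ℝ × ℝ}
    (hp : p ∈ unitSquare) (hx : u.ext' p.1 p.2 ∈ (extChartAt 𝓘(ℝ, E) x).source) (v : ℝ × ℝ) :
    ContinuousWithinAt (fun q => fderivWithin ℝ (u.inChart x) unitSquare q v) unitSquare p :=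
  ((u.contDiffWithinAt_inChart hp hx).fderivWithin_right (m := ∞) uniqueDiffOn_unitSquare
    (by simp) hp).continuousWithinAt.clm_apply continuousWithinAt_const

theorem SmoothSquare.continuousWithinAt_form (u : SmoothSquare E M) {α : M → E →L[ℝ] F}
    {p : ℝ × ℝ} (hp : p ∈ unitSquare)
    (hα : ContinuousAt (formInChart α (u.ext' p.1 p.2))
      (chartMap E (u.ext' p.1 p.2) (u.ext' p.1 p.2))) :
    ContinuousWithinAt (fun q => α (u.ext' q.1 q.2) (u.e1 q)) unitSquare p ∧
    ContinuousWithinAt (fun q => α (u.ext' q.1 q.2) (u.e2 q)) unitSquare p := by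
  have hx := mem_extChartAt_source (I := 𝓘(ℝ, E)) (u.ext' p.1 p.2)
  have hd : ContinuousWithinAt (fun q => formInChart α (u.ext' p.1 p.2)
      (u.inChart (u.ext' p.1 p.2) q)) unitSquare p :=
    ContinuousAt.comp_continuousWithinAt (f := u.inChart (u.ext' p.1 p.2)) hα
      (u.contDiffWithinAt_inChart hp hx).continuousWithinAt
  constructor
  · refine (hd.clm_apply (u.continuousWithinAt_fderiv hp hx (1, 0))).congr_of_eventuallyEq ?_ ?_
    · filter_upwards [mem_nhdsWithin_of_mem_nhds (u.eventually_source hx),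
        self_mem_nhdsWithin] with q hq hq1
      rw [u.e1_eq hq1 hq]
      exact (formInChart_chartMap α hq _).symm
    · rw [u.e1_eq hp hx]
      exact (formInChart_chartMap α hx _).symm
  · refine (hd.clm_apply (u.continuousWithinAt_fderiv hp hx (0, 1))).congr_of_eventuallyEq ?_ ?_
    · filter_upwards [mem_nhdsWithin_of_mem_nhds (u.eventually_source hx),
        self_mem_nhdsWithin] with q hq hq1
      rw [u.e2_eq hq1 hq]
      exact (formInChart_chartMap α hq _).symm
    · rw [u.e2_eq hp hx]
      exact (formInChart_chartMap α hx _).symm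

/-- The exterior derivative of a vector-valued one-form, computed in the preferred chart. -/
def formD (α : M → E →L[ℝ] F) (x : M) (v w : E) : F :=
  fderiv ℝ (formInChart α x) (chartMap E x x) v w
    - fderiv ℝ (formInChart α x) (chartMap E x x) w v

/-- Pull-back commutes with the exterior derivative: in the chart at the image of `p` the two mixed
second derivatives of the square cancel by symmetry, and the derivative of the form remains.
Interior points are taken so that derivatives within the square are ordinary derivatives nearby. -/
theorem SmoothSquare.curl_eq (u : SmoothSquare E M) {α : M → E →L[ℝ] F}
    {p : ℝ × ℝ} (hp : p ∈ Ioo (0 : ℝ) 1 ×ˢ Ioo (0 : ℝ) 1)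
    (hα : ContDiffAt ℝ 1 (formInChart α (u.ext' p.1 p.2))
      (chartMap E (u.ext' p.1 p.2) (u.ext' p.1 p.2))) :
    ∃ P Q : ℝ × ℝ →L[ℝ] F,
      HasFDerivAt (fun q => α (u.ext' q.1 q.2) (u.e1 q)) P p ∧
      HasFDerivAt (fun q => α (u.ext' q.1 q.2) (u.e2 q)) Q p ∧
      Q (1, 0) - P (0, 1) = formD α (u.ext' p.1 p.2) (u.e1 p) (u.e2 p) := by
  set x := u.ext' p.1 p.2 with hxdef
  have hx := mem_extChartAt_source (I := 𝓘(ℝ, E)) x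
  have hS : unitSquare ∈ 𝓝 p := mem_of_superset ((isOpen_Ioo.prod isOpen_Ioo).mem_nhds hp)
    (prod_mono Ioo_subset_Icc_self Ioo_subset_Icc_self)
  have hpS : p ∈ unitSquare := mem_of_mem_nhds hS
  have hU : ContDiffAt ℝ ∞ (u.inChart x) p :=
    (u.contDiffWithinAt_inChart hpS hx).contDiffAt hS
  have hfd : ∀ᶠ q in 𝓝 p, fderivWithin ℝ (u.inChart x) unitSquare q
      = fderiv ℝ (u.inChart x) q := by
    filter_upwards [eventually_mem_nhds_iff.2 hS] with q hq
    exact fderivWithin_of_mem_nhds hq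
  have h1 : (fun q => α (u.ext' q.1 q.2) (u.e1 q)) =ᶠ[𝓝 p]
      fun q => formInChart α x (u.inChart x q) (fderiv ℝ (u.inChart x) q (1, 0)) := by
    filter_upwards [hfd, u.eventually_source hx, hS] with q h2 hq hq1
    rw [u.e1_eq hq1 hq, h2]
    exact (formInChart_chartMap α hq _).symm
  have h2 : (fun q => α (u.ext' q.1 q.2) (u.e2 q)) =ᶠ[𝓝 p]
      fun q => formInChart α x (u.inChart x q) (fderiv ℝ (u.inChart x) q (0, 1)) := by
    filter_upwards [hfd, u.eventually_source hx, hS] with q h2 hq hq1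
    rw [u.e2_eq hq1 hq, h2]
    exact (formInChart_chartMap α hq _).symm
  have hd1 : HasFDerivAt (u.inChart x) (fderiv ℝ (u.inChart x) p) p :=
    (hU.differentiableAt (by simp)).hasFDerivAt
  have hd2 : HasFDerivAt (fderiv ℝ (u.inChart x)) (fderiv ℝ (fderiv ℝ (u.inChart x)) p) p :=
    ((hU.fderiv_right (m := ∞) (by simp)).differentiableAt (by simp)).hasFDerivAt
  have hda : HasFDerivAt (formInChart α x) (fderiv ℝ (formInChart α x) (u.inChart x p))
      (u.inChart x p) := (hα.differentiableAt (by simp)).hasFDerivAt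
  have hdc := hda.comp p hd1
  have hP := fun v : ℝ × ℝ => hdc.clm_apply (hd2.clm_apply (hasFDerivAt_const v p))
  refine ⟨_, _, (hP (1, 0)).congr_of_eventuallyEq h1, (hP (0, 1)).congr_of_eventuallyEq h2, ?_⟩
  have hsymm : fderiv ℝ (fderiv ℝ (u.inChart x)) p (1, 0) (0, 1)
      = fderiv ℝ (fderiv ℝ (u.inChart x)) p (0, 1) (1, 0) :=
    (hU.isSymmSndFDerivAt (by
      rw [minSmoothness_of_isRCLikeNormedField]; exact ENat.LEInfty.out)).eq _ _
  have e1 : u.e1 p = fderiv ℝ (u.inChart x) p (1, 0) := by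
    rw [u.e1_eq hpS hx, hfd.self_of_nhds]
    show symmDeriv E x (chartMap E x x) _ = _
    rw [symmDeriv_self]; rfl
  have e2 : u.e2 p = fderiv ℝ (u.inChart x) p (0, 1) := by
    rw [u.e2_eq hpS hx, hfd.self_of_nhds]
    show symmDeriv E x (chartMap E x x) _ = _
    rw [symmDeriv_self]; rfl
  have hpx : chartMap E x x = u.inChart x p := rfl
  rw [formD, e1, e2, hpx]
  simp [hsymm]

/-- Stokes' theorem for a one-form on a rectangle contained in the unit square. -/
theorem SmoothSquare.stokes (u : SmoothSquare E M) {α : M → E →L[ℝ] F} {V : Set M}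
    (hα : ∀ x ∈ V, ContDiffAt ℝ 1 (formInChart α x) (chartMap E x x))
    {w : ℝ × ℝ → F} (hw : ContinuousOn w unitSquare)
    (hd : ∀ p ∈ unitSquare, u.ext' p.1 p.2 ∈ V →
      formD α (u.ext' p.1 p.2) (u.e1 p) (u.e2 p) = w p)
    {a₀ a₁ b₀ b₁ : ℝ} (ha₀ : 0 ≤ a₀) (ha : a₀ ≤ a₁) (ha₁ : a₁ ≤ 1)
    (hb₀ : 0 ≤ b₀) (hb : b₀ ≤ b₁) (hb₁ : b₁ ≤ 1)
    (hV : ∀ p ∈ Icc a₀ a₁ ×ˢ Icc b₀ b₁, u.ext' p.1 p.2 ∈ V) :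
    (∫ a in a₀..a₁, α (u.ext' a b₀) (u.e1 (a, b₀)))
      + (∫ b in b₀..b₁, α (u.ext' a₁ b) (u.e2 (a₁, b)))
      - (∫ a in a₀..a₁, α (u.ext' a b₁) (u.e1 (a, b₁)))
      - (∫ b in b₀..b₁, α (u.ext' a₀ b) (u.e2 (a₀, b)))
      = ∫ a in a₀..a₁, ∫ b in b₀..b₁, w (a, b) := by
  classical
  have hR : Icc a₀ a₁ ×ˢ Icc b₀ b₁ ⊆ unitSquare :=
    prod_mono (Icc_subset_Icc ha₀ ha₁) (Icc_subset_Icc hb₀ hb₁)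
  have hI : Ioo a₀ a₁ ×ˢ Ioo b₀ b₁ ⊆ Ioo (0 : ℝ) 1 ×ˢ Ioo (0 : ℝ) 1 :=
    prod_mono (Ioo_subset_Ioo ha₀ ha₁) (Ioo_subset_Ioo hb₀ hb₁)
  have hIR : Ioo a₀ a₁ ×ˢ Ioo b₀ b₁ ⊆ Icc a₀ a₁ ×ˢ Icc b₀ b₁ :=
    prod_mono Ioo_subset_Icc_self Ioo_subset_Icc_self
  have hc := fun p (hp : p ∈ Icc a₀ a₁ ×ˢ Icc b₀ b₁) =>
    u.continuousWithinAt_form (hR hp) (hα _ (hV p hp)).continuousAt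
  choose! P Q hP hQ hPQ using fun p (hp : p ∈ Ioo a₀ a₁ ×ˢ Ioo b₀ b₁) =>
    u.curl_eq (hI hp) (hα _ (hV p (hIR hp)))
  -- The divergence theorem is applied to the field `(α(∂_b u), -α(∂_a u))`. Outside the open
  -- rectangle its derivatives get artificial values, chosen so that the divergence is `w`
  -- everywhere; integrability then follows from the continuity of `w` alone.
  let f' : ℝ × ℝ → ℝ × ℝ →L[ℝ] F := fun p => if p ∈ Ioo a₀ a₁ ×ˢ Ioo b₀ b₁ then Q p
    else (ContinuousLinearMap.fst ℝ ℝ ℝ).smulRight (w p)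
  let g' : ℝ × ℝ → ℝ × ℝ →L[ℝ] F := fun p => if p ∈ Ioo a₀ a₁ ×ˢ Ioo b₀ b₁ then -P p else 0
  have hfg : ∀ p, f' p (1, 0) + g' p (0, 1) = w p := by
    intro p
    by_cases hp : p ∈ Ioo a₀ a₁ ×ˢ Ioo b₀ b₁
    · simp only [f', g', if_pos hp]
      rw [← hd p (hR (hIR hp)) (hV p (hIR hp)), ← hPQ p hp, neg_apply,
        sub_eq_add_neg]
    · simp only [f', g', if_neg hp]
      simp
  have key := integral2_divergence_prod_of_hasFDerivAt_off_countable
    (fun q => α (u.ext' q.1 q.2) (u.e2 q)) (fun q => -α (u.ext' q.1 q.2) (u.e1 q)) f' g'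
    a₀ b₀ a₁ b₁ ∅ countable_empty
    (by rw [uIcc_of_le ha, uIcc_of_le hb]; exact fun p hp => (hc p hp).2.mono hR)
    (by rw [uIcc_of_le ha, uIcc_of_le hb]; exact fun p hp => ((hc p hp).1.mono hR).neg)
    (by
      rw [min_eq_left ha, max_eq_right ha, min_eq_left hb, max_eq_right hb, sdiff_empty]
      intro p hp
      simp only [f', if_pos hp]
      exact hQ p hp)
    (by
      rw [min_eq_left ha, max_eq_right ha, min_eq_left hb, max_eq_right hb, sdiff_empty]
      intro p hp
      simp only [g', if_pos hp]
      exact (hP p hp).neg)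
    (by
      simp only [hfg]
      rw [uIcc_of_le ha, uIcc_of_le hb]
      exact (hw.mono hR).integrableOn_compact (isCompact_Icc.prod isCompact_Icc))
  simp only [hfg, intervalIntegral.integral_neg] at key
  rw [key]
  abel

end Squares

/-! ### Smooth forms and coordinate vector fields -/

section SmoothForms

variable {E : Type*} [NormedAddCommGroup E] [NormedSpace ℝ E]
  {M : Type*} [TopologicalSpace M] [ChartedSpace E M] [IsManifold 𝓘(ℝ, E) ∞ M]
  {F : Type*} [NormedAddCommGroup F] [NormedSpace ℝ F]

variable (M) in
/-- The vector field which is constant in the preferred chart at `x`. -/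
def coordField (x : M) (w : E) (y : M) : TangentSpace 𝓘(ℝ, E) y :=
  (trivializationAt E (TangentSpace 𝓘(ℝ, E)) x).symm y w

theorem coordField_eq {x y : M} (hy : y ∈ (extChartAt 𝓘(ℝ, E) x).source) (w : E) :
    coordField M x w y = symmDeriv E x (chartMap E x y) w := by
  have : IsManifold 𝓘(ℝ, E) 1 M := IsManifold.of_le (n := ∞) (by simp)
  have h := TangentBundle.symmL_trivializationAt (I := 𝓘(ℝ, E)) (x₀ := x) (x := y)
    (by simpa using hy)
  rw [modelWithCornersSelf_coe, range_id, mfderivWithin_univ] at h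
  have hy' : y ∈ (trivializationAt E (TangentSpace 𝓘(ℝ, E)) x).baseSet := by simpa using hy
  rw [coordField, ← Trivialization.symmL_apply (R := ℝ) _ hy']
  exact congrArg (fun A : E →L[ℝ] E => A w) h

theorem coordField_self (x : M) (w : E) : coordField M x w x = w := by
  rw [coordField_eq (mem_extChartAt_source _), symmDeriv_self]
  rfl

theorem contMDiffOn_coordField (x : M) (w : E) :
    ContMDiffOn 𝓘(ℝ, E) (𝓘(ℝ, E).prod 𝓘(ℝ, E)) ∞
      (fun y => (TotalSpace.mk' E y (coordField M x w y) : TangentBundle 𝓘(ℝ, E) M))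
      (extChartAt 𝓘(ℝ, E) x).source := by
  have h : (extChartAt 𝓘(ℝ, E) x).source
      = (trivializationAt E (TangentSpace 𝓘(ℝ, E)) x).baseSet := by simp
  rw [h, (trivializationAt E (TangentSpace 𝓘(ℝ, E)) x).contMDiffOn_section_baseSet_iff]
  refine (contMDiffOn_const (c := w)).congr fun y hy => ?_
  simp only [coordField]
  rw [Trivialization.apply_mk_symm _ hy]

theorem contDiffOn_comp_chart_symm {x : M} {V : Set M} {h : M → F}
    (hh : ContMDiffOn 𝓘(ℝ, E) 𝓘(ℝ, F) ∞ h V) :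
    ContDiffOn ℝ ∞ (fun z => h ((extChartAt 𝓘(ℝ, E) x).symm z))
      ((extChartAt 𝓘(ℝ, E) x).target ∩ (extChartAt 𝓘(ℝ, E) x).symm ⁻¹' V) := by
  rw [← contMDiffOn_iff_contDiffOn]
  exact hh.comp ((contMDiffOn_extChartAt_symm x).mono inter_subset_left) fun z hz => hz.2

/-- In finite dimension, smoothness of an operator-valued map can be tested on each fixed vector,
and a fixed vector in the chart is a coordinate field on `M`. -/
theorem contDiffAt_formInChart [FiniteDimensional ℝ E] {α : M → E →L[ℝ] F} {V : Set M}
    (hV : IsOpen V) {x : M} (hx : x ∈ V)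
    (h : ∀ w : E, ContMDiffOn 𝓘(ℝ, E) 𝓘(ℝ, F) ∞ (fun y => α y (coordField M x w y : E))
      (V ∩ (extChartAt 𝓘(ℝ, E) x).source)) :
    ContDiffAt ℝ ∞ (formInChart α x) (chartMap E x x) := by
  set S := (extChartAt 𝓘(ℝ, E) x).target ∩ (extChartAt 𝓘(ℝ, E) x).symm ⁻¹'
    (V ∩ (extChartAt 𝓘(ℝ, E) x).source) with hS
  have hSo : S ∈ 𝓝 (chartMap E x x) := by
    refine inter_mem (extChartAt_target_mem_nhds x) ?_
    refine (continuousAt_extChartAt_symm x).preimage_mem_nhds ?_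
    rw [extChartAt_to_inv]
    exact inter_mem (hV.mem_nhds hx) (extChartAt_source_mem_nhds x)
  have h1 : ContDiffOn ℝ ∞ (formInChart α x) S := by
    rw [contDiffOn_clm_apply]
    intro w
    refine (contDiffOn_comp_chart_symm (x := x) (h w)).congr fun z hz => ?_
    show α _ (symmDeriv E x z w) = α _ _
    rw [coordField_eq hz.2.2]
    simp only [chartMap]
    rw [(extChartAt 𝓘(ℝ, E) x).right_inv hz.1]
  exact h1.contDiffAt hSo

theorem OneForm.SmoothOn.contDiffAt [FiniteDimensional ℝ E] {θ : OneForm E M} {U : Set M}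
    (hθ : θ.SmoothOn U) (hU : IsOpen U) {x : M} (hx : x ∈ U) :
    ContDiffAt ℝ ∞ (formInChart (fun y => (θ y : E →L[ℝ] ℝ)) x) (chartMap E x x) := by
  refine contDiffAt_formInChart hU hx fun w => ?_
  intro y hy
  have h1 := ContMDiffWithinAt.clm_bundle_apply (F₂ := ℝ) (E₂ := Bundle.Trivial M ℝ)
    ((hθ y hy.1).mono inter_subset_left)
    ((contMDiffOn_coordField x w y hy.2).mono inter_subset_right)
  rw [contMDiffWithinAt_totalSpace] at h1
  exact h1.2

variable (E) in
/-- The field of bilinear forms evaluated on model vectors. -/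
def BilinForm.app (Ω : BilinForm E M) (x : M) : E →L[ℝ] E →L[ℝ] ℝ := Ω x

theorem IsSymplectic.contMDiffOn_coord {Ω : BilinForm E M} (hΩ : IsSymplectic Ω) (x : M)
    (v w : E) : ContMDiffOn 𝓘(ℝ, E) 𝓘(ℝ, ℝ) ∞
      (fun y => Ω.app E y (coordField M x v y : E) (coordField M x w y : E))
      (extChartAt 𝓘(ℝ, E) x).source := by
  intro y hy
  have h1 := ContMDiffWithinAt.clm_bundle_apply₂ (F₃ := ℝ) (E₃ := Bundle.Trivial M ℝ)
    (hΩ.smooth y).contMDiffWithinAt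
    (contMDiffOn_coordField x v y hy) (contMDiffOn_coordField x w y hy)
  rw [contMDiffWithinAt_totalSpace] at h1
  exact h1.2

/-- A field of bilinear forms read in the preferred chart at `x`. -/
def BilinForm.chartForm (Ω : BilinForm E M) (x : M) (z : E) : E →L[ℝ] E →L[ℝ] ℝ :=
  (Ω.app E ((extChartAt 𝓘(ℝ, E) x).symm z)).bilinearComp (symmDeriv E x z) (symmDeriv E x z)

theorem BilinForm.chartForm_chartMap (Ω : BilinForm E M) {x y : M}
    (hy : y ∈ (extChartAt 𝓘(ℝ, E) x).source) (v w : E) :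
    Ω.chartForm x (chartMap E x y) v w
      = Ω.app E y (symmDeriv E x (chartMap E x y) v) (symmDeriv E x (chartMap E x y) w) := by
  rw [BilinForm.chartForm, chartMap, (extChartAt 𝓘(ℝ, E) x).left_inv hy]
  rfl

theorem IsSymplectic.continuousAt_chartForm [FiniteDimensional ℝ E] {Ω : BilinForm E M}
    (hΩ : IsSymplectic Ω) (x : M) :
    ContinuousAt (Ω.chartForm x) (chartMap E x x) := by
  have h1 : ContinuousOn (Ω.chartForm x) (extChartAt 𝓘(ℝ, E) x).target := by
    rw [continuousOn_clm_apply]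
    intro v
    rw [continuousOn_clm_apply]
    intro w
    have h2 := (contDiffOn_comp_chart_symm (x := x) (hΩ.contMDiffOn_coord x v w)).continuousOn
    refine (h2.mono fun z hz => ⟨hz, (extChartAt 𝓘(ℝ, E) x).map_target hz⟩).congr fun z hz => ?_
    have hz' := (extChartAt 𝓘(ℝ, E) x).map_target hz
    show Ω.app E _ (symmDeriv E x z v) (symmDeriv E x z w) = Ω.app E _ _ _
    rw [coordField_eq hz', coordField_eq hz']
    simp only [chartMap]
    rw [(extChartAt 𝓘(ℝ, E) x).right_inv hz]
  exact h1.continuousAt (extChartAt_target_mem_nhds x)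

/-- The pull-back of a two-form to the unit square. -/
def BilinForm.density (Ω : BilinForm E M) (u : SmoothSquare E M) (p : ℝ × ℝ) : ℝ :=
  Ω.app E (u.ext' p.1 p.2) (u.e1 p) (u.e2 p)

theorem IsSymplectic.continuousOn_density [FiniteDimensional ℝ E] {Ω : BilinForm E M}
    (hΩ : IsSymplectic Ω) (u : SmoothSquare E M) :
    ContinuousOn (Ω.density u) unitSquare := by
  intro p hp
  have hx := mem_extChartAt_source (I := 𝓘(ℝ, E)) (u.ext' p.1 p.2)
  have hd : ContinuousWithinAt (fun q => Ω.chartForm (u.ext' p.1 p.2)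
      (u.inChart (u.ext' p.1 p.2) q)) unitSquare p :=
    ContinuousAt.comp_continuousWithinAt (f := u.inChart (u.ext' p.1 p.2))
      (hΩ.continuousAt_chartForm _) (u.contDiffWithinAt_inChart hp hx).continuousWithinAt
  refine ((hd.clm_apply (u.continuousWithinAt_fderiv hp hx (1, 0))).clm_apply
    (u.continuousWithinAt_fderiv hp hx (0, 1))).congr_of_eventuallyEq ?_ ?_
  · filter_upwards [mem_nhdsWithin_of_mem_nhds (u.eventually_source hx),
      self_mem_nhdsWithin] with q hq hq1
    rw [BilinForm.density, u.e1_eq hq1 hq, u.e2_eq hq1 hq]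
    exact (Ω.chartForm_chartMap hq _ _).symm
  · rw [BilinForm.density, u.e1_eq hp hx, u.e2_eq hp hx]
    exact (Ω.chartForm_chartMap hx _ _).symm

end SmoothForms

/-! ### Extending local sections by bump functions -/

section Bump

variable {E : Type*} [NormedAddCommGroup E] [NormedSpace ℝ E] [FiniteDimensional ℝ E]
  {M : Type*} [TopologicalSpace M] [T2Space M] [ChartedSpace E M] [IsManifold 𝓘(ℝ, E) ∞ M]
  {F : Type*} [NormedAddCommGroup F] [NormedSpace ℝ F]
  {V : M → Type*} [TopologicalSpace (TotalSpace F V)] [∀ x, TopologicalSpace (V x)]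
  [∀ x, AddCommGroup (V x)] [∀ x, Module ℝ (V x)]
  [FiberBundle F V] [VectorBundle ℝ F V]

/-- A local smooth section agrees near a given point with a global smooth section. -/
theorem exists_global_section {s : (x : M) → V x} {W : Set M} (hW : IsOpen W)
    (hs : ContMDiffOn 𝓘(ℝ, E) (𝓘(ℝ, E).prod 𝓘(ℝ, F)) ∞ (fun x => TotalSpace.mk' F x (s x)) W)
    {x : M} (hx : x ∈ W) :
    ∃ s' : (x : M) → V x,
      ContMDiff 𝓘(ℝ, E) (𝓘(ℝ, E).prod 𝓘(ℝ, F)) ∞ (fun x => TotalSpace.mk' F x (s' x)) ∧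
      ∀ᶠ y in 𝓝 x, s' y = s y := by
  obtain ⟨f, -, hf⟩ := (SmoothBumpFunction.nhds_basis_tsupport (I := 𝓘(ℝ, E)) x).mem_iff.1
    (hW.mem_nhds hx)
  refine ⟨fun y => f y • s y,
    ContMDiffOn.smul_section_of_tsupport f.contMDiff.contMDiffOn hW hf hs, ?_⟩
  filter_upwards [f.eventuallyEq_one] with y hy
  simp [hy]

end Bump

/-! ### Frames and fibre coordinates of a line bundle -/

section Frames

variable {M : Type*} [TopologicalSpace M]
  (L : M → Type*) [TopologicalSpace (TotalSpace ℂ L)] [∀ x, TopologicalSpace (L x)]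
  [∀ x, AddCommGroup (L x)] [∀ x, Module ℂ (L x)]
  [FiberBundle ℂ L]

/-- The domain of the preferred trivialization at `x`. -/
def base (x : M) : Set M := (trivializationAt ℂ L x).baseSet

/-- The frame of the preferred trivialization at `x`. -/
def frame (x y : M) : L y := (trivializationAt ℂ L x).symm y 1

variable {L} in
/-- The fibre coordinate of the preferred trivialization at `x`. -/
def coord (x : M) (z : TotalSpace ℂ L) : ℂ := (trivializationAt ℂ L x z).2

theorem isOpen_base (x : M) : IsOpen (base L x) := (trivializationAt ℂ L x).open_baseSet

theorem mem_base (x : M) : x ∈ base L x := FiberBundle.mem_baseSet_trivializationAt' x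

variable {L}

theorem coord_frame {x y : M} (hy : y ∈ base L x) : coord x ⟨y, frame L x y⟩ = 1 := by
  have := Trivialization.apply_mk_symm (trivializationAt ℂ L x) hy (1 : ℂ)
  exact congrArg Prod.snd this

variable [VectorBundle ℂ ℂ L]

theorem coord_smul {x y : M} (hy : y ∈ base L x) (a : ℂ) (v : L y) :
    coord x ⟨y, a • v⟩ = a * coord x ⟨y, v⟩ := by
  have := ((trivializationAt ℂ L x).linear ℂ hy).map_smul a v
  exact this

theorem coord_smul_frame {x y : M} (hy : y ∈ base L x) (v : L y) :
    coord x ⟨y, v⟩ • frame L x y = v := by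
  have h1 : v = (trivializationAt ℂ L x).symm y (coord x ⟨y, v⟩) :=
    ((trivializationAt ℂ L x).symm_apply_apply_mk hy v).symm
  have h2 := ((trivializationAt ℂ L x).symmₗ ℂ y).map_smul (coord x ⟨y, v⟩) 1
  rw [Trivialization.coe_symmₗ (hb := hy)] at h2
  rw [frame, ← h2, smul_eq_mul, mul_one, ← h1]

theorem frame_ne_zero {x y : M} (hy : y ∈ base L x) : frame L x y ≠ 0 := by
  intro h
  have h1 := coord_smul hy 0 (frame L x y)
  rw [zero_smul, ← h, coord_frame hy] at h1
  simp at h1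

theorem coord_eq_zero_iff {x y : M} (hy : y ∈ base L x) (v : L y) :
    coord x ⟨y, v⟩ = 0 ↔ v = 0 := by
  constructor
  · intro h
    rw [← coord_smul_frame hy v, h, zero_smul]
  · rintro rfl
    simpa using coord_smul hy 0 (0 : L y)

theorem smul_right_injective_of_ne_zero {y : M} {v : L y} (hv : v ≠ 0) {a b : ℂ}
    (h : a • v = b • v) : a = b := by
  have h1 := coord_smul (mem_base L y) a v
  rw [h, coord_smul (mem_base L y)] at h1
  exact (mul_right_cancel₀ (fun h0 => hv ((coord_eq_zero_iff (mem_base L y) v).1 h0)) h1).symm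

end Frames

/-! ### Connection forms and curvature -/

section Connection

variable {E : Type*} [NormedAddCommGroup E] [NormedSpace ℝ E]
  {M : Type*} [TopologicalSpace M] [ChartedSpace E M] [IsManifold 𝓘(ℝ, E) ∞ M]
  {L : M → Type*} [TopologicalSpace (TotalSpace ℂ L)] [∀ x, TopologicalSpace (L x)]
  [∀ x, AddCommGroup (L x)] [∀ x, Module ℂ (L x)]
  [∀ x, IsTopologicalAddGroup (L x)] [∀ x, ContinuousSMul ℝ (L x)]
  [FiberBundle ℂ L] [VectorBundle ℂ ℂ L] [VectorBundle ℝ ℂ L]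
  [ContMDiffVectorBundle ∞ ℂ L 𝓘(ℝ, E)]

/-- Differentiability at a point of a section of a line bundle. -/
abbrev SecDiffAt (σ : (x : M) → L x) (x : M) : Prop :=
  MDifferentiableAt 𝓘(ℝ, E) (𝓘(ℝ, E).prod 𝓘(ℝ, ℂ)) (fun y => TotalSpace.mk' ℂ y (σ y)) x

theorem contMDiffOn_frame (x : M) : ContMDiffOn 𝓘(ℝ, E) (𝓘(ℝ, E).prod 𝓘(ℝ, ℂ)) ∞
    (fun y => TotalSpace.mk' ℂ y (frame L x y)) (base L x) := by
  unfold base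
  rw [(trivializationAt ℂ L x).contMDiffOn_section_baseSet_iff]
  exact (contMDiffOn_const (c := (1 : ℂ))).congr fun y hy => coord_frame hy

theorem secDiffAt_frame {x y : M} (hy : y ∈ base L x) : SecDiffAt (E := E) (frame L x) y :=
  ((contMDiffOn_frame x).contMDiffAt ((isOpen_base L x).mem_nhds hy)).mdifferentiableAt (by simp)

theorem secDiffAt_iff {σ : (x : M) → L x} {x y : M} (hy : y ∈ base L x) :
    SecDiffAt (E := E) σ y ↔
      MDifferentiableAt 𝓘(ℝ, E) 𝓘(ℝ, ℂ) (fun q => coord x ⟨q, σ q⟩) y := by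
  have : ContMDiffVectorBundle 1 ℂ L 𝓘(ℝ, E) := ContMDiffVectorBundle.of_le (n := ∞) (by simp)
  exact (trivializationAt ℂ L x).mdifferentiableAt_section_iff 𝓘(ℝ, E) σ hy

theorem SecDiffAt.smul {h : M → ℂ} {σ : (x : M) → L x} {x : M}
    (hh : MDifferentiableAt 𝓘(ℝ, E) 𝓘(ℝ, ℂ) h x) (hσ : SecDiffAt (E := E) σ x) :
    SecDiffAt (E := E) (fun y => h y • σ y) x := by
  rw [secDiffAt_iff (mem_base L x)] at hσ ⊢
  refine (hh.mul hσ).congr_of_eventuallyEq ?_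
  filter_upwards [(isOpen_base L x).mem_nhds (mem_base L x)] with y hy
  exact coord_smul hy _ _

variable (E) in
/-- The derivative of a complex function on a manifold, on the model space. -/
def dM (h : M → ℂ) (x : M) : E →L[ℝ] ℂ := mfderiv 𝓘(ℝ, E) 𝓘(ℝ, ℂ) h x

/-- The covariant derivative, with the tangent spaces identified with the model space. -/
def covE (cov : CovariantDerivative 𝓘(ℝ, E) ℂ L) (σ : (x : M) → L x) (x : M) : E →L[ℝ] L x :=
  cov σ x

/-- The covariant derivative obeys only the real Leibniz rule. Splitting `h • σ` as `(Re h) • σ +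
(Im h) • (I • σ)` and using complex linearity gives the complex one. -/
theorem covE_smul {cov : CovariantDerivative 𝓘(ℝ, E) ℂ L}
    (hcov : IsSmoothComplexConnection cov) {h : M → ℂ} {σ : (x : M) → L x} {x : M}
    (hh : MDifferentiableAt 𝓘(ℝ, E) 𝓘(ℝ, ℂ) h x) (hσ : SecDiffAt (E := E) σ x) (v : E) :
    covE cov (fun y => h y • σ y) x v = dM E h x v • σ x + h x • covE cov σ x v := by
  have hre : HasMFDerivAt 𝓘(ℝ, E) 𝓘(ℝ, ℝ) (fun y => (h y).re) x
      (Complex.reCLM.comp (dM E h x)) :=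
    (Complex.reCLM.hasFDerivAt (x := h x)).hasMFDerivAt.comp x hh.hasMFDerivAt
  have him : HasMFDerivAt 𝓘(ℝ, E) 𝓘(ℝ, ℝ) (fun y => (h y).im) x
      (Complex.imCLM.comp (dM E h x)) :=
    (Complex.imCLM.hasFDerivAt (x := h x)).hasMFDerivAt.comp x hh.hasMFDerivAt
  have hIσ : SecDiffAt (E := E) (fun y => Complex.I • σ y) x :=
    SecDiffAt.smul mdifferentiableAt_const hσ
  have hsum : (fun y => h y • σ y) = (fun y => (h y).re) • σ
      + (fun y => (h y).im) • fun y => Complex.I • σ y := by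
    funext y
    simp only [Pi.add_apply, Pi.smul_apply', ← Complex.coe_smul, smul_smul, ← add_smul]
    rw [Complex.re_add_im]
  have h1 := cov.isCovariantDerivativeOnUniv.add
    (hre.mdifferentiableAt.smul_section hσ) (him.mdifferentiableAt.smul_section hIσ)
  have h2 := cov.isCovariantDerivativeOnUniv.leibniz hσ hre.mdifferentiableAt
  have h3 := cov.isCovariantDerivativeOnUniv.leibniz hIσ him.mdifferentiableAt
  have key : ∀ v : TangentSpace 𝓘(ℝ, E) x, cov.toFun (fun y => h y • σ y) x v
      = dM E h x v • σ x + h x • cov.toFun σ x v := by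
    intro v
    have h4 := hcov.complexLinear σ x hσ v
    have e1 : mvfderiv 𝓘(ℝ, E) (fun y => (h y).re) x v = (dM E h x v).re := by
      rw [mvfderiv, hre.mfderiv]; rfl
    have e2 : mvfderiv 𝓘(ℝ, E) (fun y => (h y).im) x v = (dM E h x v).im := by
      rw [mvfderiv, him.mfderiv]; rfl
    rw [hsum, h1, h2, h3]
    simp only [add_apply, smul_apply, ContinuousLinearMap.smulRight_apply]
    rw [h4, e1, e2]
    simp only [← Complex.coe_smul, smul_smul]
    conv_rhs => rw [← Complex.re_add_im (h x), ← Complex.re_add_im (dM E h x v)]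
    module
  exact key v

theorem covE_congr (cov : CovariantDerivative 𝓘(ℝ, E) ℂ L) {σ σ' : (x : M) → L x} {x : M}
    (hσ : SecDiffAt (E := E) σ x) (h : ∀ᶠ y in 𝓝 x, σ' y = σ y) :
    covE cov σ' x = covE cov σ x := by
  have hσ' : SecDiffAt (E := E) σ' x := by
    refine hσ.congr_of_eventuallyEq ?_
    filter_upwards [h] with y hy
    rw [hy]
  exact cov.isCovariantDerivativeOnUniv.congr_of_eventuallyEq hσ' hσ univ_mem h

/-- The connection form in the preferred frame at `x`. -/
def connForm (cov : CovariantDerivative 𝓘(ℝ, E) ℂ L) (x y : M) : E →L[ℝ] ℂ :=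
  ((trivializationAt ℂ L x).continuousLinearMapAt ℝ y).comp (covE cov (frame L x) y)

theorem connForm_apply (cov : CovariantDerivative 𝓘(ℝ, E) ℂ L) {x y : M} (hy : y ∈ base L x)
    (v : E) : connForm cov x y v = coord x ⟨y, covE cov (frame L x) y v⟩ := by
  exact Trivialization.continuousLinearMapAt_apply_of_mem (R := ℝ) (trivializationAt ℂ L x) hy _

theorem covE_frame (cov : CovariantDerivative 𝓘(ℝ, E) ℂ L) {x y : M} (hy : y ∈ base L x) (v : E) :
    covE cov (frame L x) y v = connForm cov x y v • frame L x y := by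
  rw [connForm_apply cov hy, coord_smul_frame hy]

/-- The covariant derivative of a section in terms of its coordinate in a frame. -/
theorem covE_eq {cov : CovariantDerivative 𝓘(ℝ, E) ℂ L}
    (hcov : IsSmoothComplexConnection cov) {σ : (x : M) → L x} {x y : M}
    (hy : y ∈ base L x) (hσ : SecDiffAt (E := E) σ y) (v : E) :
    covE cov σ y v = (dM E (fun q => coord x ⟨q, σ q⟩) y v
      + coord x ⟨y, σ y⟩ * connForm cov x y v) • frame L x y := by
  have h1 : ∀ᶠ q in 𝓝 y, σ q = coord x ⟨q, σ q⟩ • frame L x q := by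
    filter_upwards [(isOpen_base L x).mem_nhds hy] with q hq
    exact (coord_smul_frame hq _).symm
  have hd := (secDiffAt_iff hy).1 hσ
  rw [covE_congr cov (SecDiffAt.smul hd (secDiffAt_frame hy)) h1,
    covE_smul hcov hd (secDiffAt_frame hy), covE_frame cov hy, add_smul, mul_smul]

variable [FiniteDimensional ℝ E] [T2Space M]

/-- Smoothness of the connection is applied to a global section that agrees with the frame near the
point; by locality both have the same covariant derivative there. -/
theorem contMDiffOn_connForm {cov : CovariantDerivative 𝓘(ℝ, E) ℂ L}
    (hcov : IsSmoothComplexConnection cov) (x z : M) (w : E) :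
    ContMDiffOn 𝓘(ℝ, E) 𝓘(ℝ, ℂ) ∞ (fun y => connForm cov x y (coordField M z w y : E))
      (base L x ∩ (extChartAt 𝓘(ℝ, E) z).source) := by
  intro y hy
  refine ContMDiffAt.contMDiffWithinAt ?_
  obtain ⟨s, hs, hsy⟩ := exists_global_section (isOpen_base L x) (contMDiffOn_frame (E := E) x) hy.1
  have h1 := hcov.smooth.contMDiff.contMDiff (σ := s) hs.contMDiffOn
  have h2 := (h1 y (mem_univ y)).contMDiffAt univ_mem
  have h3 := ContMDiffAt.clm_bundle_apply h2
    ((contMDiffOn_coordField z w).contMDiffAt ((isOpen_extChartAt_source z).mem_nhds hy.2))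
  rw [(trivializationAt ℂ L x).contMDiffAt_section_iff hy.1] at h3
  refine h3.congr_of_eventuallyEq ?_
  filter_upwards [eventually_eventually_nhds.2 hsy, (isOpen_base L x).mem_nhds hy.1] with q hq hq1
  refine (connForm_apply cov hq1 _).trans ?_
  rw [← covE_congr cov (secDiffAt_frame hq1) hq]
  rfl

theorem contDiffAt_connForm {cov : CovariantDerivative 𝓘(ℝ, E) ℂ L}
    (hcov : IsSmoothComplexConnection cov) {x y : M} (hy : y ∈ base L x) :
    ContDiffAt ℝ ∞ (formInChart (connForm cov x) y) (chartMap E y y) :=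
  contDiffAt_formInChart (isOpen_base L x) hy fun w => contMDiffOn_connForm hcov x y w

theorem mpullback_eq_const {X : (x : M) → TangentSpace 𝓘(ℝ, E) x} {x : M} {v : E}
    (hX : ∀ᶠ y in 𝓝 x, X y = coordField M x v y) :
    VectorField.mpullbackWithin 𝓘(ℝ, E) 𝓘(ℝ, E) (extChartAt 𝓘(ℝ, E) x).symm X
      (range 𝓘(ℝ, E)) =ᶠ[𝓝 (extChartAt 𝓘(ℝ, E) x x)] fun _ => v := by
  have : IsManifold 𝓘(ℝ, E) 1 M := IsManifold.of_le (n := ∞) (by simp)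
  have h1 : ∀ᶠ z in 𝓝 (extChartAt 𝓘(ℝ, E) x x),
      X ((extChartAt 𝓘(ℝ, E) x).symm z) = coordField M x v ((extChartAt 𝓘(ℝ, E) x).symm z) := by
    refine (continuousAt_extChartAt_symm (I := 𝓘(ℝ, E)) x).eventually
      (p := fun y => X y = coordField M x v y) ?_
    rwa [extChartAt_to_inv]
  filter_upwards [h1, extChartAt_target_mem_nhds (I := 𝓘(ℝ, E)) x] with z hz hz1
  rw [VectorField.mpullbackWithin_apply, hz]
  refine (isInvertible_mfderivWithin_extChartAt_symm hz1).inverse_apply_eq.2 ?_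
  rw [coordField_eq ((extChartAt 𝓘(ℝ, E) x).map_target hz1), chartMap,
    (extChartAt 𝓘(ℝ, E) x).right_inv hz1, modelWithCornersSelf_coe, range_id, mfderivWithin_univ]
  rfl

/-- The Lie bracket of vector fields which are constant in a chart near the point. -/
theorem mlieBracket_eq_zero {X Y : (x : M) → TangentSpace 𝓘(ℝ, E) x} {x : M} {v w : E}
    (hX : ∀ᶠ y in 𝓝 x, X y = coordField M x v y) (hY : ∀ᶠ y in 𝓝 x, Y y = coordField M x w y) :
    VectorField.mlieBracket 𝓘(ℝ, E) X Y x = 0 := by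
  rw [← VectorField.mlieBracketWithin_univ, VectorField.mlieBracketWithin_apply,
    (mpullback_eq_const hX).lieBracketWithin_vectorField_eq_nhds (mpullback_eq_const hY)]
  have h : VectorField.lieBracketWithin ℝ (fun _ => v) (fun _ => w)
      ((extChartAt 𝓘(ℝ, E) x).symm ⁻¹' univ ∩ range 𝓘(ℝ, E)) (extChartAt 𝓘(ℝ, E) x x) = 0 := by
    simp [VectorField.lieBracketWithin]
  rw [h]
  exact ContinuousLinearMap.map_zero _

/-- The field `coordField M y b` is the constant `b` in the chart at `y`, so the derivative falls
only on the form. -/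
theorem dM_form_coordField (α : M → E →L[ℝ] ℂ) {y : M} {b : E}
    (hα : ContDiffAt ℝ ∞ (formInChart α y) (chartMap E y y)) (a : E) :
    dM E (fun q => α q (coordField M y b q : E)) y a
      = fderiv ℝ (formInChart α y) (chartMap E y y) a b := by
  have h1 : HasFDerivAt (fun z => formInChart α y z b)
      ((fderiv ℝ (formInChart α y) (chartMap E y y)).flip b) (chartMap E y y) := by
    have := (hα.differentiableAt (by simp)).hasFDerivAt.clm_apply
      (hasFDerivAt_const b (chartMap E y y))
    simpa using this
  have hy := mem_extChartAt_source (I := 𝓘(ℝ, E)) y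
  have h2 : HasMFDerivAt 𝓘(ℝ, E) 𝓘(ℝ, ℂ) (fun q => α q (coordField M y b q : E)) y
      (((fderiv ℝ (formInChart α y) (chartMap E y y)).flip b).comp
        (mfderiv 𝓘(ℝ, E) 𝓘(ℝ, E) (extChartAt 𝓘(ℝ, E) y) y)) := by
    have : IsManifold 𝓘(ℝ, E) 1 M := IsManifold.of_le (n := ∞) (by simp)
    have h3 := (h1.hasMFDerivAt).comp y
      (mdifferentiableAt_extChartAt (I := 𝓘(ℝ, E)) (mem_chart_source E y)).hasMFDerivAt
    refine h3.congr_of_eventuallyEq ?_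
    filter_upwards [extChartAt_source_mem_nhds (I := 𝓘(ℝ, E)) y] with q hq
    rw [coordField_eq hq]
    exact (formInChart_chartMap α hq b).symm
  have : IsManifold 𝓘(ℝ, E) 1 M := IsManifold.of_le (n := ∞) (by simp)
  rw [mfderiv_extChartAt_self] at h2
  exact congrArg (fun A : E →L[ℝ] ℂ => A a) h2.mfderiv

/-- The exterior derivative of the connection form is the curvature. -/
theorem formD_connForm {cov : CovariantDerivative 𝓘(ℝ, E) ℂ L}
    (hcov : IsSmoothComplexConnection cov) {ħ : ℝ} {Ω : BilinForm E M}
    (hcurv : HasCurvature cov ħ Ω) {x y : M} (hy : y ∈ base L x) (v w : E) :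
    formD (connForm cov x) y v w = -(Complex.I / (ħ : ℂ)) * ((Ω.app E y v w : ℝ) : ℂ) := by
  -- The curvature hypothesis concerns global sections and vector fields, so the frame and the two
  -- coordinate fields are replaced by global objects with the same germs at `y`. The bracket of the
  -- two fields then vanishes at `y`.
  obtain ⟨s, hs, hsy⟩ := exists_global_section (isOpen_base L x) (contMDiffOn_frame (E := E) x) hy
  obtain ⟨X, hX, hXy⟩ := exists_global_section (isOpen_extChartAt_source y)
    (contMDiffOn_coordField (E := E) y v) (mem_extChartAt_source y)
  obtain ⟨Y, hY, hYy⟩ := exists_global_section (isOpen_extChartAt_source y)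
    (contMDiffOn_coordField (E := E) y w) (mem_extChartAt_source y)
  have hc := hcurv X Y s hX hY hs y
  rw [mlieBracket_eq_zero hXy hYy, map_zero, sub_zero] at hc
  have hsmall : ∀ᶠ q in 𝓝 y, q ∈ base L x ∩ (extChartAt 𝓘(ℝ, E) y).source :=
    ((isOpen_base L x).inter (isOpen_extChartAt_source y)).mem_nhds ⟨hy, mem_extChartAt_source y⟩
  -- With `A` the connection form, the second covariant derivative of the frame has coefficient `∂_a
  -- A(b) + A(b) A(a)`. The quadratic term is symmetric in `a` and `b`, because the bundle has rank
  -- one, and drops out of the commutator.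
  have main : ∀ (Z : (x : M) → TangentSpace 𝓘(ℝ, E) x) (a b : E),
      (∀ᶠ q in 𝓝 y, Z q = coordField M y b q) →
      covE cov (fun q => covE cov s q (Z q)) y a
        = (fderiv ℝ (formInChart (connForm cov x) y) (chartMap E y y) a b
          + connForm cov x y b * connForm cov x y a) • frame L x y := by
    intro Z a b hZ
    have hd : MDifferentiableAt 𝓘(ℝ, E) 𝓘(ℝ, ℂ)
        (fun q => connForm cov x q (coordField M y b q : E)) y :=
      ((contMDiffOn_connForm hcov x y b).contMDiffAt hsmall).mdifferentiableAt (by simp)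
    have h1 : ∀ᶠ q in 𝓝 y, covE cov s q (Z q)
        = connForm cov x q (coordField M y b q : E) • frame L x q := by
      filter_upwards [eventually_eventually_nhds.2 hsy, hsmall, hZ] with q hq hq1 hq2
      rw [covE_congr cov (secDiffAt_frame hq1.1) hq, hq2]
      exact covE_frame cov hq1.1 _
    rw [covE_congr cov (SecDiffAt.smul hd (secDiffAt_frame hy)) h1,
      covE_smul hcov hd (secDiffAt_frame hy), covE_frame cov hy, smul_smul, ← add_smul]
    congr 2
    · exact dM_form_coordField _ (contDiffAt_connForm hcov hy) a
    · rw [coordField_self]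
  have hXv : (X y : E) = v := by rw [hXy.self_of_nhds, coordField_self]
  have hYw : (Y y : E) = w := by rw [hYy.self_of_nhds, coordField_self]
  have hsf : s y = frame L x y := hsy.self_of_nhds
  have hc' : covE cov (fun q => covE cov s q (Y q)) y (X y)
      - covE cov (fun q => covE cov s q (X q)) y (Y y)
      = (-(Complex.I / (ħ : ℂ)) * ((Ω.app E y (X y) (Y y) : ℝ) : ℂ)) • s y := hc
  rw [main Y (X y) w hYy, main X (Y y) v hXy, ← sub_smul, hsf, hXv, hYw] at hc'
  have := smul_right_injective_of_ne_zero (frame_ne_zero hy) hc'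
  rw [← this, formD]
  ring

end Connection

/-! ### Scalar linear differential equations -/

section ScalarODE

/-- Serves to differentiate integrals also at the end points of the interval, by replacing the
integrand with one continuous on the whole line. -/
theorem exists_continuous_eqOn_Icc {G : Type*} [TopologicalSpace G] {a : ℝ → G} {l m : ℝ}
    (hlm : l ≤ m) (ha : ContinuousOn a (Icc l m)) :
    ∃ b : ℝ → G, Continuous b ∧ EqOn b a (Icc l m) := by
  refine ⟨IccExtend hlm ((Icc l m).domRestrict a), ?_, fun r hr => ?_⟩
  · exact (continuousOn_iff_continuous_domRestrict.1 ha).Icc_extend'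
  · rw [IccExtend_of_mem _ _ hr]
    rfl

theorem hasDerivAt_exp_integral {b : ℝ → ℂ} (hb : Continuous b) (l r : ℝ) :
    HasDerivAt (fun q => Complex.exp (∫ t in l..q, b t))
      (b r * Complex.exp (∫ t in l..r, b t)) r := by
  have h := (hb.integral_hasStrictDerivAt l r).hasDerivAt
  have := h.cexp
  rwa [mul_comm] at this

theorem eqOn_const_of_hasDerivWithinAt_zero {f : ℝ → ℂ} {s t : Set ℝ} (hst : s ⊆ t)
    (hs : Convex ℝ s) (hf : ∀ r ∈ s, HasDerivWithinAt f 0 t r) {x y : ℝ} (hx : x ∈ s)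
    (hy : y ∈ s) : f y = f x := by
  have := hs.norm_image_sub_le_of_norm_hasDerivWithin_le (f := f) (f' := fun _ => 0) (C := 0)
    (fun r hr => (hf r hr).mono hst) (fun r _ => by simp) hx hy
  rw [zero_mul] at this
  exact sub_eq_zero.1 (norm_le_zero_iff.1 this)

/-- The product of `f` with the integrating factor `exp (-∫ a)` has derivative zero. -/
theorem eq_exp_integral_of_hasDerivWithinAt {f a : ℝ → ℂ} {l m : ℝ} (hlm : l ≤ m)
    (ha : ContinuousOn a (Icc l m))
    (hf : ∀ r ∈ Icc l m, HasDerivWithinAt f (a r * f r) (Icc l m) r) :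
    f m = f l * Complex.exp (∫ t in l..m, a t) := by
  obtain ⟨b, hb, hba⟩ := exists_continuous_eqOn_Icc hlm ha
  have hint : ∫ t in l..m, a t = ∫ t in l..m, b t := by
    refine intervalIntegral.integral_congr fun t ht => ?_
    rw [uIcc_of_le hlm] at ht
    exact (hba ht).symm
  have hd : ∀ r ∈ Icc l m, HasDerivWithinAt
      (fun q => f q * Complex.exp (∫ t in l..q, -b t)) 0 (Icc l m) r := by
    intro r hr
    have h1 := (hf r hr).mul
      (hasDerivAt_exp_integral (b := fun t => -b t) hb.neg l r).hasDerivWithinAt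
    rw [← hba hr] at h1
    exact h1.congr_deriv (by ring)
  have h2 := eqOn_const_of_hasDerivWithinAt_zero subset_rfl (convex_Icc l m) hd
    (left_mem_Icc.2 hlm) (right_mem_Icc.2 hlm)
  simp only [intervalIntegral.integral_same, Complex.exp_zero, mul_one,
    intervalIntegral.integral_neg] at h2
  rw [hint, ← h2, mul_assoc, ← Complex.exp_add]
  simp

end ScalarODE

/-! ### Comparing points of one fibre -/

section Rho

variable {M : Type*} [TopologicalSpace M]
  {L : M → Type*} [TopologicalSpace (TotalSpace ℂ L)] [∀ x, TopologicalSpace (L x)]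
  [∀ x, AddCommGroup (L x)] [∀ x, Module ℂ (L x)]
  [FiberBundle ℂ L] [VectorBundle ℂ ℂ L]

/-- The fibre coordinate of a point of the total space in the preferred trivialization at its own
base point. -/
def rho (z : TotalSpace ℂ L) : ℂ := coord z.proj z

/-- Fibrewise multiplication by a complex number. -/
def smulT (k : ℂ) (z : TotalSpace ℂ L) : TotalSpace ℂ L := ⟨z.proj, k • z.2⟩

theorem rho_smulT (k : ℂ) (z : TotalSpace ℂ L) : rho (smulT k z) = k * rho z :=
  coord_smul (mem_base L z.proj) k z.2

theorem coord_smulT {x : M} (k : ℂ) {z : TotalSpace ℂ L} (hz : z.proj ∈ base L x) :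
    coord x (smulT k z) = k * coord x z :=
  coord_smul hz k z.2

/-- Coordinates of two points of one fibre are proportional in any two trivializations. The
cross-multiplied form needs no nonvanishing hypothesis. -/
theorem coord_mul_rho {x : M} {z z' : TotalSpace ℂ L} (h : z.proj = z'.proj)
    (hx : z.proj ∈ base L x) : coord x z * rho z' = rho z * coord x z' := by
  obtain ⟨y, v⟩ := z
  obtain ⟨y', v'⟩ := z'
  obtain rfl : y = y' := h
  have e : ∀ w : L y, rho ⟨y, w⟩ = coord x ⟨y, w⟩ * rho ⟨y, frame L x y⟩ := by
    intro w
    have h1 : (⟨y, w⟩ : TotalSpace ℂ L) = smulT (coord x ⟨y, w⟩) ⟨y, frame L x y⟩ := by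
      simp only [smulT]
      rw [coord_smul_frame hx]
    rw [h1, rho_smulT, ← h1]
  rw [e v, e v']
  ring

theorem rho_eq_coord_mul {x : M} {z : TotalSpace ℂ L} (hx : z.proj ∈ base L x) :
    rho z = coord x z * rho ⟨z.proj, frame L x z.proj⟩ := by
  have h := coord_mul_rho (x := x) (z := z) (z' := ⟨z.proj, frame L x z.proj⟩) rfl hx
  rw [coord_frame hx, mul_one] at h
  exact h.symm

theorem rho_eq_zero_iff (z : TotalSpace ℂ L) : rho z = 0 ↔ z.2 = 0 :=
  coord_eq_zero_iff (mem_base L z.proj) z.2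

theorem coord_ne_zero_iff {x : M} {z : TotalSpace ℂ L} (hx : z.proj ∈ base L x) :
    coord x z ≠ 0 ↔ rho z ≠ 0 :=
  not_congr ((coord_eq_zero_iff hx z.2).trans (rho_eq_zero_iff z).symm)

theorem eq_of_rho_eq {z z' : TotalSpace ℂ L} (h : z.proj = z'.proj) (h' : rho z = rho z') :
    z = z' := by
  obtain ⟨y, v⟩ := z
  obtain ⟨y', v'⟩ := z'
  obtain rfl : y = y' := h
  have h1 := coord_smul_frame (mem_base L y) v
  have h2 := coord_smul_frame (mem_base L y) v'
  have h3 : coord y ⟨y, v⟩ = coord y ⟨y, v'⟩ := h'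
  rw [← h1, h3, h2]

/-- Along a curve `rho` need not be continuous, as its trivialization changes with the point. A
quotient of two lifts of the same curve is independent of the trivialization, so it can be
differentiated in any one of them. -/
theorem coord_div_coord {x : M} {z z' : TotalSpace ℂ L} (h : z.proj = z'.proj)
    (hx : z.proj ∈ base L x) (hz : coord x z' ≠ 0) :
    coord x z / coord x z' = rho z / rho z' := by
  have h1 := (coord_ne_zero_iff (h ▸ hx : z'.proj ∈ base L x)).1 hz
  rw [div_eq_div_iff hz h1, coord_mul_rho h hx]

end Rho

/-! ### Parallel lifts of curves -/

section Horizontal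

variable {E : Type*} [NormedAddCommGroup E] [NormedSpace ℝ E]
  {M : Type*} [TopologicalSpace M] [ChartedSpace E M] [IsManifold 𝓘(ℝ, E) ∞ M]
  {L : M → Type*} [TopologicalSpace (TotalSpace ℂ L)] [∀ x, TopologicalSpace (L x)]
  [∀ x, AddCommGroup (L x)] [∀ x, Module ℂ (L x)]
  [∀ x, IsTopologicalAddGroup (L x)] [∀ x, ContinuousSMul ℝ (L x)]
  [FiberBundle ℂ L] [VectorBundle ℂ ℂ L] [VectorBundle ℝ ℂ L]
  [ContMDiffVectorBundle ∞ ℂ L 𝓘(ℝ, E)]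

/-- The lift `ξ` of the curve `c` to the total space of the line bundle is parallel at `r`: its
coordinate in every frame solves the equation of parallel transport. -/
def IsHorizontalAt (cov : CovariantDerivative 𝓘(ℝ, E) ℂ L) (c : ℝ → M)
    (ξ : ℝ → TotalSpace ℂ L) (r : ℝ) : Prop :=
  ∀ x, c r ∈ base L x → HasDerivWithinAt (fun q => coord x (ξ q))
    (-connForm cov x (c r) (vel E c r) * coord x (ξ r)) (Icc 0 1) r

variable {cov : CovariantDerivative 𝓘(ℝ, E) ℂ L} {c : ℝ → M}

theorem IsHorizontalAt.congr {ξ η : ℝ → TotalSpace ℂ L} {r : ℝ}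
    (h : IsHorizontalAt cov c ξ r) (hr : r ∈ Icc (0 : ℝ) 1)
    (he : ∀ᶠ q in 𝓝[Icc 0 1] r, η q = ξ q) : IsHorizontalAt cov c η r := by
  intro x hx
  have h1 := h x hx
  have h2 : η r = ξ r := he.self_of_nhdsWithin hr
  rw [← h2] at h1
  refine h1.congr_of_eventuallyEq ?_ (by rw [h2])
  filter_upwards [he] with q hq
  rw [hq]

theorem IsHorizontalAt.smulT {ξ : ℝ → TotalSpace ℂ L} {r : ℝ}
    (hc : ContinuousWithinAt c (Icc 0 1) r) (hξ : ∀ q, (ξ q).proj = c q)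
    (h : IsHorizontalAt cov c ξ r) (k : ℂ) :
    IsHorizontalAt cov c (fun q => smulT k (ξ q)) r := by
  intro x hx
  have h1 := (h x hx).const_mul k
  have he : ∀ q, c q ∈ base L x → coord x (PathHol.smulT k (ξ q)) = k * coord x (ξ q) :=
    fun q hq => coord_smulT k (by rwa [hξ q])
  rw [he r hx]
  refine (h1.congr_of_eventuallyEq ?_ (he r hx)).congr_deriv (by ring)
  filter_upwards [hc ((isOpen_base L x).mem_nhds hx)] with q hq
  exact he q hq

/-- A multiple of a section satisfying `∇σ = B ⊗ σ` is parallel along a curve when the factor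
solves the corresponding scalar equation. -/
theorem isHorizontalAt_of_section (hcov : IsSmoothComplexConnection cov) {r : ℝ}
    (hc : ContMDiffWithinAt 𝓘(ℝ, ℝ) 𝓘(ℝ, E) ∞ c (Icc 0 1) r)
    {σ : (x : M) → L x} (hσ : SecDiffAt (E := E) σ (c r)) {b : ℂ}
    (hB : covE cov σ (c r) (vel E c r) = b • σ (c r)) {k : ℝ → ℂ}
    (hk : HasDerivWithinAt k (-b * k r) (Icc 0 1) r) :
    IsHorizontalAt cov c (fun q => ⟨c q, k q • σ (c q)⟩) r := by
  intro x hx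
  have hd := (secDiffAt_iff hx).1 hσ
  have hg : HasDerivWithinAt (fun q => coord x ⟨c q, σ (c q)⟩)
      (dM E (fun y => coord x ⟨y, σ y⟩) (c r) (vel E c r)) (Icc 0 1) r := by
    have h1 := HasMFDerivAt.comp_hasMFDerivWithinAt r hd.hasMFDerivAt
      (hc.mdifferentiableWithinAt (by simp)).hasMFDerivWithinAt
    have h2 : HasFDerivWithinAt (fun q => coord x ⟨c q, σ (c q)⟩)
        ((dM E (fun y => coord x ⟨y, σ y⟩) (c r)).comp
          (mfderivWithin 𝓘(ℝ, ℝ) 𝓘(ℝ, E) c (Icc 0 1) r : ℝ →L[ℝ] E)) (Icc 0 1) r :=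
      h1.hasFDerivWithinAt
    exact h2.hasDerivWithinAt
  rw [covE_eq hcov hx hσ] at hB
  nth_rw 2 [← coord_smul_frame hx (σ (c r))] at hB
  rw [smul_smul] at hB
  have hB' := smul_right_injective_of_ne_zero (frame_ne_zero hx) hB
  have h3 := hk.mul hg
  have he : ∀ q, c q ∈ base L x →
      coord x ⟨c q, k q • σ (c q)⟩ = k q * coord x ⟨c q, σ (c q)⟩ :=
    fun q hq => coord_smul hq _ _
  refine (h3.congr_of_eventuallyEq ?_ (he r hx)).congr_deriv ?_
  · filter_upwards [hc.continuousWithinAt ((isOpen_base L x).mem_nhds hx)] with q hq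
    exact he q hq
  · rw [he r hx]
    linear_combination k r * hB'

/-- In the quotient rule the connection forms of numerator and denominator cancel and only `m`
survives. The case `m = 0` compares two parallel lifts; `m = √-1 ħ⁻¹λ` gives the connection on the
path space. -/
theorem hasDerivWithinAt_rho_div {ξ η : ℝ → TotalSpace ℂ L} {r : ℝ}
    (hc : ContinuousWithinAt c (Icc 0 1) r)
    (hξ : ∀ q, (ξ q).proj = c q) (hη : ∀ q, (η q).proj = c q) {x : M} (hx : c r ∈ base L x)
    {m : ℂ} (h1 : HasDerivWithinAt (fun q => coord x (ξ q))
      ((m - connForm cov x (c r) (vel E c r)) * coord x (ξ r)) (Icc 0 1) r)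
    (h2 : IsHorizontalAt cov c η r) (h0 : rho (η r) ≠ 0) :
    HasDerivWithinAt (fun q => rho (ξ q) / rho (η q)) (m * (rho (ξ r) / rho (η r)))
      (Icc 0 1) r := by
  have h0' : coord x (η r) ≠ 0 := (coord_ne_zero_iff (by rwa [hη])).2 h0
  have he : ∀ q, c q ∈ base L x → coord x (η q) ≠ 0 →
      rho (ξ q) / rho (η q) = coord x (ξ q) / coord x (η q) := fun q hq hq0 =>
    (coord_div_coord ((hξ q).trans (hη q).symm) (by rwa [hξ]) hq0).symm
  refine ((h1.div (h2 x hx) h0').congr_of_eventuallyEq ?_ (he r hx h0')).congr_deriv ?_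
  · filter_upwards [hc ((isOpen_base L x).mem_nhds hx),
      (h2 x hx).continuousWithinAt.eventually_ne h0'] with q hq hq0
    exact he q hq hq0
  · rw [he r hx h0']
    field_simp
    ring

theorem rho_div_eq_of_isHorizontalAt {ξ η : ℝ → TotalSpace ℂ L} {s : Set ℝ}
    (hs : Convex ℝ s) (hs1 : s ⊆ Icc 0 1) (hc : Continuous c)
    (hξ : ∀ q, (ξ q).proj = c q) (hη : ∀ q, (η q).proj = c q)
    (h1 : ∀ r ∈ s, IsHorizontalAt cov c ξ r) (h2 : ∀ r ∈ s, IsHorizontalAt cov c η r)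
    (h0 : ∀ r ∈ s, rho (η r) ≠ 0) {p q : ℝ} (hp : p ∈ s) (hq : q ∈ s) :
    rho (ξ q) / rho (η q) = rho (ξ p) / rho (η p) := by
  refine eqOn_const_of_hasDerivWithinAt_zero (f := fun q => rho (ξ q) / rho (η q)) hs1 hs
    (fun r hr => ?_) hp hq
  have := hasDerivWithinAt_rho_div (m := 0) hc.continuousWithinAt hξ hη
    (mem_base L (c r)) (by simpa using h1 r hr _ (mem_base L (c r))) (h2 r hr) (h0 r hr)
  simpa using this

variable [FiniteDimensional ℝ E] [T2Space M]

theorem continuousWithinAt_connForm_vel (hcov : IsSmoothComplexConnection cov)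
    (hc : ContMDiffOn 𝓘(ℝ, ℝ) 𝓘(ℝ, E) ∞ c (Icc 0 1)) {x : M} {r : ℝ} (hr : r ∈ Icc (0 : ℝ) 1)
    (hx : c r ∈ base L x) :
    ContinuousWithinAt (fun q => connForm cov x (c q) (vel E c q)) (Icc 0 1) r :=
  continuousWithinAt_apply_vel hr hc (contDiffAt_connForm hcov hx).continuousAt

/-- In rank one the equation of parallel transport is solved explicitly in a frame, by the
exponential of minus the integral of the connection form. Solutions do not vanish, which allows
later quotients. -/
theorem exists_horizontal_near (hcov : IsSmoothComplexConnection cov)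
    (hc : ContMDiffOn 𝓘(ℝ, ℝ) 𝓘(ℝ, E) ∞ c (Icc 0 1)) {x : M} {p δ : ℝ} (hp : p ∈ Icc (0 : ℝ) 1)
    (hδ : 0 < δ) (hx : ∀ r, |r - p| ≤ δ → c r ∈ base L x) :
    ∃ η : ℝ → TotalSpace ℂ L, (∀ r, (η r).proj = c r) ∧
      ∀ r ∈ Icc (0 : ℝ) 1, |r - p| < δ → IsHorizontalAt cov c η r ∧ rho (η r) ≠ 0 := by
  have hmem : ∀ r, r ∈ Icc (max 0 (p - δ)) (min 1 (p + δ)) ↔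
      r ∈ Icc (0 : ℝ) 1 ∧ |r - p| ≤ δ := by
    intro r
    rw [mem_Icc, mem_Icc, abs_le, max_le_iff, le_min_iff]
    constructor
    · rintro ⟨⟨h1, h2⟩, h3, h4⟩
      exact ⟨⟨h1, h3⟩, by linarith, by linarith⟩
    · rintro ⟨⟨h1, h2⟩, h3, h4⟩
      exact ⟨⟨h1, by linarith⟩, h2, by linarith⟩
  have hle : max 0 (p - δ) ≤ min 1 (p + δ) := by
    have := (hmem p).2 ⟨hp, by simp [hδ.le]⟩
    exact this.1.trans this.2
  obtain ⟨b, hb, hba⟩ := exists_continuous_eqOn_Icc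
    (a := fun q => connForm cov x (c q) (vel E c q)) hle (by
      intro r hr
      exact (continuousWithinAt_connForm_vel hcov hc ((hmem r).1 hr).1
        (hx r ((hmem r).1 hr).2)).mono fun q hq => ((hmem q).1 hq).1)
  refine ⟨fun q => ⟨c q, Complex.exp (∫ t in p..q, -b t) • frame L x (c q)⟩, fun _ => rfl, ?_⟩
  intro r hr hrδ
  have hxr := hx r hrδ.le
  constructor
  · refine isHorizontalAt_of_section hcov (hc r hr) (secDiffAt_frame hxr)
      (covE_frame cov hxr _) ?_
    have hbr : b r = connForm cov x (c r) (vel E c r) := hba ((hmem r).2 ⟨hr, hrδ.le⟩)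
    rw [← hbr]
    exact (hasDerivAt_exp_integral (b := fun t => -b t) hb.neg p r).hasDerivWithinAt
  · rw [Ne, rho_eq_zero_iff]
    exact smul_ne_zero (Complex.exp_ne_zero _) (frame_ne_zero hxr)

/-- Along every smooth curve there is a nowhere vanishing parallel lift. -/
theorem exists_horizontal (hcov : IsSmoothComplexConnection cov)
    (hc : ContMDiffOn 𝓘(ℝ, ℝ) 𝓘(ℝ, E) ∞ c (Icc 0 1)) (hcc : Continuous c) :
    ∃ ξ : ℝ → TotalSpace ℂ L, (∀ r, (ξ r).proj = c r) ∧
      ∀ r ∈ Icc (0 : ℝ) 1, IsHorizontalAt cov c ξ r ∧ rho (ξ r) ≠ 0 := by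
  obtain ⟨ε, hε, hball⟩ := lebesgue_number_lemma_of_metric (s := Icc (0 : ℝ) 1)
    (c := fun x : M => c ⁻¹' base L x) isCompact_Icc
    (fun x => (isOpen_base L x).preimage hcc) (fun r _ => mem_iUnion.2 ⟨c r, mem_base L (c r)⟩)
  obtain ⟨δ, hδ, hδε⟩ := exists_between hε
  have hloc : ∀ p ∈ Icc (0 : ℝ) 1, ∃ η : ℝ → TotalSpace ℂ L, (∀ r, (η r).proj = c r) ∧
      ∀ r ∈ Icc (0 : ℝ) 1, |r - p| < δ → IsHorizontalAt cov c η r ∧ rho (η r) ≠ 0 := by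
    intro p hp
    obtain ⟨x, hx⟩ := hball p hp
    exact exists_horizontal_near hcov hc hp hδ fun r hr => hx (by
      rw [Metric.mem_ball, Real.dist_eq]
      linarith)
  -- Each step takes a lift valid up to `t` and adds a local lift of radius `δ` centred at `p = t -
  -- δ/2`. This reaches `t + δ/2` and leaves an overlap on which to match the two.
  have key : ∀ n : ℕ, ∃ ξ : ℝ → TotalSpace ℂ L, (∀ r, (ξ r).proj = c r) ∧
      ∀ r ∈ Icc (0 : ℝ) 1, r < δ + n * (δ / 2) → IsHorizontalAt cov c ξ r ∧ rho (ξ r) ≠ 0 := by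
    intro n
    induction n with
    | zero =>
      obtain ⟨η, h1, h2⟩ := hloc 0 (by simp)
      refine ⟨η, h1, fun r hr hrδ => h2 r hr ?_⟩
      rw [sub_zero, abs_of_nonneg hr.1]
      simpa using hrδ
    | succ n ih =>
      obtain ⟨ξ, hξ, hξ1⟩ := ih
      set t : ℝ := δ + n * (δ / 2) with ht
      have htn : δ + ((n + 1 : ℕ) : ℝ) * (δ / 2) = t + δ / 2 := by
        rw [ht]; push_cast; ring
      rw [htn]
      by_cases ht1 : 1 < t
      · exact ⟨ξ, hξ, fun r hr _ => hξ1 r hr (hr.2.trans_lt ht1)⟩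
      have htδ : δ ≤ t := by
        rw [ht]
        have : (0 : ℝ) ≤ n * (δ / 2) := by positivity
        linarith
      set p := t - δ / 2 with hpdef
      have hp : p ∈ Icc (0 : ℝ) 1 := ⟨by linarith, by linarith⟩
      obtain ⟨η, hη, hη1⟩ := hloc p hp
      have hpt : p < t := by linarith
      -- The factor that makes the two lifts agree at `p`; the quotient of parallel lifts is
      -- constant, so they then agree on the whole overlap.
      set k := rho (ξ p) / rho (η p) with hk
      have hηp := hη1 p hp (by simpa using hδ)
      have hk0 : k ≠ 0 := div_ne_zero (hξ1 p hp hpt).2 hηp.2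
      have hov : ∀ q ∈ Icc (0 : ℝ) 1 ∩ Ioo (p - δ) t, |q - p| < δ := by
        rintro q ⟨-, h1, h2⟩
        rw [abs_lt]
        constructor <;> linarith
      have heq : ∀ q ∈ Icc (0 : ℝ) 1 ∩ Ioo (p - δ) t, ξ q = smulT k (η q) := by
        intro q hq
        have h1 := rho_div_eq_of_isHorizontalAt (cov := cov)
          (s := Icc (0 : ℝ) 1 ∩ Ioo (p - δ) t)
          ((convex_Icc 0 1).inter (convex_Ioo _ _)) inter_subset_left hcc hξ hη
          (fun r hr => (hξ1 r hr.1 hr.2.2).1) (fun r hr => (hη1 r hr.1 (hov r hr)).1)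
          (fun r hr => (hη1 r hr.1 (hov r hr)).2) (p := p) ⟨hp, by linarith, hpt⟩ hq
        refine eq_of_rho_eq ((hξ q).trans (hη q).symm) ?_
        rw [rho_smulT, hk, ← h1, div_mul_cancel₀ _ (hη1 q hq.1 (hov q hq)).2]
      refine ⟨fun r => if r < p then ξ r else smulT k (η r), fun r => ?_, fun r hr hrt => ?_⟩
      · beta_reduce
        split_ifs
        · exact hξ r
        · exact hη r
      rcases lt_or_ge r t with hrt' | hrt'
      · have hee : ∀ᶠ q in 𝓝[Icc 0 1] r,
            (if q < p then ξ q else smulT k (η q)) = ξ q := by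
          filter_upwards [self_mem_nhdsWithin, mem_nhdsWithin_of_mem_nhds (Iio_mem_nhds hrt')]
            with q hq hqt
          split_ifs with h
          · rfl
          · refine (heq q ⟨hq, ?_, hqt⟩).symm
            linarith
        refine ⟨(hξ1 r hr hrt').1.congr hr hee, ?_⟩
        beta_reduce
        rw [hee.self_of_nhdsWithin hr]
        exact (hξ1 r hr hrt').2
      · have hpr : p < r := by linarith
        have hrp : |r - p| < δ := by rw [abs_lt]; constructor <;> linarith
        have hee : ∀ᶠ q in 𝓝[Icc 0 1] r,
            (if q < p then ξ q else smulT k (η q)) = smulT k (η q) := by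
          filter_upwards [mem_nhdsWithin_of_mem_nhds (Ioi_mem_nhds hpr)] with q hq
          rw [if_neg (not_lt.2 (le_of_lt hq))]
        refine ⟨((hη1 r hr hrp).1.smulT hcc.continuousWithinAt hη k).congr hr hee, ?_⟩
        beta_reduce
        rw [hee.self_of_nhdsWithin hr, rho_smulT]
        exact mul_ne_zero hk0 (hη1 r hr hrp).2
  obtain ⟨n, hn⟩ := exists_nat_gt (1 / (δ / 2))
  obtain ⟨ξ, h1, h2⟩ := key n
  refine ⟨ξ, h1, fun r hr => h2 r hr ?_⟩
  rw [div_lt_iff₀ (by positivity)] at hn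
  linarith [hr.2]

end Horizontal

/-! ### Subdivision of rectangles -/

section Rectangles

/-- A property of the rectangles contained in the unit square which holds for small rectangles and
is preserved when rectangles are glued along an edge holds for all of them. -/
theorem rectangle_induction {P : ℝ → ℝ → ℝ → ℝ → Prop} {δ : ℝ} (hδ : 0 < δ)
    (h1 : ∀ a₀ m a₁ b₀ b₁, 0 ≤ a₀ → a₀ ≤ m → m ≤ a₁ → a₁ ≤ 1 → 0 ≤ b₀ → b₀ ≤ b₁ → b₁ ≤ 1 →
      P a₀ m b₀ b₁ → P m a₁ b₀ b₁ → P a₀ a₁ b₀ b₁)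
    (h2 : ∀ a₀ a₁ b₀ m b₁, 0 ≤ a₀ → a₀ ≤ a₁ → a₁ ≤ 1 → 0 ≤ b₀ → b₀ ≤ m → m ≤ b₁ → b₁ ≤ 1 →
      P a₀ a₁ b₀ m → P a₀ a₁ m b₁ → P a₀ a₁ b₀ b₁)
    (hloc : ∀ a₀ a₁ b₀ b₁, 0 ≤ a₀ → a₀ ≤ a₁ → a₁ ≤ 1 → 0 ≤ b₀ → b₀ ≤ b₁ → b₁ ≤ 1 →
      a₁ - a₀ ≤ δ → b₁ - b₀ ≤ δ → P a₀ a₁ b₀ b₁)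
    (a₀ a₁ b₀ b₁ : ℝ) (ha₀ : 0 ≤ a₀) (ha : a₀ ≤ a₁) (ha₁ : a₁ ≤ 1) (hb₀ : 0 ≤ b₀) (hb : b₀ ≤ b₁)
    (hb₁ : b₁ ≤ 1) : P a₀ a₁ b₀ b₁ := by
  -- Here `n` bounds the number of bisections of both sides needed to reach side length at most `δ`.
  have key : ∀ (n : ℕ) (a₀ a₁ b₀ b₁ : ℝ), 0 ≤ a₀ → a₀ ≤ a₁ → a₁ ≤ 1 → 0 ≤ b₀ → b₀ ≤ b₁ → b₁ ≤ 1 →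
      a₁ - a₀ ≤ 2 ^ n * δ → b₁ - b₀ ≤ 2 ^ n * δ → P a₀ a₁ b₀ b₁ := by
    intro n
    induction n with
    | zero => simpa using hloc
    | succ n ih =>
      intro a₀ a₁ b₀ b₁ ha₀ ha ha₁ hb₀ hb hb₁ hA hB
      rw [pow_succ] at hA hB
      have half : ∀ b b', 0 ≤ b → b ≤ b' → b' ≤ 1 → b' - b ≤ 2 ^ n * δ → P a₀ a₁ b b' := by
        intro b b' hb0 hbb hb1 hB'
        refine h1 a₀ ((a₀ + a₁) / 2) a₁ b b' ha₀ (by linarith) (by linarith) ha₁ hb0 hbb hb1 ?_ ?_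
        · exact ih _ _ _ _ ha₀ (by linarith) (by linarith) hb0 hbb hb1 (by linarith) hB'
        · exact ih _ _ _ _ (by linarith) (by linarith) ha₁ hb0 hbb hb1 (by linarith) hB'
      refine h2 a₀ a₁ b₀ ((b₀ + b₁) / 2) b₁ ha₀ ha ha₁ hb₀ (by linarith) (by linarith) hb₁ ?_ ?_
      · exact half _ _ hb₀ (by linarith) (by linarith) (by linarith)
      · exact half _ _ (by linarith) (by linarith) hb₁ (by linarith)
  obtain ⟨n, hn⟩ := pow_unbounded_of_one_lt (1 / δ) (one_lt_two (α := ℝ))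
  rw [div_lt_iff₀ hδ] at hn
  exact key n a₀ a₁ b₀ b₁ ha₀ ha ha₁ hb₀ hb hb₁ (by linarith) (by linarith)

/-- An iterated integral of a continuous function is additive under subdivision. -/
theorem integral_integral_add_left {w : ℝ × ℝ → ℝ} (hw : Continuous w) (a₀ m a₁ b₀ b₁ : ℝ) :
    ∫ a in a₀..a₁, ∫ b in b₀..b₁, w (a, b)
      = (∫ a in a₀..m, ∫ b in b₀..b₁, w (a, b)) + ∫ a in m..a₁, ∫ b in b₀..b₁, w (a, b) := by
  have h : Continuous fun a => ∫ b in b₀..b₁, w (a, b) :=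
    intervalIntegral.continuous_parametric_intervalIntegral_of_continuous'
      (f := fun a b => w (a, b)) hw b₀ b₁
  exact (intervalIntegral.integral_add_adjacent_intervals (h.intervalIntegrable _ _)
    (h.intervalIntegrable _ _)).symm

/-- An iterated integral of a continuous function is additive under subdivision. -/
theorem integral_integral_add_right {w : ℝ × ℝ → ℝ} (hw : Continuous w) (a₀ a₁ b₀ m b₁ : ℝ) :
    ∫ a in a₀..a₁, ∫ b in b₀..b₁, w (a, b)
      = (∫ a in a₀..a₁, ∫ b in b₀..m, w (a, b)) + ∫ a in a₀..a₁, ∫ b in m..b₁, w (a, b) := by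
  have h : ∀ c d : ℝ, Continuous fun a => ∫ b in c..d, w (a, b) := fun c d =>
    intervalIntegral.continuous_parametric_intervalIntegral_of_continuous'
      (f := fun a b => w (a, b)) hw c d
  rw [← intervalIntegral.integral_add ((h _ _).intervalIntegrable _ _)
    ((h _ _).intervalIntegrable _ _)]
  refine intervalIntegral.integral_congr fun a _ => ?_
  have hc : Continuous fun b => w (a, b) := hw.comp (by fun_prop)
  exact (intervalIntegral.integral_add_adjacent_intervals (hc.intervalIntegrable _ _)
    (hc.intervalIntegrable _ _)).symm

end Rectangles

/-! ### Homomorphisms on one-chains -/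

section Chains

variable {E : Type*} [NormedAddCommGroup E] [NormedSpace ℝ E]
  {M : Type*} [TopologicalSpace M] [ChartedSpace E M]

/-- A path functional which is given on reparametrized pieces of a path by the differences of a
potential extends to one-chains. -/
theorem exists_chainHom {G : Type*} [AddCommGroup G] (J : SmoothPath E M → G)
    (F : SmoothPath E M → unitInterval → G)
    (hF : ∀ (p q : SmoothPath E M) (φ : unitInterval → unitInterval), IsReparam φ →
      q.toFun = p.toFun ∘ φ → J q = F p (φ 1) - F p (φ 0)) :
    ∃ Φ : OneChain E M →+ G, ∀ γ : SmoothPath E M, Φ γ.chain = J γ := by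
  refine ⟨QuotientAddGroup.lift _ (FreeAbelianGroup.lift J) ?_, fun γ => ?_⟩
  · rw [AddSubgroup.closure_le]
    rintro z ⟨p, q₁, q₂, q₃, φ₁, φ₂, φ₃, h1, h2, h3, e1, e2, e3, h0, h01, h11, rfl⟩
    rw [SetLike.mem_coe, AddMonoidHom.mem_ker]
    simp only [map_sub, map_add, FreeAbelianGroup.lift_apply_of]
    -- The relation telescopes: the differences of the potential from `a` to `b` and from `b` to `c`
    -- add up to the one from `a` to `c`.
    rw [hF p q₁ φ₁ h1 e1, hF p q₂ φ₂ h2 e2, hF p q₃ φ₃ h3 e3, h0, h01, h11]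
    abel
  · exact FreeAbelianGroup.lift_apply_of J γ

/-- If a homomorphism agrees on the boundary of each patch with the integral of `Ω`, it does so on
the boundary of the surface. -/
theorem map_surfaceBoundary {G : Type*} [AddCommGroup G] (Φ : OneChain E M →+ G) (Ψ : ℝ →+ G)
    (Ω : BilinForm E M) (S : OrientedSurface E M)
    (h : ∀ u ∈ S, Φ u.boundary = Ψ (squareIntegral Ω u)) :
    Φ (surfaceBoundary S) = Ψ (surfaceIntegral Ω S) := by
  induction S with
  | nil => simp [surfaceBoundary, surfaceIntegral]
  | cons u S ih =>
    have h1 := ih fun v hv => h v (List.mem_cons_of_mem _ hv)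
    have h2 := h u List.mem_cons_self
    simp only [surfaceBoundary, surfaceIntegral, List.map_cons, List.sum_cons, map_add] at h1 ⊢
    rw [h1, h2]

variable [IsManifold 𝓘(ℝ, E) ∞ M]

theorem clamp_zero : clamp 0 = 0 := by simpa using clamp_coe 0

theorem clamp_one : clamp 1 = 1 := by simpa using clamp_coe 1

theorem IsReparam.hasDerivWithinAt {φ : unitInterval → unitInterval} (hφ : IsReparam φ) {r : ℝ}
    (hr : r ∈ Icc (0 : ℝ) 1) : HasDerivWithinAt (fun r : ℝ => (φ (clamp r) : ℝ))
      (derivWithin (fun r : ℝ => (φ (clamp r) : ℝ)) (Icc 0 1) r) (Icc 0 1) r :=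
  ((hφ r hr).differentiableWithinAt (by simp)).hasDerivWithinAt

theorem ext_reparam {p q : SmoothPath E M} {φ : unitInterval → unitInterval}
    (h : q.toFun = p.toFun ∘ φ) (r : ℝ) : q.ext' r = p.ext' (φ (clamp r)) := by
  simp only [SmoothPath.ext', h, Function.comp_apply, clamp_coe]

theorem vel_reparam {p q : SmoothPath E M} {φ : unitInterval → unitInterval}
    (hφ : IsReparam φ) (h : q.toFun = p.toFun ∘ φ) {r : ℝ} (hr : r ∈ Icc (0 : ℝ) 1) :
    vel E q.ext' r = derivWithin (fun r : ℝ => (φ (clamp r) : ℝ)) (Icc 0 1) r •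
      vel E p.ext' (φ (clamp r)) := by
  have hu : UniqueMDiffWithinAt 𝓘(ℝ, ℝ) (Icc (0 : ℝ) 1) r :=
    ((uniqueDiffOn_Icc zero_lt_one) r hr).uniqueMDiffWithinAt
  have h1 : HasMFDerivWithinAt 𝓘(ℝ, ℝ) 𝓘(ℝ, ℝ) (fun r : ℝ => (φ (clamp r) : ℝ)) (Icc 0 1) r _ :=
    (hφ.hasDerivWithinAt hr).hasFDerivWithinAt.hasMFDerivWithinAt
  have h2 : HasMFDerivWithinAt 𝓘(ℝ, ℝ) 𝓘(ℝ, E) p.ext' (Icc 0 1) (φ (clamp r) : ℝ) _ :=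
    ((p.contMDiffOn_ext _ (φ (clamp r)).2).mdifferentiableWithinAt (by simp)).hasMFDerivWithinAt
  have h3 := h2.comp r h1 (fun q _ => mem_preimage.2 (φ (clamp q)).2)
  have h4 : HasMFDerivWithinAt 𝓘(ℝ, ℝ) 𝓘(ℝ, E) (p.ext' ∘ fun r : ℝ => (φ (clamp r) : ℝ))
      (Icc 0 1) r (mfderivWithin 𝓘(ℝ, ℝ) 𝓘(ℝ, E) q.ext' (Icc 0 1) r) :=
    ((q.contMDiffOn_ext r hr).mdifferentiableWithinAt
      (by simp)).hasMFDerivWithinAt.congr_of_eventuallyEq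
      (Eventually.of_forall fun s => (ext_reparam h s).symm) (ext_reparam h r).symm
  have h5 := hu.eq h4 h3
  let A : ℝ →L[ℝ] E := mfderivWithin 𝓘(ℝ, ℝ) 𝓘(ℝ, E) p.ext' (Icc 0 1) (φ (clamp r) : ℝ)
  set k := derivWithin (fun r : ℝ => (φ (clamp r) : ℝ)) (Icc 0 1) r
  have h6 : vel E q.ext' r = A (ContinuousLinearMap.toSpanSingleton ℝ k 1) :=
    congrArg (fun A : ℝ →L[ℝ] E => A 1) h5
  rw [h6, ContinuousLinearMap.toSpanSingleton_apply, one_smul]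
  have h7 := A.map_smul k 1
  rw [smul_eq_mul, mul_one] at h7
  exact h7

/-- The line integral of a continuous one-form over a reparametrized piece of a path. -/
theorem integral_reparam {α : M → E →L[ℝ] ℝ}
    (hα : ∀ x, ContinuousAt (formInChart α x) (chartMap E x x))
    {p q : SmoothPath E M} {φ : unitInterval → unitInterval}
    (hφ : IsReparam φ) (h : q.toFun = p.toFun ∘ φ) :
    ∫ r in (0 : ℝ)..1, α (q.ext' r) (vel E q.ext' r)
      = (∫ r in (0 : ℝ)..(φ 1 : ℝ), α (p.ext' r) (vel E p.ext' r))
        - ∫ r in (0 : ℝ)..(φ 0 : ℝ), α (p.ext' r) (vel E p.ext' r) := by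
  have hcont : ∀ γ : SmoothPath E M,
      ContinuousOn (fun r => α (γ.ext' r) (vel E γ.ext' r)) (Icc 0 1) := fun γ r hr =>
    continuousWithinAt_apply_vel hr γ.contMDiffOn_ext (hα _)
  obtain ⟨b, hb, hbp⟩ := exists_continuous_eqOn_Icc zero_le_one (hcont p)
  have hint : ∀ t : unitInterval, ∫ r in (0 : ℝ)..t, α (p.ext' r) (vel E p.ext' r)
      = ∫ r in (0 : ℝ)..t, b r := by
    intro t
    refine intervalIntegral.integral_congr fun r hr => ?_
    rw [uIcc_of_le t.2.1] at hr
    exact (hbp ⟨hr.1, hr.2.trans t.2.2⟩).symm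
  -- The reparametrization need not be monotone, so instead of a change of variables the primitive
  -- along `p`, composed with `φ`, is shown to be a primitive along `q`.
  have hd : ∀ r ∈ Icc (0 : ℝ) 1, HasDerivWithinAt
      ((fun t => ∫ s in (0 : ℝ)..t, b s) ∘ fun r : ℝ => (φ (clamp r) : ℝ))
      (α (q.ext' r) (vel E q.ext' r)) (Icc 0 1) r := by
    intro r hr
    have h1 := (hb.integral_hasStrictDerivAt 0 (φ (clamp r) : ℝ)).hasDerivAt
    refine (h1.comp_hasDerivWithinAt r (hφ.hasDerivWithinAt hr)).congr_deriv ?_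
    rw [vel_reparam hφ h hr, map_smul, hbp (φ (clamp r)).2, ext_reparam h r, smul_eq_mul, mul_comm]
  have h2 := intervalIntegral.integral_eq_sub_of_hasDeriv_right_of_le zero_le_one
    (fun r hr => (hd r hr).continuousWithinAt)
    (fun r hr => ((hd r (Ioo_subset_Icc_self hr)).hasDerivAt
      (Icc_mem_nhds hr.1 hr.2)).hasDerivWithinAt)
    ((hcont q).intervalIntegrable_of_Icc zero_le_one)
  rw [h2, hint, hint]
  simp [clamp_zero, clamp_one]

end Chains

/-! ### Parallel transport along paths -/

section Transport

variable {E : Type*} [NormedAddCommGroup E] [NormedSpace ℝ E] [FiniteDimensional ℝ E]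
  {M : Type*} [TopologicalSpace M] [T2Space M] [ChartedSpace E M] [IsManifold 𝓘(ℝ, E) ∞ M]
  {L : M → Type*} [TopologicalSpace (TotalSpace ℂ L)] [∀ x, TopologicalSpace (L x)]
  [∀ x, AddCommGroup (L x)] [∀ x, Module ℂ (L x)]
  [∀ x, IsTopologicalAddGroup (L x)] [∀ x, ContinuousSMul ℝ (L x)]
  [FiberBundle ℂ L] [VectorBundle ℂ ℂ L] [VectorBundle ℝ ℂ L]
  [ContMDiffVectorBundle ∞ ℂ L 𝓘(ℝ, E)]
  {cov : CovariantDerivative 𝓘(ℝ, E) ℂ L} (hcov : IsSmoothComplexConnection cov)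

/-- A nowhere vanishing parallel lift of a path. -/
def lift (γ : SmoothPath E M) : ℝ → TotalSpace ℂ L :=
  (exists_horizontal hcov γ.contMDiffOn_ext γ.continuous_ext).choose

theorem lift_proj (γ : SmoothPath E M) (r : ℝ) : (lift hcov γ r).proj = γ.ext' r :=
  (exists_horizontal hcov γ.contMDiffOn_ext γ.continuous_ext).choose_spec.1 r

theorem isHorizontalAt_lift (γ : SmoothPath E M) {r : ℝ} (hr : r ∈ Icc (0 : ℝ) 1) :
    IsHorizontalAt cov γ.ext' (lift hcov γ) r :=
  ((exists_horizontal hcov γ.contMDiffOn_ext γ.continuous_ext).choose_spec.2 r hr).1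

theorem rho_lift_ne_zero (γ : SmoothPath E M) {r : ℝ} (hr : r ∈ Icc (0 : ℝ) 1) :
    rho (lift hcov γ r) ≠ 0 :=
  ((exists_horizontal hcov γ.contMDiffOn_ext γ.continuous_ext).choose_spec.2 r hr).2

/-- Parallel transport along `γ` from the parameter `r` to the parameter `s`, read in the preferred
trivializations at the end points. -/
def transport (γ : SmoothPath E M) (r s : ℝ) : ℂ := rho (lift hcov γ s) / rho (lift hcov γ r)

theorem transport_ne_zero (γ : SmoothPath E M) {r s : ℝ} (hr : r ∈ Icc (0 : ℝ) 1)
    (hs : s ∈ Icc (0 : ℝ) 1) : transport hcov γ r s ≠ 0 :=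
  div_ne_zero (rho_lift_ne_zero hcov γ hs) (rho_lift_ne_zero hcov γ hr)

theorem transport_mul_transport (γ : SmoothPath E M) (r : ℝ) {s : ℝ} (hs : s ∈ Icc (0 : ℝ) 1)
    (t : ℝ) : transport hcov γ r t = transport hcov γ r s * transport hcov γ s t := by
  rw [transport, transport, transport, div_mul_div_comm, mul_comm (rho (lift hcov γ s)),
    mul_div_mul_right _ _ (rho_lift_ne_zero hcov γ hs)]

/-- Every parallel lift computes the transport. -/
theorem transport_eq_of_isHorizontalAt (γ : SmoothPath E M) {η : ℝ → TotalSpace ℂ L}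
    (hη : ∀ r, (η r).proj = γ.ext' r)
    (h : ∀ r ∈ Icc (0 : ℝ) 1, IsHorizontalAt cov γ.ext' η r) {r s : ℝ}
    (hr : r ∈ Icc (0 : ℝ) 1) (hs : s ∈ Icc (0 : ℝ) 1) (h0 : rho (η r) ≠ 0) :
    transport hcov γ r s = rho (η s) / rho (η r) := by
  have h1 := rho_div_eq_of_isHorizontalAt (convex_Icc (0 : ℝ) 1) subset_rfl γ.continuous_ext hη
    (lift_proj hcov γ) h (fun r hr => isHorizontalAt_lift hcov γ hr)
    (fun r hr => rho_lift_ne_zero hcov γ hr) hr hs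
  rw [div_eq_div_iff (rho_lift_ne_zero hcov γ hs) (rho_lift_ne_zero hcov γ hr)] at h1
  rw [transport, div_eq_div_iff (rho_lift_ne_zero hcov γ hr) h0]
  linear_combination -h1

/-- A parallel lift of `p` composed with `φ` is a parallel lift of `q`, since both the derivative of
its coordinate and the velocity are multiplied by the derivative of `φ`. -/
theorem transport_reparam {p q : SmoothPath E M} {φ : unitInterval → unitInterval}
    (hφ : IsReparam φ) (h : q.toFun = p.toFun ∘ φ) :
    transport hcov q 0 1 = transport hcov p (φ 0) (φ 1) := by
  have h0 : ∀ r : ℝ, rho (lift hcov p (φ (clamp r))) ≠ 0 := fun r =>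
    rho_lift_ne_zero hcov p (φ (clamp r)).2
  rw [transport_eq_of_isHorizontalAt hcov q (η := fun r => lift hcov p (φ (clamp r)))
    (fun r => (lift_proj hcov p _).trans (ext_reparam h r).symm) ?_ (by simp) (by simp) (h0 0)]
  · simp [transport, clamp_zero, clamp_one]
  intro r hr x hx
  rw [ext_reparam h r] at hx
  have h1 := isHorizontalAt_lift hcov p (φ (clamp r)).2 x hx
  refine (HasDerivWithinAt.scomp (t' := Icc 0 1) r h1 (hφ.hasDerivWithinAt hr)
    (fun q _ => (φ (clamp q)).2)).congr_deriv ?_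
  rw [vel_reparam hφ h hr, map_smul, ext_reparam h r, Complex.real_smul, Complex.real_smul]
  ring

/-- The transport of a path contained in the domain of a trivialization. -/
theorem transport_eq_exp (γ : SmoothPath E M) {x : M} {r s : ℝ} (hr : 0 ≤ r) (hrs : r ≤ s)
    (hs : s ≤ 1) (hx : ∀ q ∈ Icc r s, γ.ext' q ∈ base L x) :
    transport hcov γ r s = rho ⟨γ.ext' s, frame L x (γ.ext' s)⟩
      / rho ⟨γ.ext' r, frame L x (γ.ext' r)⟩
      * Complex.exp (-∫ q in r..s, connForm cov x (γ.ext' q) (vel E γ.ext' q)) := by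
  have hsub : Icc r s ⊆ Icc 0 1 := Icc_subset_Icc hr hs
  have h1 := eq_exp_integral_of_hasDerivWithinAt (f := fun q => coord x (lift hcov γ q))
    (a := fun q => -connForm cov x (γ.ext' q) (vel E γ.ext' q)) hrs
    (fun q hq => ((continuousWithinAt_connForm_vel hcov γ.contMDiffOn_ext (hsub hq)
      (hx q hq)).mono hsub).neg)
    (fun q hq => (isHorizontalAt_lift hcov γ (hsub hq) x (hx q hq)).mono hsub)
  have hl := left_mem_Icc.2 hrs
  have hm := right_mem_Icc.2 hrs
  have h2 : ∀ q ∈ Icc r s, rho (lift hcov γ q) = coord x (lift hcov γ q) *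
      rho ⟨γ.ext' q, frame L x (γ.ext' q)⟩ := by
    intro q hq
    have := rho_eq_coord_mul (x := x) (z := lift hcov γ q) (by rw [lift_proj]; exact hx q hq)
    rwa [lift_proj] at this
  have h3 : coord x (lift hcov γ r) ≠ 0 :=
    (coord_ne_zero_iff (by rw [lift_proj]; exact hx r hl)).2 (rho_lift_ne_zero hcov γ (hsub hl))
  have h4 : rho ⟨γ.ext' r, frame L x (γ.ext' r)⟩ ≠ 0 :=
    (rho_eq_zero_iff _).not.2 (frame_ne_zero (hx r hl))
  rw [intervalIntegral.integral_neg] at h1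
  rw [transport, h2 s hm, h2 r hl, h1]
  field_simp

end Transport

/-! ### The phase homomorphism and its kernel -/

section Phase

theorem phase_add (ħ x y : ℝ) : phase ħ (x + y) = phase ħ x * phase ħ y := by
  rw [phase, phase, phase, ← Complex.exp_add]
  push_cast
  ring_nf

theorem phase_ne_zero (ħ x : ℝ) : phase ħ x ≠ 0 := Complex.exp_ne_zero _

/-- The phase, as a homomorphism to the multiplicative group. -/
def phaseHom (ħ : ℝ) : ℝ →+ Additive ℂˣ :=
  AddMonoidHom.mk' (fun x => Additive.ofMul (Units.mk0 (phase ħ x) (phase_ne_zero ħ x)))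
    fun x y => Additive.toMul.injective (Units.ext (phase_add ħ x y))

theorem exists_int_of_phase_eq {ħ : ℝ} (hħ : 0 < ħ) {x y : ℝ} (h : phase ħ x = phase ħ y) :
    ∃ n : ℤ, x - y = 2 * Real.pi * n * ħ := by
  obtain ⟨n, hn⟩ := Complex.exp_eq_exp_iff_exists_int.1 h
  refine ⟨n, ?_⟩
  have hħ' : (ħ : ℂ) ≠ 0 := by exact_mod_cast hħ.ne'
  have h1 : (x : ℂ) - y = 2 * Real.pi * n * ħ := by
    field_simp at hn
    linear_combination hn
  exact_mod_cast h1

end Phase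

/-! ### Densities on the square and Stokes for a potential -/

section Density

variable {E : Type*} [NormedAddCommGroup E] [NormedSpace ℝ E] [FiniteDimensional ℝ E]
  {M : Type*} [TopologicalSpace M] [ChartedSpace E M] [IsManifold 𝓘(ℝ, E) ∞ M]

/-- The pull-back of a two-form to the unit square, extended continuously to the plane. -/
def BilinForm.densityC (Ω : BilinForm E M) (u : SmoothSquare E M) (p : ℝ × ℝ) : ℝ :=
  Ω.density u ((clamp p.1 : ℝ), (clamp p.2 : ℝ))

theorem BilinForm.densityC_eq (Ω : BilinForm E M) (u : SmoothSquare E M) {p : ℝ × ℝ}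
    (hp : p ∈ unitSquare) : Ω.densityC u p = Ω.density u p := by
  rw [BilinForm.densityC, coe_clamp hp.1, coe_clamp hp.2]

theorem IsSymplectic.continuous_densityC {Ω : BilinForm E M} (hΩ : IsSymplectic Ω)
    (u : SmoothSquare E M) : Continuous (Ω.densityC u) := by
  refine (hΩ.continuousOn_density u).comp_continuous
    (f := fun p : ℝ × ℝ => ((clamp p.1 : ℝ), (clamp p.2 : ℝ))) ?_
    (fun p => ⟨(clamp p.1).2, (clamp p.2).2⟩)
  exact ((continuous_subtype_val.comp continuous_clamp).comp continuous_fst).prodMk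
    ((continuous_subtype_val.comp continuous_clamp).comp continuous_snd)

theorem squareIntegral_eq (Ω : BilinForm E M) (u : SmoothSquare E M) :
    squareIntegral Ω u = ∫ a in (0 : ℝ)..1, ∫ b in (0 : ℝ)..1, Ω.densityC u (a, b) := by
  refine intervalIntegral.integral_congr fun a ha => intervalIntegral.integral_congr fun b hb => ?_
  rw [uIcc_of_le zero_le_one] at ha hb
  exact (Ω.densityC_eq u (p := (a, b)) ⟨ha, hb⟩).symm

theorem mfderiv_chart_self (x : M) :
    (mfderiv 𝓘(ℝ, E) 𝓘(ℝ, E) (extChartAt 𝓘(ℝ, E) x) x : E →L[ℝ] E)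
      = ContinuousLinearMap.id ℝ E := by
  have : IsManifold 𝓘(ℝ, E) 1 M := IsManifold.of_le (n := ∞) (by simp)
  exact mfderiv_extChartAt_self

/-- The preferred chart at `x` has identity derivative at `x`, so the chart derivatives in
`OneForm.d` can be dropped. -/
theorem OneForm.d_eq (θ : OneForm E M) (x : M) (v w : E) :
    θ.d x v w = formD (fun y => (θ y : E →L[ℝ] ℝ)) x v w := by
  have h : ∀ v : E, (mfderiv 𝓘(ℝ, E) 𝓘(ℝ, E) (extChartAt 𝓘(ℝ, E) x) x : E →L[ℝ] E) v = v :=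
    fun v => congrArg (fun A : E →L[ℝ] E => A v) (mfderiv_chart_self x)
  unfold OneForm.d formD
  exact congrArg₂ (· - ·) (congrArg₂ (fun v w : E => fderiv ℝ (θ.inChart x) _ v w) (h v) (h w))
    (congrArg₂ (fun v w : E => fderiv ℝ (θ.inChart x) _ v w) (h w) (h v))

/-- Stokes' theorem for a symplectic potential. -/
theorem IsPotentialOn.stokes {Ω : BilinForm E M} (hΩ : IsSymplectic Ω) {θ : OneForm E M} {U : Set M}
    (hU : IsOpen U) (hθ : IsPotentialOn Ω θ U) (u : SmoothSquare E M)
    (hu : ∀ a b, u.toFun a b ∈ U) {a₀ a₁ b₀ b₁ : ℝ} (ha₀ : 0 ≤ a₀) (ha : a₀ ≤ a₁) (ha₁ : a₁ ≤ 1)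
    (hb₀ : 0 ≤ b₀) (hb : b₀ ≤ b₁) (hb₁ : b₁ ≤ 1) :
    (∫ a in a₀..a₁, θ (u.ext' a b₀) (u.e1 (a, b₀)))
      + (∫ b in b₀..b₁, θ (u.ext' a₁ b) (u.e2 (a₁, b)))
      - (∫ a in a₀..a₁, θ (u.ext' a b₁) (u.e1 (a, b₁)))
      - (∫ b in b₀..b₁, θ (u.ext' a₀ b) (u.e2 (a₀, b)))
      = ∫ a in a₀..a₁, ∫ b in b₀..b₁, Ω.densityC u (a, b) := by
  refine u.stokes (α := fun y => (θ y : E →L[ℝ] ℝ)) (V := U)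
    (fun x hx => (hθ.1.contDiffAt hU hx).of_le (by simp))
    (hΩ.continuous_densityC u).continuousOn (fun p hp hpU => ?_) ha₀ ha ha₁ hb₀ hb hb₁
    (fun p _ => hu _ _)
  rw [Ω.densityC_eq u hp, ← OneForm.d_eq]
  exact hθ.2 _ hpU _ _

end Density

/-! ### Transport around squares and spanning surfaces -/

section TransportStokes

variable {E : Type*} [NormedAddCommGroup E] [NormedSpace ℝ E] [FiniteDimensional ℝ E]
  {M : Type*} [TopologicalSpace M] [T2Space M] [ChartedSpace E M] [IsManifold 𝓘(ℝ, E) ∞ M]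
  {L : M → Type*} [TopologicalSpace (TotalSpace ℂ L)] [∀ x, TopologicalSpace (L x)]
  [∀ x, AddCommGroup (L x)] [∀ x, Module ℂ (L x)]
  [∀ x, IsTopologicalAddGroup (L x)] [∀ x, ContinuousSMul ℝ (L x)]
  [FiberBundle ℂ L] [VectorBundle ℂ ℂ L] [VectorBundle ℝ ℂ L]
  [ContMDiffVectorBundle ∞ ℂ L 𝓘(ℝ, E)]
  {cov : CovariantDerivative 𝓘(ℝ, E) ℂ L} (hcov : IsSmoothComplexConnection cov)
  {ħ : ℝ} {Ω : BilinForm E M}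

/-- The curvature computes the transport around a rectangle in the domain of a trivialization. -/
theorem transport_rectangle_of_base (hΩ : IsSymplectic Ω) (hcurv : HasCurvature cov ħ Ω)
    (u : SmoothSquare E M) {x : M}
    {a₀ a₁ b₀ b₁ : ℝ} (ha₀ : 0 ≤ a₀) (ha : a₀ ≤ a₁) (ha₁ : a₁ ≤ 1)
    (hb₀ : 0 ≤ b₀) (hb : b₀ ≤ b₁) (hb₁ : b₁ ≤ 1)
    (hx : ∀ p ∈ Icc a₀ a₁ ×ˢ Icc b₀ b₁, u.ext' p.1 p.2 ∈ base L x) :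
    transport hcov (u.snd (clamp b₀)) a₀ a₁ * transport hcov (u.fst (clamp a₁)) b₀ b₁
      = phase ħ (∫ a in a₀..a₁, ∫ b in b₀..b₁, Ω.densityC u (a, b))
        * (transport hcov (u.snd (clamp b₁)) a₀ a₁ * transport hcov (u.fst (clamp a₀)) b₀ b₁) := by
  -- The change from the preferred trivialization at each point to the fixed frame at `x`. Each edge
  -- contributes a ratio of its values at two corners, and on both sides of the identity these
  -- multiply to the ratio for opposite corners.
  let g : ℝ → ℝ → ℂ := fun a b => rho ⟨u.ext' a b, frame L x (u.ext' a b)⟩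
  have hg : ∀ a ∈ Icc a₀ a₁, ∀ b ∈ Icc b₀ b₁, g a b ≠ 0 := fun a ha b hb =>
    (rho_eq_zero_iff _).not.2 (frame_ne_zero (hx (a, b) ⟨ha, hb⟩))
  have h1 : ∀ b ∈ Icc b₀ b₁, transport hcov (u.snd (clamp b)) a₀ a₁ = g a₁ b / g a₀ b
      * Complex.exp (-∫ a in a₀..a₁, connForm cov x (u.ext' a b) (u.e1 (a, b))) := fun b hb =>
    transport_eq_exp hcov (u.snd (clamp b)) ha₀ ha ha₁ fun a ha => hx (a, b) ⟨ha, hb⟩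
  have h2 : ∀ a ∈ Icc a₀ a₁, transport hcov (u.fst (clamp a)) b₀ b₁ = g a b₁ / g a b₀
      * Complex.exp (-∫ b in b₀..b₁, connForm cov x (u.ext' a b) (u.e2 (a, b))) := fun a ha =>
    transport_eq_exp hcov (u.fst (clamp a)) hb₀ hb hb₁ fun b hb => hx (a, b) ⟨ha, hb⟩
  have hs := u.stokes (α := connForm cov x) (V := base L x)
    (w := fun p => -(Complex.I / (ħ : ℂ)) * ((Ω.densityC u p : ℝ) : ℂ))
    (fun y hy => (contDiffAt_connForm hcov hy).of_le (by simp))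
    (by have := hΩ.continuous_densityC u; fun_prop)
    (fun p hp hpU => by rw [Ω.densityC_eq u hp]; exact formD_connForm hcov hcurv hpU _ _)
    ha₀ ha ha₁ hb₀ hb hb₁ hx
  simp only [intervalIntegral.integral_const_mul, intervalIntegral.integral_ofReal] at hs
  have hA0 := left_mem_Icc.2 ha
  have hA1 := right_mem_Icc.2 ha
  have hB0 := left_mem_Icc.2 hb
  have hB1 := right_mem_Icc.2 hb
  rw [h1 b₀ hB0, h1 b₁ hB1, h2 a₀ hA0, h2 a₁ hA1, phase]
  have n00 := hg _ hA0 _ hB0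
  have n01 := hg _ hA0 _ hB1
  have n10 := hg _ hA1 _ hB0
  have n11 := hg _ hA1 _ hB1
  generalize (∫ a in a₀..a₁, connForm cov x (u.ext' a b₀) (u.e1 (a, b₀))) = I1 at hs ⊢
  generalize (∫ a in a₀..a₁, connForm cov x (u.ext' a b₁) (u.e1 (a, b₁))) = I2 at hs ⊢
  generalize (∫ b in b₀..b₁, connForm cov x (u.ext' a₀ b) (u.e2 (a₀, b))) = I3 at hs ⊢
  generalize (∫ b in b₀..b₁, connForm cov x (u.ext' a₁ b) (u.e2 (a₁, b))) = I4 at hs ⊢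
  generalize (∫ a in a₀..a₁, ∫ b in b₀..b₁, Ω.densityC u (a, b)) = W at hs ⊢
  have he : Complex.exp (-I1) * Complex.exp (-I4)
      = Complex.exp (Complex.I / ħ * W) * (Complex.exp (-I2) * Complex.exp (-I3)) := by
    rw [← Complex.exp_add, ← Complex.exp_add, ← Complex.exp_add]
    congr 1
    linear_combination -hs
  calc _ = g a₁ b₁ / g a₀ b₀ * (Complex.exp (-I1) * Complex.exp (-I4)) := by field_simp
    _ = _ := by rw [he]; field_simp

/-- The curvature computes the transport around a rectangle. -/
theorem transport_rectangle (hΩ : IsSymplectic Ω) (hcurv : HasCurvature cov ħ Ω)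
    (u : SmoothSquare E M) {a₀ a₁ b₀ b₁ : ℝ} (ha₀ : 0 ≤ a₀) (ha : a₀ ≤ a₁) (ha₁ : a₁ ≤ 1)
    (hb₀ : 0 ≤ b₀) (hb : b₀ ≤ b₁) (hb₁ : b₁ ≤ 1) :
    transport hcov (u.snd (clamp b₀)) a₀ a₁ * transport hcov (u.fst (clamp a₁)) b₀ b₁
      = phase ħ (∫ a in a₀..a₁, ∫ b in b₀..b₁, Ω.densityC u (a, b))
        * (transport hcov (u.snd (clamp b₁)) a₀ a₁ * transport hcov (u.fst (clamp a₀)) b₀ b₁) := by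
  have hw := hΩ.continuous_densityC u
  obtain ⟨ε, hε, hball⟩ := lebesgue_number_lemma_of_metric (s := unitSquare)
    (c := fun x : M => (fun p : ℝ × ℝ => u.ext' p.1 p.2) ⁻¹' base L x)
    (isCompact_Icc.prod isCompact_Icc) (fun x => (isOpen_base L x).preimage u.continuous_ext)
    (fun r _ => mem_iUnion.2 ⟨u.ext' r.1 r.2, mem_base L _⟩)
  revert a₀ a₁ b₀ b₁
  refine fun {a₀ a₁ b₀ b₁} => rectangle_induction (P := fun a₀ a₁ b₀ b₁ =>
    transport hcov (u.snd (clamp b₀)) a₀ a₁ * transport hcov (u.fst (clamp a₁)) b₀ b₁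
      = phase ħ (∫ a in a₀..a₁, ∫ b in b₀..b₁, Ω.densityC u (a, b))
        * (transport hcov (u.snd (clamp b₁)) a₀ a₁ * transport hcov (u.fst (clamp a₀)) b₀ b₁))
    (half_pos hε) ?_ ?_ ?_ a₀ a₁ b₀ b₁
  -- The transport along the common edge `a = m` stands on the right of `P2` and on the left of
  -- `P1`, so substituting one into the other removes it without division.
  · intro a₀ m a₁ b₀ b₁ h0 h1 h2 h3 h4 h5 h6 P1 P2
    have hm : m ∈ Icc (0 : ℝ) 1 := ⟨h0.trans h1, h2.trans h3⟩
    rw [transport_mul_transport hcov _ a₀ hm a₁,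
      transport_mul_transport hcov (u.snd (clamp b₁)) a₀ hm a₁,
      integral_integral_add_left hw a₀ m a₁, phase_add, mul_assoc, P2]
    linear_combination phase ħ (∫ a in m..a₁, ∫ b in b₀..b₁, Ω.densityC u (a, b)) *
      transport hcov (u.snd (clamp b₁)) m a₁ * P1
  · intro a₀ a₁ b₀ m b₁ h0 h1 h2 h3 h4 h5 h6 P1 P2
    have hm : m ∈ Icc (0 : ℝ) 1 := ⟨h3.trans h4, h5.trans h6⟩
    rw [transport_mul_transport hcov _ b₀ hm b₁,
      transport_mul_transport hcov (u.fst (clamp a₀)) b₀ hm b₁,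
      integral_integral_add_right hw a₀ a₁ b₀ m b₁, phase_add, ← mul_assoc, P1]
    linear_combination phase ħ (∫ a in a₀..a₁, ∫ b in b₀..m, Ω.densityC u (a, b)) *
      transport hcov (u.fst (clamp a₀)) b₀ m * P2
  · intro a₀ a₁ b₀ b₁ h0 h1 h2 h3 h4 h5 h6 h7
    obtain ⟨x, hx⟩ := hball (a₀, b₀) ⟨⟨h0, h1.trans h2⟩, ⟨h3, h4.trans h5⟩⟩
    refine transport_rectangle_of_base hcov hΩ hcurv u (x := x) h0 h1 h2 h3 h4 h5 fun p hp => hx ?_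
    rw [Metric.mem_ball, Prod.dist_eq, max_lt_iff, Real.dist_eq, Real.dist_eq,
      abs_of_nonneg (sub_nonneg.2 hp.1.1), abs_of_nonneg (sub_nonneg.2 hp.2.1)]
    constructor <;> linarith [hp.1.2, hp.2.2]

/-- The transport as a homomorphism on one-chains. -/
theorem exists_transportHom : ∃ Φ : OneChain E M →+ Additive ℂˣ, ∀ γ : SmoothPath E M,
    (((Φ γ.chain).toMul : ℂˣ) : ℂ) = transport hcov γ 0 1 := by
  have h0 := fun (γ : SmoothPath E M) (t : unitInterval) => rho_lift_ne_zero hcov γ t.2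
  obtain ⟨Φ, hΦ⟩ := exists_chainHom (E := E) (M := M)
    (fun γ => Additive.ofMul (Units.mk0 (transport hcov γ 0 1)
      (transport_ne_zero hcov γ (by simp) (by simp))))
    -- The coordinate of a chosen parallel lift is a multiplicative potential for the transport: its
    -- quotients are the transports along the pieces of the path.
    (fun γ t => Additive.ofMul (Units.mk0 (rho (lift hcov γ t)) (h0 γ t))) (by
      intro p q φ hφ h
      refine Additive.toMul.injective (Units.ext ?_)
      simp only [toMul_ofMul, toMul_sub, Units.val_div_eq_div_val, Units.val_mk0]
      exact transport_reparam hcov hφ h)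
  exact ⟨Φ, fun γ => by rw [hΦ]; rfl⟩

/-- The transport around a loop spanned by a surface. -/
theorem transport_eq_phase_of_spans (hΩ : IsSymplectic Ω) (hcurv : HasCurvature cov ħ Ω)
    {S : OrientedSurface E M} {γ : SmoothPath E M} (h : Spans S γ) :
    transport hcov γ 0 1 = phase ħ (surfaceIntegral Ω S) := by
  obtain ⟨Φ, hΦ⟩ := exists_transportHom hcov
  rw [← hΦ, ← h, map_surfaceBoundary Φ (phaseHom ħ) Ω S]
  · rfl
  intro u _
  refine Additive.toMul.injective (Units.ext ?_)
  have e : Φ u.boundary = Φ (u.snd 0).chain + Φ (u.fst 1).chain - Φ (u.snd 1).chain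
      - Φ (u.fst 0).chain := by
    simp only [SmoothSquare.boundary, map_sub, map_add]
  rw [e]
  simp only [toMul_sub, toMul_add, Units.val_div_eq_div_val, Units.val_mul, hΦ]
  have h1 := transport_rectangle hcov hΩ hcurv u le_rfl zero_le_one le_rfl le_rfl zero_le_one le_rfl
  rw [clamp_zero, clamp_one, ← squareIntegral_eq] at h1
  rw [h1, div_div, mul_div_cancel_right₀]
  · rfl
  · exact mul_ne_zero (transport_ne_zero hcov _ (by simp) (by simp))
      (transport_ne_zero hcov _ (by simp) (by simp))

/-- The transports around the longitudinal loops of a loop of paths. -/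
theorem transport_snd_of_isLoop (hΩ : IsSymplectic Ω) (hcurv : HasCurvature cov ħ Ω)
    {Γ : SmoothSquare E M} (hΓ : Γ.IsLoop) {t : ℝ} (ht : t ∈ Icc (0 : ℝ) 1) :
    transport hcov (Γ.snd 0) 0 1
      = phase ħ (∫ a in (0 : ℝ)..1, ∫ b in (0 : ℝ)..t, Ω.densityC Γ (a, b))
        * transport hcov (Γ.snd (clamp t)) 0 1 := by
  have h1 := transport_rectangle hcov hΩ hcurv Γ le_rfl zero_le_one le_rfl le_rfl ht.1 ht.2
  -- The loop condition makes the two transverse edges the same path, so their transports over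
  -- `[0,t]` cancel.
  rw [clamp_zero, clamp_one, ← show Γ.fst 0 = Γ.fst 1 from hΓ, ← mul_assoc] at h1
  exact mul_right_cancel₀ (transport_ne_zero hcov _ (by simp) ht) h1

end TransportStokes

/-! ### The one-form on path space and the flux -/

section Lambda

variable {E : Type*} [NormedAddCommGroup E] [NormedSpace ℝ E] [FiniteDimensional ℝ E]
  {M : Type*} [TopologicalSpace M] [ChartedSpace E M] [IsManifold 𝓘(ℝ, E) ∞ M]
  {Ω : BilinForm E M}

theorem IsSymplectic.app_swap (hΩ : IsSymplectic Ω) (x : M) (v w : E) :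
    Ω.app E x v w = -Ω.app E x w v := by
  have h : ∀ v, Ω.app E x v v = 0 := hΩ.alternating x
  have h1 := h (v + w)
  simp only [map_add, add_apply, h v, h w] at h1
  linarith

/-- The one-form `λ` on the tangent vectors of a path of paths. -/
def lam (Ω : BilinForm E M) (Γ : SmoothSquare E M) (s : ℝ) : ℝ :=
  -∫ t in (0 : ℝ)..1, ∫ τ in (0 : ℝ)..t, Ω.densityC Γ (s, τ)

/-- The sign in `lam` arises because `λ` pairs the velocity along the path first and the variation
second, whereas the density pairs `∂_s` first. -/
theorem lambdaForm_eq_lam (hΩ : IsSymplectic Ω) (Γ : SmoothSquare E M) {s : ℝ}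
    (hs : s ∈ Icc (0 : ℝ) 1) :
    lambdaForm Ω (Γ.fst (clamp s)) (Γ.tangent s) = lam Ω Γ s := by
  rw [lam, ← intervalIntegral.integral_neg]
  refine intervalIntegral.integral_congr fun t ht => ?_
  rw [← intervalIntegral.integral_neg]
  refine intervalIntegral.integral_congr fun τ hτ => ?_
  rw [uIcc_of_le zero_le_one] at ht
  rw [uIcc_of_le ht.1] at hτ
  rw [Ω.densityC_eq Γ (p := (s, τ)) ⟨hs, hτ.1, hτ.2.trans ht.2⟩, BilinForm.density,
    ← hΩ.app_swap]
  rfl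

theorem continuous_integral_density (hΩ : IsSymplectic Ω) (Γ : SmoothSquare E M) :
    Continuous fun p : ℝ × ℝ => ∫ τ in (0 : ℝ)..p.2, Ω.densityC Γ (p.1, τ) := by
  have h := hΩ.continuous_densityC Γ
  refine intervalIntegral.continuous_parametric_intervalIntegral_of_continuous
    (f := fun (p : ℝ × ℝ) τ => Ω.densityC Γ (p.1, τ)) (h.comp (by fun_prop)) continuous_snd

theorem continuous_lam (hΩ : IsSymplectic Ω) (Γ : SmoothSquare E M) : Continuous (lam Ω Γ) :=
  (intervalIntegral.continuous_parametric_intervalIntegral_of_continuous'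
    (f := fun s t => ∫ τ in (0 : ℝ)..t, Ω.densityC Γ (s, τ))
    (continuous_integral_density hΩ Γ) 0 1).neg

/-- The integral of the pull-back of `Ω` over `[0,1] × [0,t]`. -/
def flux (Ω : BilinForm E M) (Γ : SmoothSquare E M) (t : ℝ) : ℝ :=
  ∫ a in (0 : ℝ)..1, ∫ b in (0 : ℝ)..t, Ω.densityC Γ (a, b)

theorem flux_zero (Γ : SmoothSquare E M) : flux Ω Γ 0 = 0 := by simp [flux]

theorem continuous_flux (hΩ : IsSymplectic Ω) (Γ : SmoothSquare E M) :
    Continuous (flux Ω Γ) := by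
  have h : Continuous fun p : ℝ × ℝ => ∫ τ in (0 : ℝ)..p.1, Ω.densityC Γ (p.2, τ) :=
    (continuous_integral_density hΩ Γ).comp (continuous_snd.prodMk continuous_fst)
  exact intervalIntegral.continuous_parametric_intervalIntegral_of_continuous'
    (f := fun t a => ∫ τ in (0 : ℝ)..t, Ω.densityC Γ (a, τ)) h 0 1

/-- Fubini in `s` and `t`, with the inner integral over `[0,t]` left in place. -/
theorem integral_lam (hΩ : IsSymplectic Ω) (Γ : SmoothSquare E M) :
    ∫ s in (0 : ℝ)..1, lam Ω Γ s = -∫ t in (0 : ℝ)..1, flux Ω Γ t := by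
  simp only [lam, flux, intervalIntegral.integral_neg]
  congr 1
  refine intervalIntegral_intervalIntegral_swap (F := fun s t =>
    ∫ τ in (0 : ℝ)..t, Ω.densityC Γ (s, τ)) ?_
  exact ((continuous_integral_density hΩ Γ).continuousOn.integrableOn_compact
    (isCompact_uIcc.prod isCompact_uIcc)).mono_set
      (prod_mono uIoc_subset_uIcc uIoc_subset_uIcc)

end Lambda

/-! ### Holonomy on the path space -/

section Holonomy

variable {E : Type*} [NormedAddCommGroup E] [NormedSpace ℝ E] [FiniteDimensional ℝ E]
  {M : Type*} [TopologicalSpace M] [T2Space M] [ChartedSpace E M] [IsManifold 𝓘(ℝ, E) ∞ M]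
  {L : M → Type*} [TopologicalSpace (TotalSpace ℂ L)] [∀ x, TopologicalSpace (L x)]
  [∀ x, AddCommGroup (L x)] [∀ x, Module ℂ (L x)]
  [∀ x, IsTopologicalAddGroup (L x)] [∀ x, ContinuousSMul ℝ (L x)]
  [FiberBundle ℂ L] [VectorBundle ℂ ℂ L] [VectorBundle ℝ ℂ L]
  [ContMDiffVectorBundle ∞ ℂ L 𝓘(ℝ, E)]
  {cov : CovariantDerivative 𝓘(ℝ, E) ℂ L} (hcov : IsSmoothComplexConnection cov)
  {ħ : ℝ} {Ω : BilinForm E M} {Γ : SmoothSquare E M}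

theorem ev0_eq_ext (Γ : SmoothSquare E M) : Γ.ev0 = (Γ.snd 0).ext' := by
  funext s
  simp only [SmoothSquare.ev0, SmoothPath.ext', SmoothSquare.fst, SmoothSquare.snd, clamp_zero]

/-- The equation of parallel transport for sections along a path of paths, in coordinates. -/
theorem isParallel_iff (hΩ : IsSymplectic Ω) (ξ : (s : ℝ) → L (Γ.ev0 s)) :
    IsParallel cov ħ Ω Γ ξ ↔ ∀ s ∈ Icc (0 : ℝ) 1,
      HasDerivWithinAt (fun q => coord (Γ.ev0 s) ⟨Γ.ev0 q, ξ q⟩)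
        ((Complex.I / ħ * (lam Ω Γ s : ℝ) - connForm cov (Γ.ev0 s) (Γ.ev0 s) (vel E Γ.ev0 s))
          * coord (Γ.ev0 s) ⟨Γ.ev0 s, ξ s⟩) (Icc 0 1) s := by
  have hc : ∀ s ∈ Icc (0 : ℝ) 1, MDifferentiableWithinAt 𝓘(ℝ, ℝ) 𝓘(ℝ, E) Γ.ev0 (Icc 0 1) s := by
    rw [ev0_eq_ext]
    exact fun s hs => ((Γ.snd 0).contMDiffOn_ext s hs).mdifferentiableWithinAt (by simp)
  have hd : ∀ s ∈ Icc (0 : ℝ) 1, (MDifferentiableWithinAt 𝓘(ℝ, ℝ) (𝓘(ℝ, E).prod 𝓘(ℝ, ℂ))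
      (fun s : ℝ => TotalSpace.mk' ℂ (Γ.ev0 s) (ξ s)) (Icc 0 1) s ↔
      DifferentiableWithinAt ℝ (fun q => coord (Γ.ev0 s) ⟨Γ.ev0 q, ξ q⟩) (Icc 0 1) s) := by
    intro s hs
    -- Differentiability of a lift is that of its base curve together with that of its fibre
    -- coordinate; the base curve is smooth here.
    rw [mdifferentiableWithinAt_totalSpace, ← mdifferentiableWithinAt_iff_differentiableWithinAt]
    exact and_iff_right (hc s hs)
  have hp : ∀ s ∈ Icc (0 : ℝ) 1, (pathCovDeriv cov ħ Ω Γ ξ s = 0 ↔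
      derivWithin (fun q => coord (Γ.ev0 s) ⟨Γ.ev0 q, ξ q⟩) (Icc 0 1) s =
        (Complex.I / ħ * (lam Ω Γ s : ℝ) - connForm cov (Γ.ev0 s) (Γ.ev0 s) (vel E Γ.ev0 s))
          * coord (Γ.ev0 s) ⟨Γ.ev0 s, ξ s⟩) := by
    intro s hs
    set x := Γ.ev0 s
    set f := fun q => coord x ⟨Γ.ev0 q, ξ q⟩
    have h1 : covDerivAlong cov Γ.ev0 ξ s
        = derivWithin f (Icc 0 1) s • frame L x x + f s • covE cov (frame L x) x (vel E Γ.ev0 s) :=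
      rfl
    have h2 : ξ s = f s • frame L x x := (coord_smul_frame (mem_base L x) (ξ s)).symm
    have h3 : pathCovDeriv cov ħ Ω Γ ξ s = (derivWithin f (Icc 0 1) s
        - (Complex.I / ħ * (lam Ω Γ s : ℝ) - connForm cov x x (vel E Γ.ev0 s)) * f s)
          • frame L x x := by
      rw [pathCovDeriv, h1, lambdaForm_eq_lam hΩ Γ hs, covE_frame cov (mem_base L x)]
      nth_rw 1 [h2]
      simp only [smul_smul]
      rw [← add_smul, ← sub_smul]
      congr 1
      ring
    rw [h3, ← sub_eq_zero (a := derivWithin f (Icc 0 1) s)]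
    refine ⟨fun h => smul_right_injective_of_ne_zero (frame_ne_zero (mem_base L x))
      (h.trans (zero_smul ℂ _).symm), fun h => ?_⟩
    rw [h, zero_smul]
  constructor
  · rintro ⟨h1, h2⟩ s hs
    exact (((hd s hs).1 (h1 s hs)).hasDerivWithinAt).congr_deriv ((hp s hs).1 (h2 s hs))
  · intro h
    refine ⟨fun s hs => (hd s hs).2 (h s hs).differentiableWithinAt, fun s hs => (hp s hs).2 ?_⟩
    exact (h s hs).derivWithin (uniqueDiffOn_Icc zero_lt_one s hs)

/-- The holonomy, in terms of the transport around the loop of initial points. -/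
theorem hasHolonomy_transport (hΩ : IsSymplectic Ω) (hΓ : Γ.IsLoop) :
    HasHolonomy cov ħ Ω Γ
      (transport hcov (Γ.snd 0) 0 1 * phase ħ (∫ s in (0 : ℝ)..1, lam Ω Γ s)) := by
  have hloop : Γ.ev0 1 = Γ.ev0 0 := by
    rw [ev0_eq_ext]
    exact (congrArg (fun γ : SmoothPath E M => γ.toFun 0)
      (show Γ.fst (clamp 0) = Γ.fst (clamp 1) by rw [clamp_zero, clamp_one]; exact hΓ)).symm
  have hcc : Continuous Γ.ev0 := by rw [ev0_eq_ext]; exact (Γ.snd 0).continuous_ext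
  set η := lift hcov (Γ.snd 0) with hηdef
  have hη : ∀ r, (η r).proj = Γ.ev0 r := by rw [ev0_eq_ext]; exact lift_proj hcov _
  have hη1 : ∀ r ∈ Icc (0 : ℝ) 1, IsHorizontalAt cov Γ.ev0 η r := by
    rw [ev0_eq_ext]; exact fun r hr => isHorizontalAt_lift hcov _ hr
  have hη0 : ∀ r ∈ Icc (0 : ℝ) 1, rho (η r) ≠ 0 := fun r hr => rho_lift_ne_zero hcov _ hr
  set m : ℝ → ℂ := fun s => Complex.I / ħ * (lam Ω Γ s : ℝ) with hm
  have hmc : Continuous m := by have := continuous_lam hΩ Γ; fun_prop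
  have hmi : Complex.exp (∫ s in (0 : ℝ)..1, m s) = phase ħ (∫ s in (0 : ℝ)..1, lam Ω Γ s) := by
    rw [hm, intervalIntegral.integral_const_mul, intervalIntegral.integral_ofReal, phase]
  have h01 : (0 : ℝ) ∈ Icc (0 : ℝ) 1 := by simp
  have h11 : (1 : ℝ) ∈ Icc (0 : ℝ) 1 := by simp
  constructor
  · intro v
    -- The lift `η` takes values in the total space; `ηv` is the same lift as a section over
    -- `Γ.ev0`.
    let ηv : (s : ℝ) → L (Γ.ev0 s) := fun s => rho (η s) • frame L (Γ.ev0 s) (Γ.ev0 s)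
    have hηv : ∀ s, (⟨Γ.ev0 s, ηv s⟩ : TotalSpace ℂ L) = η s := by
      intro s
      refine eq_of_rho_eq (hη s).symm ?_
      have h := coord_smul (mem_base L (Γ.ev0 s)) (rho (η s)) (frame L (Γ.ev0 s) (Γ.ev0 s))
      rw [coord_frame (mem_base L _), mul_one] at h
      exact h
    set k : ℂ := rho ⟨Γ.ev0 0, v⟩ / rho (η 0) with hk
    have hx : ∀ s, (⟨Γ.ev0 s, (k * Complex.exp (∫ t in (0 : ℝ)..s, m t)) • ηv s⟩ : TotalSpace ℂ L)
        = smulT (k * Complex.exp (∫ t in (0 : ℝ)..s, m t)) (η s) := by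
      intro s
      rw [← hηv s]
      rfl
    -- The exponential absorbs the term `-√-1 ħ⁻¹λ` of the connection, and `k` adjusts the initial
    -- value to `v`.
    refine ⟨fun s => (k * Complex.exp (∫ t in (0 : ℝ)..s, m t)) • ηv s, ?_, ?_⟩
    · rw [isParallel_iff hΩ]
      intro s hs
      simp only [hx]
      have h1 := ((hasDerivAt_exp_integral hmc 0 s).const_mul k).hasDerivWithinAt (s := Icc 0 1)
      have h2 := h1.mul (hη1 s hs (Γ.ev0 s) (mem_base L _))
      have he : ∀ q, Γ.ev0 q ∈ base L (Γ.ev0 s) →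
          coord (Γ.ev0 s) (smulT (k * Complex.exp (∫ t in (0 : ℝ)..q, m t)) (η q))
          = k * Complex.exp (∫ t in (0 : ℝ)..q, m t) * coord (Γ.ev0 s) (η q) :=
        fun q hq => coord_smulT _ (by rwa [hη q])
      refine (h2.congr_of_eventuallyEq ?_ (he s (mem_base L _))).congr_deriv ?_
      · filter_upwards [hcc.continuousWithinAt ((isOpen_base L (Γ.ev0 s)).mem_nhds
          (mem_base L (Γ.ev0 s)))] with q hq
        exact he q hq
      · rw [he s (mem_base L _)]
        ring
    · have h1 : (⟨Γ.ev0 0, (k * Complex.exp (∫ t in (0 : ℝ)..0, m t)) • ηv 0⟩ : TotalSpace ℂ L)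
          = ⟨Γ.ev0 0, v⟩ := by
        rw [hx]
        refine eq_of_rho_eq (hη 0) ?_
        rw [rho_smulT, intervalIntegral.integral_same, Complex.exp_zero, mul_one, hk,
          div_mul_cancel₀ _ (hη0 0 h01)]
      exact TotalSpace.mk_injective _ h1
  · intro ξ hξ
    rw [isParallel_iff hΩ] at hξ
    -- The quotient of an arbitrary parallel section by `η` solves the scalar equation with
    -- coefficient `m`, which determines its value at `1`.
    have h1 := eq_exp_integral_of_hasDerivWithinAt
      (f := fun q => rho ⟨Γ.ev0 q, ξ q⟩ / rho (η q)) zero_le_one hmc.continuousOn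
      (fun s hs => hasDerivWithinAt_rho_div hcc.continuousWithinAt (fun _ => rfl) hη
        (mem_base L (Γ.ev0 s)) (hξ s hs) (hη1 s hs) (hη0 s hs))
    rw [hmi, div_eq_iff (hη0 1 h11)] at h1
    refine eq_of_rho_eq hloop ?_
    have h2 := rho_smulT (transport hcov (Γ.snd 0) 0 1 * phase ħ (∫ s in (0 : ℝ)..1, lam Ω Γ s))
      (⟨Γ.ev0 0, ξ 0⟩ : TotalSpace ℂ L)
    refine h1.trans (Eq.trans ?_ h2.symm)
    rw [transport, ← hηdef]
    ring

/-- The holonomy is unique. -/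
theorem HasHolonomy.unique {h h' : ℂ} (h1 : HasHolonomy cov ħ Ω Γ h)
    (h2 : HasHolonomy cov ħ Ω Γ h') : h = h' := by
  obtain ⟨ξ, hξ, hv⟩ := h1.1 (frame L (Γ.ev0 0) (Γ.ev0 0))
  have h3 := (h1.2 ξ hξ).symm.trans (h2.2 ξ hξ)
  have h4 := TotalSpace.mk_injective _ h3
  rw [hv] at h4
  exact smul_right_injective_of_ne_zero (frame_ne_zero (mem_base L _)) h4

/-- The holonomy, in terms of continuous logarithms of the transports around the longitudinal
loops. -/
theorem hasHolonomy_of_transport_eq_phase (hħ : 0 < ħ) (hΩ : IsSymplectic Ω)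
    (hcurv : HasCurvature cov ħ Ω) (hΓ : Γ.IsLoop) {g : ℝ → ℝ} (hg : ContinuousOn g (Icc 0 1))
    (h : ∀ t ∈ Icc (0 : ℝ) 1, transport hcov (Γ.snd (clamp t)) 0 1 = phase ħ (g t)) :
    HasHolonomy cov ħ Ω Γ (phase ħ (∫ t in (0 : ℝ)..1, g t)) := by
  have h01 : (0 : ℝ) ∈ Icc (0 : ℝ) 1 := by simp
  have h0 : transport hcov (Γ.snd 0) 0 1 = phase ħ (g 0) := by
    have := h 0 h01
    rwa [clamp_zero] at this
  have hper : 2 * Real.pi * ħ ≠ 0 := by positivity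
  -- Comparing transports gives this only modulo `2πħ`. The error divided by `2πħ` is continuous and
  -- integer-valued on an interval, and vanishes at `0`.
  have hconst : ∀ t ∈ Icc (0 : ℝ) 1, g t = g 0 - flux Ω Γ t := by
    intro t ht
    have h1 := isPreconnected_Icc.constant_of_mapsTo (S := Icc (0 : ℝ) 1)
      (T := range ((↑) : ℤ → ℝ)) (f := fun t => (flux Ω Γ t + g t - g 0) / (2 * Real.pi * ħ))
      (Int.isClosedEmbedding_coe_real.isEmbedding.isDiscrete_range)
      ((((continuous_flux hΩ Γ).continuousOn.add hg).sub continuousOn_const).div_const _)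
      (fun t ht => by
        have h2 := transport_snd_of_isLoop hcov hΩ hcurv hΓ ht
        rw [h t ht, h0, ← phase_add] at h2
        obtain ⟨n, hn⟩ := exists_int_of_phase_eq hħ h2.symm
        refine ⟨n, ?_⟩
        rw [eq_div_iff hper]
        exact Eq.trans (by ring) hn.symm) ht h01
    simp only [flux_zero, zero_add, sub_self, zero_div] at h1
    rw [div_eq_zero_iff, or_iff_left hper] at h1
    linarith
  have hint : ∫ t in (0 : ℝ)..1, g t = g 0 + ∫ s in (0 : ℝ)..1, lam Ω Γ s := by
    rw [integral_lam hΩ, intervalIntegral.integral_congr (g := fun t => g 0 - flux Ω Γ t)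
      (fun t ht => hconst t (by rwa [uIcc_of_le zero_le_one] at ht)),
      intervalIntegral.integral_sub (by simp) ((continuous_flux hΩ Γ).intervalIntegrable _ _)]
    simp [sub_eq_add_neg]
  rw [hint, phase_add, ← h0]
  exact hasHolonomy_transport hcov hΩ hΓ

end Holonomy

/-! ### Line integrals of a symplectic potential -/

section LineIntegrals

variable {E : Type*} [NormedAddCommGroup E] [NormedSpace ℝ E] [FiniteDimensional ℝ E]
  {M : Type*} [TopologicalSpace M] [ChartedSpace E M] [IsManifold 𝓘(ℝ, E) ∞ M]
  {Ω : BilinForm E M} {θ : OneForm E M} {U : Set M}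

theorem squareIntegral_eq_lineIntegral (hΩ : IsSymplectic Ω) (hU : IsOpen U)
    (hθ : IsPotentialOn Ω θ U) (u : SmoothSquare E M) (hu : ∀ a b, u.toFun a b ∈ U) :
    lineIntegral θ (u.snd 0) + lineIntegral θ (u.fst 1) - lineIntegral θ (u.snd 1)
      - lineIntegral θ (u.fst 0) = squareIntegral Ω u := by
  rw [squareIntegral_eq, ← hθ.stokes hΩ hU u hu le_rfl zero_le_one le_rfl le_rfl zero_le_one le_rfl,
    ← clamp_zero, ← clamp_one]
  rfl

/-- Stokes on `[0,1] × [0,t]`, where the transverse edges cancel. This is the additive counterpart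
of `transport_snd_of_isLoop`. -/
theorem lineIntegral_snd_of_isLoop (hΩ : IsSymplectic Ω) (hU : IsOpen U)
    (hθ : IsPotentialOn Ω θ U) {Γ : SmoothSquare E M} (hΓ : Γ.IsLoop)
    (hΓU : ∀ s t, Γ.toFun s t ∈ U) {t : ℝ} (ht : t ∈ Icc (0 : ℝ) 1) :
    lineIntegral θ (Γ.snd (clamp t)) = lineIntegral θ (Γ.snd (clamp 0)) - flux Ω Γ t := by
  have h := hθ.stokes hΩ hU Γ hΓU le_rfl zero_le_one le_rfl le_rfl ht.1 ht.2
  have h1 : (∫ b in (0 : ℝ)..t, θ (Γ.ext' 1 b) (Γ.e2 (1, b)))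
      = ∫ b in (0 : ℝ)..t, θ (Γ.ext' 0 b) (Γ.e2 (0, b)) :=
    congrArg (fun γ : SmoothPath E M => ∫ b in (0 : ℝ)..t, θ (γ.ext' b) (vel E γ.ext' b))
      (show Γ.fst (clamp 1) = Γ.fst (clamp 0) by rw [clamp_zero, clamp_one]; exact hΓ.symm)
  have h2 : ∀ t, lineIntegral θ (Γ.snd (clamp t))
      = ∫ a in (0 : ℝ)..1, θ (Γ.ext' a t) (Γ.e1 (a, t)) := fun t => rfl
  rw [h1] at h
  rw [h2, h2, flux, ← h]
  ring

/-- A one-form which is continuous on an open set can be cut off. -/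
theorem continuousAt_formInChart_smul {α : M → E →L[ℝ] ℝ}
    (hα : ∀ x ∈ U, ContinuousAt (formInChart α x) (chartMap E x x)) {χ : M → ℝ}
    (hχ : Continuous χ) (h0 : ∀ x, x ∉ U → ∀ᶠ y in 𝓝 x, χ y = 0) (x : M) :
    ContinuousAt (formInChart (fun y => χ y • α y) x) (chartMap E x x) := by
  have hs := continuousAt_extChartAt_symm (I := 𝓘(ℝ, E)) x
  have he : ∀ z, formInChart (fun y => χ y • α y) x z
      = χ ((extChartAt 𝓘(ℝ, E) x).symm z) • formInChart α x z := fun z =>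
    ContinuousLinearMap.smul_comp _ _ _
  rw [continuousAt_congr (Eventually.of_forall he)]
  by_cases hx : x ∈ U
  · have h1 : ContinuousAt (fun z => χ ((extChartAt 𝓘(ℝ, E) x).symm z)) (chartMap E x x) :=
      hχ.continuousAt.comp hs
    exact h1.smul (hα x hx)
  · have h2 : ∀ᶠ z in 𝓝 (chartMap E x x), χ ((extChartAt 𝓘(ℝ, E) x).symm z) = 0 :=
      hs.eventually (p := fun y => χ y = 0) (by rw [extChartAt_to_inv]; exact h0 x hx)
    refine (continuousAt_const (y := (0 : E →L[ℝ] ℝ))).congr ?_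
    filter_upwards [h2] with z hz
    rw [hz, zero_smul]

variable [T2Space M]

/-- Vanishing near every point outside `U`, and not merely at it, makes the cut-off form continuous
even though the potential is arbitrary off `U`. -/
theorem exists_continuous_cutoff [LocallyCompactSpace M] {K : Set M} (hK : IsCompact K)
    (hU : IsOpen U) (hKU : K ⊆ U) :
    ∃ χ : M → ℝ, Continuous χ ∧ (∀ x ∈ K, χ x = 1) ∧ ∀ x, x ∉ U → ∀ᶠ y in 𝓝 x, χ y = 0 := by
  obtain ⟨C, -, hCc, hKC, hCU⟩ := exists_compact_closed_between hK hU hKU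
  obtain ⟨χ, hχ1, hχ0, -, -⟩ := exists_continuous_one_zero_of_isCompact hK
    isOpen_interior.isClosed_compl (disjoint_compl_right_iff_subset.2 hKC)
  refine ⟨χ, χ.continuous, fun x hx => hχ1 hx, fun x hx => ?_⟩
  filter_upwards [hCc.isOpen_compl.mem_nhds fun h => hx (hCU h)] with y hy
  exact hχ0 fun h => hy (interior_subset h)

/-- Stokes' theorem for a loop spanned by a surface in the domain of a symplectic potential. -/
theorem lineIntegral_eq_surfaceIntegral (hΩ : IsSymplectic Ω) (hU : IsOpen U)
    (hθ : IsPotentialOn Ω θ U) {S : OrientedSurface E M} {γ : SmoothPath E M} (hS : Spans S γ)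
    (hSU : ∀ u ∈ S, ∀ a b, u.toFun a b ∈ U) (hγ : ∀ t, γ.toFun t ∈ U) :
    lineIntegral θ γ = surfaceIntegral Ω S := by
  let K : Set M := (⋃ u ∈ {u | u ∈ S}, (fun p : ℝ × ℝ => u.ext' p.1 p.2) '' unitSquare)
    ∪ γ.ext' '' Icc 0 1
  have hK : IsCompact K := by
    refine IsCompact.union (S.finite_toSet.isCompact_biUnion fun u _ => ?_)
      (isCompact_Icc.image γ.continuous_ext)
    exact (isCompact_Icc.prod isCompact_Icc).image u.continuous_ext
  have hKU : K ⊆ U := by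
    refine union_subset (iUnion₂_subset fun u hu => ?_) ?_
    · rintro _ ⟨p, -, rfl⟩
      exact hSU u hu _ _
    · rintro _ ⟨t, -, rfl⟩
      exact hγ _
  have : LocallyCompactSpace M := Manifold.locallyCompact_of_finiteDimensional 𝓘(ℝ, E)
  obtain ⟨χ, hχ, hχ1, hχ0⟩ := exists_continuous_cutoff hK hU hKU
  -- The relations that make the boundary of `S` equal to `γ` may involve paths leaving `U`, so the
  -- line integral must be defined on all chains of `M`. Continuity of the form suffices for that;
  -- Stokes is applied only to the patches, where the cut-off is `1`.
  let α : M → E →L[ℝ] ℝ := fun x => χ x • (θ x : E →L[ℝ] ℝ)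
  have hα : ∀ x, ContinuousAt (formInChart α x) (chartMap E x x) :=
    continuousAt_formInChart_smul (U := U) (α := fun x => (θ x : E →L[ℝ] ℝ))
      (fun x hx => (hθ.1.contDiffAt hU hx).continuousAt) hχ hχ0
  obtain ⟨Φ, hΦ⟩ := exists_chainHom (E := E) (M := M)
    (fun γ => ∫ r in (0 : ℝ)..1, α (γ.ext' r) (vel E γ.ext' r))
    (fun γ t => ∫ r in (0 : ℝ)..t, α (γ.ext' r) (vel E γ.ext' r))
    (fun p q φ hφ h => integral_reparam hα hφ h)
  have hline : ∀ γ : SmoothPath E M, (∀ t ∈ Icc (0 : ℝ) 1, γ.ext' t ∈ K) →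
      Φ γ.chain = lineIntegral θ γ := by
    intro γ hγ
    rw [hΦ]
    refine intervalIntegral.integral_congr fun t ht => ?_
    rw [uIcc_of_le zero_le_one] at ht
    have h1 : χ (γ.ext' t) = 1 := hχ1 _ (hγ t ht)
    have h2 : α (γ.ext' t) = (θ (γ.ext' t) : E →L[ℝ] ℝ) := by
      simp only [α, h1]
      exact one_smul ℝ _
    exact congrArg (fun A : E →L[ℝ] ℝ => A (vel E γ.ext' t)) h2
  rw [← hline γ fun t ht => Or.inr ⟨t, ht, rfl⟩, ← hS,
    map_surfaceBoundary Φ (AddMonoidHom.id ℝ) Ω S]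
  · rfl
  intro u hu
  have hmem : ∀ p ∈ unitSquare, u.ext' p.1 p.2 ∈ K := fun p hp =>
    Or.inl (mem_biUnion (show u ∈ {u | u ∈ S} from hu) ⟨p, hp, rfl⟩)
  have hsnd : ∀ b, Φ (u.snd b).chain = lineIntegral θ (u.snd b) := fun b => hline _ fun t ht => by
    have := hmem (t, b) ⟨ht, b.2⟩
    rwa [SmoothSquare.ext', clamp_coe] at this
  have hfst : ∀ a, Φ (u.fst a).chain = lineIntegral θ (u.fst a) := fun a => hline _ fun t ht => by
    have := hmem (a, t) ⟨a.2, ht⟩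
    rwa [SmoothSquare.ext', clamp_coe] at this
  have e : Φ u.boundary = Φ (u.snd 0).chain + Φ (u.fst 1).chain - Φ (u.snd 1).chain
      - Φ (u.fst 0).chain := by
    simp only [SmoothSquare.boundary, map_sub, map_add]
  rw [e, hsnd, hsnd, hfst, hfst, squareIntegral_eq_lineIntegral hΩ hU hθ u (hSU u hu)]
  rfl

end LineIntegrals

/-! ### Holonomy in the domain of a potential -/

section Potential

variable {E : Type*} [NormedAddCommGroup E] [NormedSpace ℝ E] [FiniteDimensional ℝ E]
  {M : Type*} [TopologicalSpace M] [T2Space M] [ChartedSpace E M] [IsManifold 𝓘(ℝ, E) ∞ M]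
  {L : M → Type*} [TopologicalSpace (TotalSpace ℂ L)] [∀ x, TopologicalSpace (L x)]
  [∀ x, AddCommGroup (L x)] [∀ x, Module ℂ (L x)]
  [∀ x, IsTopologicalAddGroup (L x)] [∀ x, ContinuousSMul ℝ (L x)]
  [FiberBundle ℂ L] [VectorBundle ℂ ℂ L] [VectorBundle ℝ ℂ L]
  [ContMDiffVectorBundle ∞ ℂ L 𝓘(ℝ, E)]
  {cov : CovariantDerivative 𝓘(ℝ, E) ℂ L} (hcov : IsSmoothComplexConnection cov)
  {ħ : ℝ} {Ω : BilinForm E M} {θ : OneForm E M} {U : Set M}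

/-- The transport around a loop on which the connection is `d - √-1 ħ⁻¹θ`. -/
theorem transport_eq_phase_lineIntegral (hU : IsOpen U) (hθ : θ.SmoothOn U)
    (h : IsConnectionFormOn cov ħ θ U) {γ : SmoothPath E M} (hγ : ∀ t, γ.toFun t ∈ U)
    (hloop : γ.toFun 0 = γ.toFun 1) :
    transport hcov γ 0 1 = phase ħ (lineIntegral θ γ) := by
  obtain ⟨σ, hσ, hσ0, hσθ⟩ := h
  let α : M → E →L[ℝ] ℝ := fun x => θ x
  have hγU : ∀ r, γ.ext' r ∈ U := fun r => hγ _
  obtain ⟨b, hb, hbα⟩ := exists_continuous_eqOn_Icc (a := fun r => α (γ.ext' r) (vel E γ.ext' r))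
    zero_le_one fun r hr => continuousWithinAt_apply_vel hr γ.contMDiffOn_ext
      (hθ.contDiffAt hU (hγU r)).continuousAt
  set m : ℝ → ℂ := fun r => Complex.I / ħ * (b r : ℝ) with hm
  have hmc : Continuous m := by fun_prop
  have hmi : Complex.exp (∫ r in (0 : ℝ)..1, m r) = phase ħ (lineIntegral θ γ) := by
    have : lineIntegral θ γ = ∫ r in (0 : ℝ)..1, b r :=
      intervalIntegral.integral_congr fun r hr => by
        rw [uIcc_of_le zero_le_one] at hr
        exact (hbα hr).symm
    rw [hm, intervalIntegral.integral_const_mul, intervalIntegral.integral_ofReal, phase, this]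
  -- Multiplying the section `σ` along `γ` by this factor makes it parallel, since the connection
  -- form of `σ` along `γ` is `-m`.
  let k : ℝ → ℂ := fun r => Complex.exp (∫ t in (0 : ℝ)..r, m t)
  let z : ℝ → TotalSpace ℂ L := fun r => ⟨γ.ext' r, σ (γ.ext' r)⟩
  have hz : ∀ r, rho (z r) ≠ 0 := fun r => (rho_eq_zero_iff _).not.2 (hσ0 _ (hγU r))
  have hkz : ∀ r, rho (smulT (k r) (z r)) = k r * rho (z r) := fun r => rho_smulT _ _
  have hz01 : z 0 = z 1 := by
    have : γ.ext' 0 = γ.ext' 1 := by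
      rw [SmoothPath.ext', SmoothPath.ext', clamp_zero, clamp_one, hloop]
    simp only [z]
    rw [this]
  rw [transport_eq_of_isHorizontalAt hcov γ (η := fun r => smulT (k r) (z r)) (fun _ => rfl) ?_
    (by simp) (by simp) (by rw [hkz]; exact mul_ne_zero (Complex.exp_ne_zero _) (hz 0)), hkz, hkz,
    hz01, mul_div_mul_right _ _ (hz 1), ← hmi]
  · simp [k]
  intro r hr
  refine isHorizontalAt_of_section hcov (γ.contMDiffOn_ext r hr)
    (b := -m r) (((hσ.contMDiffAt (hU.mem_nhds (hγU r))).mdifferentiableAt (by simp))) ?_ ?_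
  · have h1 : covE cov σ (γ.ext' r) (vel E γ.ext' r) = (-(Complex.I / (ħ : ℂ)) *
      ((α (γ.ext' r) (vel E γ.ext' r) : ℝ) : ℂ)) • σ (γ.ext' r) := hσθ _ (hγU r) _
    have h2 : b r = α (γ.ext' r) (vel E γ.ext' r) := hbα hr
    rw [h1, ← h2, hm, neg_mul]
  · rw [neg_neg]
    exact (hasDerivAt_exp_integral hmc 0 r).hasDerivWithinAt

/-- The holonomy in the domain of a symplectic potential. -/
theorem hasHolonomy_lineIntegral (hħ : 0 < ħ) (hΩ : IsSymplectic Ω) (hcurv : HasCurvature cov ħ Ω)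
    {Γ : SmoothSquare E M} (hΓ : Γ.IsLoop) (hU : IsOpen U) (hθ : IsPotentialOn Ω θ U)
    (hΓU : ∀ s t, Γ.toFun s t ∈ U) {t₀ : unitInterval}
    (h : transport hcov (Γ.snd t₀) 0 1 = phase ħ (lineIntegral θ (Γ.snd t₀))) :
    HasHolonomy cov ħ Ω Γ
      (phase ħ (∫ t in (0 : ℝ)..1, lineIntegral θ (Γ.snd (clamp t)))) := by
  have hl := fun (t : ℝ) (ht : t ∈ Icc (0 : ℝ) 1) =>
    lineIntegral_snd_of_isLoop hΩ hU hθ hΓ hΓU ht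
  have ht := fun (t : ℝ) (ht : t ∈ Icc (0 : ℝ) 1) =>
    transport_snd_of_isLoop hcov hΩ hcurv hΓ ht
  -- Transport and phase of the line integral change with `t` by the same flux, so their agreement
  -- moves from `t₀` to `0`, and below from `0` to every `t`.
  have h0 : transport hcov (Γ.snd 0) 0 1 = phase ħ (lineIntegral θ (Γ.snd (clamp 0))) := by
    have h1 := hl t₀ t₀.2
    have h2 := ht t₀ t₀.2
    rw [clamp_coe] at h1 h2
    rw [h2, h, h1, ← phase_add, flux]
    congr 1
    ring
  refine hasHolonomy_of_transport_eq_phase hcov hħ hΩ hcurv hΓ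
    (g := fun t => lineIntegral θ (Γ.snd (clamp t))) ?_ fun t ht' => ?_
  · exact (continuousOn_const.sub (continuous_flux hΩ Γ).continuousOn).congr hl
  · refine mul_left_cancel₀ (phase_ne_zero ħ (flux Ω Γ t)) ((ht t ht').symm.trans ?_)
    rw [h0, ← phase_add, hl t ht']
    congr 1
    ring

end Potential

/-! ### Continuity of areas for a smooth family of surfaces -/

section CubeIntegrals

variable {E : Type*} [NormedAddCommGroup E] [NormedSpace ℝ E] [FiniteDimensional ℝ E]
  {M : Type*} [TopologicalSpace M] [ChartedSpace E M] [IsManifold 𝓘(ℝ, E) ∞ M]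
  {Ω : BilinForm E M}

/-- The unit cube. -/
abbrev unitCube : Set (ℝ × ℝ × ℝ) := Icc (0 : ℝ) 1 ×ˢ (Icc (0 : ℝ) 1 ×ˢ Icc (0 : ℝ) 1)

theorem uniqueDiffOn_unitCube : UniqueDiffOn ℝ unitCube :=
  (uniqueDiffOn_Icc zero_lt_one).prod uniqueDiffOn_unitSquare

/-- A smooth cube, extended from `[0,1]³` to `ℝ³`. -/
def SmoothCube.ext' (G : SmoothCube E M) (p : ℝ × ℝ × ℝ) : M :=
  G.toFun (clamp p.1) (clamp p.2.1) (clamp p.2.2)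

theorem SmoothCube.contMDiffOn_ext (G : SmoothCube E M) :
    ContMDiffOn 𝓘(ℝ, ℝ × ℝ × ℝ) 𝓘(ℝ, E) ∞ G.ext' unitCube := G.smooth

/-- The partial derivatives of a slice are those of the cube in its first two variables. Reading the
whole cube in one chart gives continuity jointly with the slice parameter. -/
theorem continuousOn_density_slice (hΩ : IsSymplectic Ω) (G : SmoothCube E M) :
    ContinuousOn (fun p : ℝ × ℝ × ℝ => Ω.density (G.slice (clamp p.2.2)) (p.1, p.2.1))
      unitCube := by
  intro p hp
  set x := G.ext' p with hxdef
  have hx : G.ext' p ∈ (extChartAt 𝓘(ℝ, E) x).source := mem_extChartAt_source x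
  have hU := contDiffWithinAt_chartMap_comp (x := x) (G.contMDiffOn_ext p hp) hx
  have hfd : ∀ v, ContinuousWithinAt
      (fun q => fderivWithin ℝ (fun q => chartMap E x (G.ext' q)) unitCube q v) unitCube p :=
    fun v => (hU.fderivWithin_right (m := ∞) uniqueDiffOn_unitCube
      (by simp) hp).continuousWithinAt.clm_apply continuousWithinAt_const
  have hd : ContinuousWithinAt (fun q => Ω.chartForm x (chartMap E x (G.ext' q))) unitCube p :=
    ContinuousAt.comp_continuousWithinAt (f := fun q => chartMap E x (G.ext' q))
      (hΩ.continuousAt_chartForm x) hU.continuousWithinAt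
  have key : ∀ q ∈ unitCube, G.ext' q ∈ (extChartAt 𝓘(ℝ, E) x).source →
      Ω.density (G.slice (clamp q.2.2)) (q.1, q.2.1)
        = Ω.chartForm x (chartMap E x (G.ext' q))
          (fderivWithin ℝ (fun q => chartMap E x (G.ext' q)) unitCube q (1, 0, 0))
          (fderivWithin ℝ (fun q => chartMap E x (G.ext' q)) unitCube q (0, 1, 0)) := by
    intro q hq hqx
    have e1 := vel_comp_eq_symmDeriv (ℓ := fun r : ℝ => (r, q.2.1, q.2.2)) hq.1
      (G.contMDiffOn_ext q hq) (contDiff_id.prodMk contDiff_const)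
      ((hasDerivWithinAt_id _ _).prodMk (hasDerivWithinAt_const _ _ _))
      (fun _ hr => ⟨hr, hq.2⟩) hqx
    have e2 := vel_comp_eq_symmDeriv (ℓ := fun r : ℝ => (q.1, r, q.2.2)) hq.2.1
      (G.contMDiffOn_ext q hq) (contDiff_const.prodMk (contDiff_id.prodMk contDiff_const))
      ((hasDerivWithinAt_const _ _ _).prodMk
        ((hasDerivWithinAt_id _ _).prodMk (hasDerivWithinAt_const _ _ _)))
      (fun _ hr => ⟨hq.1, hr, hq.2.2⟩) hqx
    rw [Ω.chartForm_chartMap hqx]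
    exact congrArg₂ (fun v w => Ω.app E (G.ext' q) v w) e1 e2
  refine ((hd.clm_apply (hfd (1, 0, 0))).clm_apply (hfd (0, 1, 0))).congr_of_eventuallyEq ?_
    (key p hp hx)
  filter_upwards [(G.contMDiffOn_ext p hp).continuousWithinAt
    ((isOpen_extChartAt_source x).mem_nhds hx), self_mem_nhdsWithin] with q hq hq1
  exact key q hq1 hq

theorem continuous_squareIntegral_slice (hΩ : IsSymplectic Ω) (G : SmoothCube E M) :
    Continuous fun t : unitInterval => squareIntegral Ω (G.slice t) := by
  have hcl : Continuous fun r : ℝ => (clamp r : ℝ) := continuous_subtype_val.comp continuous_clamp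
  have h1 : Continuous fun p : ℝ × ℝ × ℝ => Ω.densityC (G.slice (clamp p.2.2)) (p.1, p.2.1) := by
    have h2 := (continuousOn_density_slice hΩ G).comp_continuous
      (f := fun p : ℝ × ℝ × ℝ => ((clamp p.1 : ℝ), (clamp p.2.1 : ℝ), (clamp p.2.2 : ℝ)))
      (by fun_prop) (fun p => ⟨(clamp p.1).2, (clamp p.2.1).2, (clamp p.2.2).2⟩)
    refine h2.congr fun p => ?_
    simp only [Function.comp_apply, clamp_clamp, BilinForm.densityC]
  have h2 : Continuous fun p : ℝ × ℝ => ∫ b in (0 : ℝ)..1,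
      Ω.densityC (G.slice (clamp p.1)) (p.2, b) :=
    intervalIntegral.continuous_parametric_intervalIntegral_of_continuous'
      (f := fun (p : ℝ × ℝ) b => Ω.densityC (G.slice (clamp p.1)) (p.2, b))
      (h1.comp (f := fun q : (ℝ × ℝ) × ℝ => (q.1.2, q.2, q.1.1)) (by fun_prop)) 0 1
  have h3 : Continuous fun t : ℝ => ∫ a in (0 : ℝ)..1, ∫ b in (0 : ℝ)..1,
      Ω.densityC (G.slice (clamp t)) (a, b) :=
    intervalIntegral.continuous_parametric_intervalIntegral_of_continuous'
      (f := fun t a => ∫ b in (0 : ℝ)..1, Ω.densityC (G.slice (clamp t)) (a, b)) h2 0 1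
  refine (h3.comp continuous_subtype_val).congr fun t => ?_
  rw [squareIntegral_eq, Function.comp_apply, clamp_coe]

end CubeIntegrals

/-! ### Holonomy for spanning families -/

section Spanning

variable {E : Type*} [NormedAddCommGroup E] [NormedSpace ℝ E] [FiniteDimensional ℝ E]
  {M : Type*} [TopologicalSpace M] [T2Space M] [ChartedSpace E M] [IsManifold 𝓘(ℝ, E) ∞ M]
  {L : M → Type*} [TopologicalSpace (TotalSpace ℂ L)] [∀ x, TopologicalSpace (L x)]
  [∀ x, AddCommGroup (L x)] [∀ x, Module ℂ (L x)]
  [∀ x, IsTopologicalAddGroup (L x)] [∀ x, ContinuousSMul ℝ (L x)]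
  [FiberBundle ℂ L] [VectorBundle ℂ ℂ L] [VectorBundle ℝ ℂ L]
  [ContMDiffVectorBundle ∞ ℂ L 𝓘(ℝ, E)]
  {cov : CovariantDerivative 𝓘(ℝ, E) ℂ L} {ħ : ℝ} {Ω : BilinForm E M} {Γ : SmoothSquare E M}

/-- The holonomy around a loop of paths whose longitudinal loops are spanned by surfaces. -/
theorem hasHolonomy_familyIntegral (hcov : IsSmoothComplexConnection cov) (hħ : 0 < ħ)
    (hΩ : IsSymplectic Ω) (hcurv : HasCurvature cov ħ Ω) (hΓ : Γ.IsLoop)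
    {S : unitInterval → OrientedSurface E M} (hS : IsSpanningFamily Ω Γ S) :
    HasHolonomy cov ħ Ω Γ (phase ħ (familyIntegral Ω S)) :=
  hasHolonomy_of_transport_eq_phase hcov hħ hΩ hcurv hΓ
    (hS.2.comp continuous_clamp).continuousOn
    fun t _ => transport_eq_phase_of_spans hcov hΩ hcurv (hS.1 (clamp t))

end Spanning

end PathHol

end

/-! ### The theorem -/

theorem mainTheorem6
    {E : Type*} [NormedAddCommGroup E] [NormedSpace ℝ E] [FiniteDimensional ℝ E]
    {M : Type*} [TopologicalSpace M] [T2Space M] [ChartedSpace E M] [IsManifold 𝓘(ℝ, E) ∞ M]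
    {L : M → Type*} [TopologicalSpace (TotalSpace ℂ L)] [∀ x, TopologicalSpace (L x)]
    [∀ x, AddCommGroup (L x)] [∀ x, Module ℂ (L x)]
    [∀ x, IsTopologicalAddGroup (L x)] [∀ x, ContinuousSMul ℝ (L x)]
    [FiberBundle ℂ L] [VectorBundle ℂ ℂ L] [VectorBundle ℝ ℂ L]
    [ContMDiffVectorBundle ∞ ℂ L 𝓘(ℝ, E)]
    (ħ : ℝ) (hħ : 0 < ħ)
    (Ω : PathHol.BilinForm E M) (hΩ : PathHol.IsSymplectic Ω)
    (cov : CovariantDerivative 𝓘(ℝ, E) ℂ L) (hcov : PathHol.IsSmoothComplexConnection cov)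
    (hcurv : PathHol.HasCurvature cov ħ Ω)
    (Γ : PathHol.SmoothSquare E M) (hΓ : Γ.IsLoop) :
    -- the loop lies in one domain of a local symplectic potential
    (∀ (U : Set M) (θ : PathHol.OneForm E M), IsOpen U → PathHol.IsPotentialOn Ω θ U →
      (∀ s t, Γ.toFun s t ∈ U) →
      (PathHol.IsConnectionFormOn cov ħ θ U ∨
        ∃ (t : unitInterval) (S : PathHol.OrientedSurface E M),
          PathHol.Spans S (Γ.snd t) ∧ ∀ u ∈ S, ∀ a b, u.toFun a b ∈ U) →
      PathHol.HasHolonomy cov ħ Ω Γ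
        (PathHol.phase ħ (∫ t in (0 : ℝ)..1, PathHol.lineIntegral θ (Γ.snd (PathHol.clamp t))))) ∧
    -- the general case
    (∀ S : unitInterval → PathHol.OrientedSurface E M, PathHol.IsSpanningFamily Ω Γ S →
      PathHol.HasHolonomy cov ħ Ω Γ (PathHol.phase ħ (PathHol.familyIntegral Ω S))) ∧
    -- in particular for a smooth parametrized surface in the path space spanning the loop
    (∀ G : PathHol.SmoothCube E M, (∀ t, PathHol.Spans [G.slice t] (Γ.snd t)) →
      PathHol.HasHolonomy cov ħ Ω Γ
        (PathHol.phase ħ (PathHol.familyIntegral Ω (fun t => [G.slice t])))) ∧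
    -- independence of the spanning surfaces
    (∀ (t : unitInterval) (S S' : PathHol.OrientedSurface E M),
      PathHol.Spans S (Γ.snd t) → PathHol.Spans S' (Γ.snd t) →
      ∃ n : ℤ, PathHol.surfaceIntegral Ω S - PathHol.surfaceIntegral Ω S'
        = 2 * Real.pi * n * ħ) ∧
    (∀ S S' : unitInterval → PathHol.OrientedSurface E M,
      PathHol.IsSpanningFamily Ω Γ S → PathHol.IsSpanningFamily Ω Γ S' →
      PathHol.phase ħ (PathHol.familyIntegral Ω S)
        = PathHol.phase ħ (PathHol.familyIntegral Ω S')) := by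
  have hspan : ∀ S : unitInterval → PathHol.OrientedSurface E M, PathHol.IsSpanningFamily Ω Γ S →
      PathHol.HasHolonomy cov ħ Ω Γ (PathHol.phase ħ (PathHol.familyIntegral Ω S)) := fun S hS =>
    PathHol.hasHolonomy_familyIntegral hcov hħ hΩ hcurv hΓ hS
  refine ⟨fun U θ hU hθ hΓU h => ?_, hspan, fun G hG => hspan _ ⟨hG, ?_⟩, fun t S S' hS hS' => ?_,
    fun S S' hS hS' => (hspan S hS).unique (hspan S' hS')⟩
  · rcases h with h | ⟨t, S, hS, hSU⟩
    · refine PathHol.hasHolonomy_lineIntegral hcov hħ hΩ hcurv hΓ hU hθ hΓU (t₀ := 0) ?_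
      exact PathHol.transport_eq_phase_lineIntegral hcov hU hθ.1 h (fun s => hΓU s 0)
        (congrArg (fun γ : PathHol.SmoothPath E M => γ.toFun 0) hΓ)
    · refine PathHol.hasHolonomy_lineIntegral hcov hħ hΩ hcurv hΓ hU hθ hΓU (t₀ := t) ?_
      rw [PathHol.transport_eq_phase_of_spans hcov hΩ hcurv hS,
        PathHol.lineIntegral_eq_surfaceIntegral hΩ hU hθ hS hSU fun s => hΓU s t]
  · simpa [PathHol.surfaceIntegral] using PathHol.continuous_squareIntegral_slice hΩ G
  · refine PathHol.exists_int_of_phase_eq hħ ?_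
    rw [← PathHol.transport_eq_phase_of_spans hcov hΩ hcurv hS,
      ← PathHol.transport_eq_phase_of_spans hcov hΩ hcurv hS']
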